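/- **Setting.** A *Hopf–von Neumann algebra* is a pair $\mathbb G=(L^\infty(\mathbb G),\Delta)$, where $L^\infty(\mathbb G)$ is a von Neumann algebra and $\Delta:L^\infty(\mathbb G)\to L^\infty(\mathbb G)\bar\otimes L^\infty(\mathbb G)$ is a unital normal $*$-homomorphism with $(\Delta\otimes\mathrm{id})\Delta=(\mathrm{id}\otimes\Delta)\Delta$. Let $L^1(\mathbb G)$ be the predual of $L^\infty(\mathbb G)$, with the convolution $\theta*\psi:=(\theta\otimes\psi)\circ\Delta$; its positive elements of norm one are called states. An *action* of $\mathbb G$ on a von Neumann algebra $N$ is a unital normal $*$-homomorphism $\alpha:N\to N\bar\otimes L^\infty(\mathbb G)$ with $(\alpha\otimes\mathrm{id})\alpha=(\mathrm{id}\otimes\Delta)\alpha$. Let $\omega$ be a faithful normal state of $N$ that is $\alpha$-invariant, i.e. $(\omega\otimes\mathrm{id})\alpha(a)=\omega(a)\mathbf 1$ for all $a\in N$, and let $\Gamma:N\to\mathcal H$ be the GNS map of $(N,\omega)$. Let $C$ be a von Neumann algebra and let $u\in C\bar\otimes L^\infty(\mathbb G)$ be a unitary co-representation of $\mathbb G$,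 i.e. $u$ is unitary and $(\mathrm{id}\otimes\Delta)(u)=u_{12}u_{13}$ (leg notation). Fix a positive normal functional $\mu\in C_*^+$ with GNS map $\Gamma_\mu:C\to\mathcal H_\mu$, and let $\Xi:=\Gamma_\mu\otimes\Gamma: C\bar\otimes N\to\mathcal H_\mu\otimes\mathcal H$ be the GNS map of $\mu\otimes\omega$. Let $(m_\kappa)$ be a net of states in $L^1(\mathbb G)$ which is *approximately invariant*: for each state $\theta\in L^1(\mathbb G)$ we have $\|m_\kappa*\theta-m_\kappa\|\to0$, and $\theta*m_\kappa-m_\kappa\to0$ in the $\sigma(L^1(\mathbb G),L^\infty(\mathbb G))$-topology. **Theorem.** 0. For every $\theta\in L^1(\mathbb G)^+$ and $a\in C\bar\otimes N$, the element $(\mathrm{id}\otimes\mathrm{id}\otimes\theta)\bigl(u_{13}\,(\mathrm{id}\otimes\alpha)(a)\bigr)$ lies in $C\bar\otimes N$, and there is a unique bounded operator $V_u(\theta)$ on $\mathcal H_\mu\otimes\mathcal H$ with $$V_u(\theta)\,\Xi(a)=\Xi\bigl[(\mathrm{id}\otimes\mathrm{id}\otimes\theta)\bigl(u_{13}\,(\mathrm{id}\otimes\alpha)(a)\bigr)\bigr]\qquad(a\in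 C\bar\otimes N).$$ Let $P_u$ be the orthogonal projection of $\mathcal H_\mu\otimes\mathcal H$ onto $\bigcap_{\theta}\ker(V_u(\theta)-\mathbf 1)$, the intersection being over all states $\theta$ in $L^1(\mathbb G)$. 1. $V_u(m_\kappa)\to P_u$ strongly. 2. Suppose that $\mu$ is faithful. There exists a unique projection (idempotent linear map) $E_u$ from $C\bar\otimes N$ onto the subspace $$N_u:=\{b\in C\bar\otimes N:\ (\mathrm{id}\otimes\alpha)(b)=u_{13}^*\,b_{12}\}$$ satisfying $\Xi\circ E_u=P_u\circ\Xi$. Furthermore, $E_u$ is bounded and normal, it has norm $1$ unless $E_u=0$, for every $a\in C\bar\otimes N$ and every approximately invariant net $(m_\kappa)$ of states in $L^1(\mathbb G)$ $$(\mathrm{id}\otimes\mathrm{id}\otimes m_\kappa)\bigl[u_{13}\,(\mathrm{id}\otimes\alpha)(a)\bigr]\to E_u(a)\quad\text{strongly},$$ and $\overline{\Xi(N_u)}=\operatorname{Im}P_u$. -/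

import Mathlib

open scoped InnerProductSpace TensorProduct ComplexOrder
set_option linter.unusedSectionVars false

noncomputable section

namespace QErg


section Algebras
variable {H : Type*} [NormedAddCommGroup H] [InnerProductSpace ℂ H] [CompleteSpace H]

instance isClosed_vonNeumann (M : VonNeumannAlgebra H) : IsClosed (M : Set (H →L[ℂ] H)) := by
  rw [← M.centralizer_centralizer]; exact Set.isClosed_centralizer _

instance smulMemClass_vonNeumann : SMulMemClass (VonNeumannAlgebra H) ℂ (H →L[ℂ] H) where
  smul_mem {M} c _ hx := M.toStarSubalgebra.smul_mem hx c

instance starOrderedRing_vonNeumann (M : VonNeumannAlgebra H) : StarOrderedRing M :=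
  StarOrderedRing.of_nonneg_iff'
    (fun {_ _} hxy z => add_le_add_right (α := H →L[ℂ] H) hxy z) <| fun x => by
    constructor
    · intro hx
      have hx' : (0 : H →L[ℂ] H) ≤ x := hx
      have hs : 0 ≤ CFC.sqrt (x : H →L[ℂ] H) := CFC.sqrt_nonneg _
      refine ⟨⟨CFC.sqrt (x : H →L[ℂ] H), ?_⟩, ?_⟩
      · rw [CFC.sqrt_eq_real_sqrt _ hx']
        exact cfcₙ_mem (𝕜' := ℂ) _ x.2
      · apply Subtype.ext
        change (x : H →L[ℂ] H) = star (CFC.sqrt (x : H →L[ℂ] H)) * CFC.sqrt (x : H →L[ℂ] H)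
        rw [(IsSelfAdjoint.of_nonneg hs).star_eq, CFC.sqrt_mul_sqrt_self _ hx']
    · rintro ⟨s, rfl⟩
      exact star_mul_self_nonneg (s : H →L[ℂ] H)

/-- The von Neumann algebra of all operators commuting with `S` and with the adjoints of `S`. -/
def commutantOf (S : Set (H →L[ℂ] H)) : VonNeumannAlgebra H where
  toStarSubalgebra := StarSubalgebra.centralizer ℂ S
  centralizer_centralizer' := by
    change Set.centralizer (Set.centralizer ((StarSubalgebra.centralizer ℂ S : Set (H →L[ℂ] H)))) =
      (StarSubalgebra.centralizer ℂ S : Set (H →L[ℂ] H))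
    simp [StarSubalgebra.coe_centralizer]

theorem mem_commutantOf {S : Set (H →L[ℂ] H)} {T : H →L[ℂ] H} :
    T ∈ commutantOf S ↔ ∀ s ∈ S, s * T = T * s ∧ star s * T = T * star s :=
  StarSubalgebra.mem_centralizer_iff ℂ

/-- The von Neumann algebra generated by `S`, that is, the bicommutant of `S ∪ S*`. -/
def generatedBy (S : Set (H →L[ℂ] H)) : VonNeumannAlgebra H := (commutantOf S).commutant

/-- The inclusion of `M` into the algebra of all bounded operators. -/
def incl (M : VonNeumannAlgebra H) : M →⋆ₐ[ℂ] (H →L[ℂ] H) where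
  toFun x := x
  map_one' := rfl
  map_mul' _ _ := rfl
  map_zero' := rfl
  map_add' _ _ := rfl
  commutes' _ := rfl
  map_star' _ := rfl

/-- The inclusion of `M` as a bounded linear map. -/
def inclL (M : VonNeumannAlgebra H) : M →L[ℂ] (H →L[ℂ] H) where
  toFun x := x
  map_add' _ _ := rfl
  map_smul' _ _ := rfl
  cont := continuous_subtype_val

/-- The vector functional `x ↦ ⟪η, x ξ⟫` restricted to `M`. -/
def vectorFunctional (M : VonNeumannAlgebra H) (η ξ : H) : StrongDual ℂ M :=
  (innerSL ℂ η).comp ((ContinuousLinearMap.apply ℂ H ξ).comp (inclL M))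

theorem vectorFunctional_apply (M : VonNeumannAlgebra H) (η ξ : H) (x : M) :
    vectorFunctional M η ξ x = ⟪η, (x : H →L[ℂ] H) ξ⟫_ℂ := rfl

/-- The predual of `M`: the normal functionals on `M`, realized as the norm closure in the
Banach space dual of the linear span of the vector functionals. -/
def predual (M : VonNeumannAlgebra H) : Submodule ℂ (StrongDual ℂ M) :=
  (Submodule.span ℂ {φ | ∃ η ξ : H, φ = vectorFunctional M η ξ}).topologicalClosure

/-- The positive cone of the predual: normal positive functionals. -/
structure NormalPos (M : VonNeumannAlgebra H) where
  toDual : StrongDual ℂ M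
  normal : toDual ∈ predual M
  nonneg : ∀ x : M, 0 ≤ x → 0 ≤ toDual x

/-- A normal positive functional is faithful if it vanishes at no nonzero `x* x`. -/
def NormalPos.Faithful {M : VonNeumannAlgebra H} (φ : NormalPos M) : Prop :=
  ∀ x : M, φ.toDual (star x * x) = 0 → x = 0

/-- A normal positive functional is a state if it is unital. -/
def NormalPos.IsState {M : VonNeumannAlgebra H} (φ : NormalPos M) : Prop := φ.toDual 1 = 1

variable {K : Type*} [NormedAddCommGroup K] [InnerProductSpace ℂ K] [CompleteSpace K]

/-- A map between von Neumann algebras is normal if composing with it maps normal functionals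
to normal functionals. -/
def IsNormalMap {M : VonNeumannAlgebra H} {N : VonNeumannAlgebra K} (f : M → N) : Prop :=
  ∀ φ ∈ predual N, ∃ ψ ∈ predual M, ∀ x, ψ x = φ (f x)

end Algebras

section HilbertTensor

/-- The Hilbert space tensor product. -/
def HTensor (H K : Type*) [NormedAddCommGroup H] [InnerProductSpace ℂ H]
    [NormedAddCommGroup K] [InnerProductSpace ℂ K] : Type _ :=
  UniformSpace.Completion (H ⊗[ℂ] K)

infixr:70 " ⊗ₕ " => HTensor

variable {H : Type*} [NormedAddCommGroup H] [InnerProductSpace ℂ H]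
variable {K : Type*} [NormedAddCommGroup K] [InnerProductSpace ℂ K]
variable {H' : Type*} [NormedAddCommGroup H'] [InnerProductSpace ℂ H']
variable {K' : Type*} [NormedAddCommGroup K'] [InnerProductSpace ℂ K']
variable {L : Type*} [NormedAddCommGroup L] [InnerProductSpace ℂ L]

instance : NormedAddCommGroup (H ⊗ₕ K) :=
  inferInstanceAs (NormedAddCommGroup (UniformSpace.Completion (H ⊗[ℂ] K)))

instance : InnerProductSpace ℂ (H ⊗ₕ K) :=
  inferInstanceAs (InnerProductSpace ℂ (UniformSpace.Completion (H ⊗[ℂ] K)))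

instance : CompleteSpace (H ⊗ₕ K) :=
  inferInstanceAs (CompleteSpace (UniformSpace.Completion (H ⊗[ℂ] K)))

/-- The canonical embedding of the algebraic tensor product. -/
def ofAlg : H ⊗[ℂ] K →ₗᵢ[ℂ] H ⊗ₕ K :=
  UniformSpace.Completion.toComplₗᵢ (𝕜 := ℂ) (E := H ⊗[ℂ] K)

/-- The operator `k ↦ ξ ⊗ k`. -/
def ket (ξ : H) : K →L[ℂ] H ⊗ₕ K :=
  ofAlg.toContinuousLinearMap.comp (TensorProduct.mkL ℂ H K ξ)

/-- The elementary tensor `ξ ⊗ k`. -/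
def tmul (ξ : H) (k : K) : H ⊗ₕ K := ofAlg (ξ ⊗ₜ[ℂ] k)

theorem ket_apply (ξ : H) (k : K) : ket ξ k = tmul ξ k := rfl

theorem inner_tmul (ξ η : H) (k h : K) : ⟪tmul ξ k, tmul η h⟫_ℂ = ⟪ξ, η⟫_ℂ * ⟪k, h⟫_ℂ := by
  simp only [tmul, LinearIsometry.inner_map_map, TensorProduct.inner_tmul]

theorem norm_tmul (ξ : H) (k : K) : ‖tmul ξ k‖ = ‖ξ‖ * ‖k‖ := by
  simp only [tmul, LinearIsometry.norm_map, TensorProduct.norm_tmul]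

theorem tmul_add_left (ξ η : H) (k : K) : tmul (ξ + η) k = tmul ξ k + tmul η k := by
  simp only [tmul, TensorProduct.add_tmul, map_add]

theorem tmul_smul_left (c : ℂ) (ξ : H) (k : K) : tmul (c • ξ) k = c • tmul ξ k := by
  simp only [tmul, ← TensorProduct.smul_tmul', map_smul]

theorem tmul_add_right (ξ : H) (k l : K) : tmul ξ (k + l) = tmul ξ k + tmul ξ l :=
  (ket ξ).map_add k l

theorem tmul_smul_right (c : ℂ) (ξ : H) (k : K) : tmul ξ (c • k) = c • tmul ξ k :=
  (ket ξ).map_smul c k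

theorem continuous_tmul_left (k : K) : Continuous fun ξ : H => tmul ξ k :=
  (LinearIsometry.continuous ofAlg).comp ((TensorProduct.mkL ℂ H K).flip k).continuous

theorem denseRange_ofAlg : DenseRange (ofAlg : H ⊗[ℂ] K → H ⊗ₕ K) :=
  UniformSpace.Completion.denseRange_coe (α := H ⊗[ℂ] K)

theorem dense_span_tmul :
    Dense (Submodule.span ℂ (Set.range fun p : H × K => tmul p.1 p.2) : Set (H ⊗ₕ K)) := by
  refine (denseRange_ofAlg (H := H) (K := K)).mono ?_
  rintro _ ⟨t, rfl⟩
  induction t with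
  | zero => rw [map_zero]; exact Submodule.zero_mem _
  | tmul x y => exact Submodule.subset_span ⟨(x, y), rfl⟩
  | add x y hx hy => rw [map_add]; exact Submodule.add_mem _ hx hy

theorem ext_tmul {E : Type*} [NormedAddCommGroup E] [NormedSpace ℂ E] {S T : H ⊗ₕ K →L[ℂ] E}
    (h : ∀ ξ k, S (tmul ξ k) = T (tmul ξ k)) : S = T := by
  refine ContinuousLinearMap.ext_on dense_span_tmul ?_
  rintro _ ⟨p, rfl⟩
  exact h _ _

/-- The tensor product `S ⊗ T` of bounded operators. -/
def mapT (S : H →L[ℂ] H') (T : K →L[ℂ] K') : H ⊗ₕ K →L[ℂ] H' ⊗ₕ K' :=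
  (TensorProduct.mapL S T).completion

theorem mapT_tmul (S : H →L[ℂ] H') (T : K →L[ℂ] K') (ξ : H) (k : K) :
    mapT S T (tmul ξ k) = tmul (S ξ) (T k) :=
  ContinuousLinearMap.completion_apply_coe (TensorProduct.mapL S T) (ξ ⊗ₜ[ℂ] k)

theorem mapT_mul (S S' : H →L[ℂ] H) (T T' : K →L[ℂ] K) :
    mapT (S * S') (T * T') = mapT S T * mapT S' T' := by
  apply ext_tmul; intro ξ k
  simp [mapT_tmul]

theorem star_mapT [CompleteSpace H] [CompleteSpace K] (S : H →L[ℂ] H) (T : K →L[ℂ] K) :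
    star (mapT S T) = mapT (star S) (star T) := by
  rw [ContinuousLinearMap.star_eq_adjoint, eq_comm, ContinuousLinearMap.eq_adjoint_iff]
  intro x y
  have h : ∀ x, (innerSL ℂ (mapT (star S) (star T) x)) = (innerSL ℂ x).comp (mapT S T) := by
    intro x
    apply ext_tmul; intro ξ k
    have : (innerSL ℂ (tmul ξ k)).comp (mapT (star S) (star T)) =
        innerSL ℂ (mapT S T (tmul ξ k)) := by
      apply ext_tmul; intro η l
      simp [mapT_tmul, inner_tmul, ContinuousLinearMap.star_eq_adjoint,
        ContinuousLinearMap.adjoint_inner_right]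
    have h2 := congrArg (fun f => star (f x)) this
    simpa using h2
  exact congrArg (fun f => f y) (h x)

theorem mapT_one_one : mapT (1 : H →L[ℂ] H) (1 : K →L[ℂ] K) = 1 := by
  apply ext_tmul; intro ξ k; simp [mapT_tmul]

section Gram
variable {E F : Type*} [NormedAddCommGroup E] [InnerProductSpace ℂ E] 
  [NormedAddCommGroup F] [InnerProductSpace ℂ F] {ι : Type*}

theorem denseRange_linearCombination {v : ι → E}
    (hv : Dense (Submodule.span ℂ (Set.range v) : Set E)) :
    DenseRange (Finsupp.linearCombination ℂ v) := by
  rw [DenseRange, ← LinearMap.coe_range, Finsupp.range_linearCombination]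
  exact hv

theorem inner_linearCombination (v : ι → E) (w : ι → F)
    (h : ∀ i j, ⟪v i, v j⟫_ℂ = ⟪w i, w j⟫_ℂ) (c d : ι →₀ ℂ) :
    ⟪Finsupp.linearCombination ℂ v c, Finsupp.linearCombination ℂ v d⟫_ℂ =
      ⟪Finsupp.linearCombination ℂ w c, Finsupp.linearCombination ℂ w d⟫_ℂ := by
  simp only [Finsupp.linearCombination_apply, Finsupp.sum, sum_inner, inner_sum, inner_smul_left,
    inner_smul_right, h]

theorem norm_linearCombination (v : ι → E) (w : ι → F)
    (h : ∀ i j, ⟪v i, v j⟫_ℂ = ⟪w i, w j⟫_ℂ) (c : ι →₀ ℂ) :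
    ‖Finsupp.linearCombination ℂ v c‖ = ‖Finsupp.linearCombination ℂ w c‖ := by
  rw [@norm_eq_sqrt_re_inner ℂ, @norm_eq_sqrt_re_inner ℂ, inner_linearCombination v w h]

variable [CompleteSpace E] [CompleteSpace F]

/-- The unitary carrying one total family to another one with the same Gram matrix. -/
def gramEquiv (v : ι → E) (w : ι → F) (hv : Dense (Submodule.span ℂ (Set.range v) : Set E))
    (hw : Dense (Submodule.span ℂ (Set.range w) : Set F))
    (h : ∀ i j, ⟪v i, v j⟫_ℂ = ⟪w i, w j⟫_ℂ) : E ≃ₗᵢ[ℂ] F :=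
  LinearEquiv.extendOfIsometry (LinearEquiv.refl ℂ (ι →₀ ℂ)) (Finsupp.linearCombination ℂ v)
    (Finsupp.linearCombination ℂ w) (denseRange_linearCombination hv)
    (denseRange_linearCombination hw) (fun c => (norm_linearCombination v w h c).symm)

theorem gramEquiv_apply (v : ι → E) (w : ι → F)
    (hv : Dense (Submodule.span ℂ (Set.range v) : Set E))
    (hw : Dense (Submodule.span ℂ (Set.range w) : Set F))
    (h : ∀ i j, ⟪v i, v j⟫_ℂ = ⟪w i, w j⟫_ℂ) (i : ι) : gramEquiv v w hv hw h (v i) = w i := by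
  have := LinearEquiv.extendOfIsometry_eq (f := LinearEquiv.refl ℂ (ι →₀ ℂ))
    (e₁ := Finsupp.linearCombination ℂ v) (e₂ := Finsupp.linearCombination ℂ w)
    (denseRange_linearCombination hv)
    (denseRange_linearCombination hw) (fun c => (norm_linearCombination v w h c).symm)
    (Finsupp.single i 1)
  simpa [gramEquiv] using this

end Gram

theorem dense_span_tmul_of_dense {ι κ : Type*} {v : ι → H} {w : κ → K}
    (hv : Dense (Submodule.span ℂ (Set.range v) : Set H))
    (hw : Dense (Submodule.span ℂ (Set.range w) : Set K)) :
    Dense (Submodule.span ℂ (Set.range fun p : ι × κ => tmul (v p.1) (w p.2)) :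
      Set (H ⊗ₕ K)) := by
  set S := Submodule.span ℂ (Set.range fun p : ι × κ => tmul (v p.1) (w p.2)) with hS
  have h1 : ∀ i k, tmul (v i) k ∈ S.topologicalClosure := by
    intro i
    have : Set.MapsTo (ket (v i)) (closure (Submodule.span ℂ (Set.range w) : Set K))
        (S.topologicalClosure : Set (H ⊗ₕ K)) := by
      rw [Submodule.topologicalClosure_coe]
      refine Set.MapsTo.closure ?_ (ket (v i)).continuous
      intro k hk
      refine Submodule.span_induction (p := fun k _ => ket (v i) k ∈ S) ?_ ?_ ?_ ?_ hk
      · rintro _ ⟨j, rfl⟩; exact Submodule.subset_span ⟨(i, j), rfl⟩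
      · simp
      · intro x y _ _ hx hy; rw [map_add]; exact S.add_mem hx hy
      · intro c x _ hx; rw [map_smul]; exact S.smul_mem c hx
    intro k
    exact this (hw k)
  have h2 : ∀ ξ k, tmul ξ k ∈ S.topologicalClosure := by
    intro ξ k
    have hc := continuous_tmul_left (H := H) k
    have : Set.MapsTo (fun ξ : H => tmul ξ k) (closure (Submodule.span ℂ (Set.range v) : Set H))
        (closure (S.topologicalClosure : Set (H ⊗ₕ K))) := by
      refine Set.MapsTo.closure ?_ hc
      intro x hx
      refine Submodule.span_induction (p := fun x _ => tmul x k ∈ S.topologicalClosure) ?_ ?_ ?_ ?_ hx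
      · rintro _ ⟨j, rfl⟩; exact h1 j k
      · have := tmul_smul_left (0 : ℂ) (0 : H) k
        simp only [zero_smul] at this; rw [this]; exact Submodule.zero_mem _
      · intro x y _ _ hx hy; rw [tmul_add_left]; exact Submodule.add_mem _ hx hy
      · intro c x _ hx; rw [tmul_smul_left]; exact Submodule.smul_mem _ c hx
    have h3 := this (hv ξ)
    rwa [S.isClosed_topologicalClosure.closure_eq] at h3
  have h3 : Submodule.span ℂ (Set.range fun p : H × K => tmul p.1 p.2) ≤ S.topologicalClosure := by
    rw [Submodule.span_le]; rintro _ ⟨p, rfl⟩; exact h2 _ _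
  have h4 := (dense_span_tmul (H := H) (K := K)).mono h3
  rw [Submodule.topologicalClosure_coe] at h4
  exact dense_closure.mp h4

theorem dense_span_tmul3 :
    Dense (Submodule.span ℂ (Set.range fun p : H × K × L => tmul p.1 (tmul p.2.1 p.2.2)) :
      Set (H ⊗ₕ K ⊗ₕ L)) := by
  have h1 : Dense (Submodule.span ℂ (Set.range (id : H → H)) : Set H) := by simp
  have := dense_span_tmul_of_dense h1 (dense_span_tmul (H := K) (K := L))
  simp only [id] at this
  exact this

theorem dense_span_tmul3' :
    Dense (Submodule.span ℂ (Set.range fun p : H × K × L => tmul (tmul p.1 p.2.1) p.2.2) :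
      Set ((H ⊗ₕ K) ⊗ₕ L)) := by
  have h1 : Dense (Submodule.span ℂ (Set.range (id : L → L)) : Set L) := by simp
  have := dense_span_tmul_of_dense (dense_span_tmul (H := H) (K := K)) h1
  have h : (Set.range fun p : H × K × L => tmul (tmul p.1 p.2.1) p.2.2) =
      Set.range fun p : (H × K) × L => tmul (tmul p.1.1 p.1.2) (id p.2) := by
    ext x; constructor
    · rintro ⟨⟨a, b, c⟩, rfl⟩; exact ⟨((a, b), c), rfl⟩
    · rintro ⟨⟨⟨a, b⟩, c⟩, rfl⟩; exact ⟨(a, b, c), rfl⟩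
  rw [h]; exact this

variable (H K L)

/-- The flip unitary `ξ ⊗ k ↦ k ⊗ ξ`. -/
def flipU : H ⊗ₕ K ≃ₗᵢ[ℂ] K ⊗ₕ H :=
  gramEquiv (fun p : H × K => tmul p.1 p.2) (fun p : H × K => tmul p.2 p.1) dense_span_tmul
    (by
      have h : (Set.range fun p : H × K => tmul p.2 p.1) = Set.range fun p : K × H => tmul p.1 p.2 :=
        (Prod.swap_surjective (α := H) (β := K)).range_comp fun p : K × H => tmul p.1 p.2
      rw [h]; exact dense_span_tmul)
    (fun i j => by simp [inner_tmul, mul_comm])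

/-- The associativity unitary `(ξ ⊗ k) ⊗ l ↦ ξ ⊗ (k ⊗ l)`. -/
def assocU : (H ⊗ₕ K) ⊗ₕ L ≃ₗᵢ[ℂ] H ⊗ₕ K ⊗ₕ L :=
  gramEquiv (fun p : H × K × L => tmul (tmul p.1 p.2.1) p.2.2)
    (fun p : H × K × L => tmul p.1 (tmul p.2.1 p.2.2)) dense_span_tmul3' dense_span_tmul3
    (fun i j => by simp [inner_tmul, mul_assoc])

/-- The unitary `k ⊗ (ξ ⊗ l) ↦ ξ ⊗ (k ⊗ l)` exchanging the first two legs. -/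
def swapU : K ⊗ₕ H ⊗ₕ L ≃ₗᵢ[ℂ] H ⊗ₕ K ⊗ₕ L :=
  gramEquiv (fun p : K × H × L => tmul p.1 (tmul p.2.1 p.2.2))
    (fun p : K × H × L => tmul p.2.1 (tmul p.1 p.2.2)) dense_span_tmul3
    (by
      have h : (Set.range fun p : K × H × L => tmul p.2.1 (tmul p.1 p.2.2)) =
          Set.range fun p : H × K × L => tmul p.1 (tmul p.2.1 p.2.2) := by
        ext x; constructor
        · rintro ⟨⟨a, b, c⟩, rfl⟩; exact ⟨(b, a, c), rfl⟩
        · rintro ⟨⟨a, b, c⟩, rfl⟩; exact ⟨(b, a, c), rfl⟩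
      rw [h]; exact dense_span_tmul3)
    (fun i j => by simp [inner_tmul]; ring)

variable {H K L}

theorem flipU_tmul (ξ : H) (k : K) : flipU H K (tmul ξ k) = tmul k ξ :=
  gramEquiv_apply _ _ _ _ _ ((ξ, k) : H × K)

theorem assocU_tmul (ξ : H) (k : K) (l : L) :
    assocU H K L (tmul (tmul ξ k) l) = tmul ξ (tmul k l) :=
  gramEquiv_apply _ _ _ _ _ ((ξ, k, l) : H × K × L)

theorem swapU_tmul (ξ : H) (k : K) (l : L) :
    swapU H K L (tmul k (tmul ξ l)) = tmul ξ (tmul k l) :=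
  gramEquiv_apply _ _ _ _ _ ((k, ξ, l) : K × H × L)

end HilbertTensor


section Slices

variable {X : Type*} [NormedAddCommGroup X] [InnerProductSpace ℂ X] [CompleteSpace X]
variable {H : Type*} [NormedAddCommGroup H] [InnerProductSpace ℂ H] [CompleteSpace H]
variable {K : Type*} [NormedAddCommGroup K] [InnerProductSpace ℂ K] [CompleteSpace K]
variable {L : Type*} [NormedAddCommGroup L] [InnerProductSpace ℂ L] [CompleteSpace L]

/-- The operator-valued matrix coefficient of `T` between the vectors `ξ` and `η` of the first
leg: `⟪k, coeff ξ η T l⟫ = ⟪ξ ⊗ k, T (η ⊗ l)⟫`. -/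
def coeff (ξ η : X) (T : X ⊗ₕ K →L[ℂ] X ⊗ₕ K) : K →L[ℂ] K :=
  (ContinuousLinearMap.adjoint (ket ξ : K →L[ℂ] X ⊗ₕ K)).comp (T.comp (ket η))

theorem inner_coeff (ξ η : X) (T : X ⊗ₕ K →L[ℂ] X ⊗ₕ K) (k l : K) :
    ⟪k, coeff ξ η T l⟫_ℂ = ⟪tmul ξ k, T (tmul η l)⟫_ℂ := by
  simp [coeff, ContinuousLinearMap.adjoint_inner_right, ket_apply]

theorem ext_inner_clm {S T : H →L[ℂ] K} (h : ∀ k l, ⟪k, S l⟫_ℂ = ⟪k, T l⟫_ℂ) : S = T := by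
  ext l; exact ext_inner_left ℂ fun k => h k l

theorem ext_coeff {S T : X ⊗ₕ K →L[ℂ] X ⊗ₕ K} (h : ∀ ξ η, coeff ξ η S = coeff ξ η T) : S = T := by
  apply ext_tmul
  intro η l
  have h1 : innerSL ℂ (S (tmul η l)) = innerSL ℂ (T (tmul η l)) := by
    apply ext_tmul
    intro ξ k
    have := inner_coeff ξ η S k l
    rw [h, inner_coeff] at this
    have h2 := congrArg (starRingEnd ℂ) this
    simpa using h2.symm
  exact (innerSL_inj (𝕜 := ℂ)).mp h1

theorem coeff_add_left (ξ ξ' η : X) (T : X ⊗ₕ K →L[ℂ] X ⊗ₕ K) :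
    coeff (ξ + ξ') η T = coeff ξ η T + coeff ξ' η T :=
  ext_inner_clm fun k l => by simp [inner_coeff, tmul_add_left]

theorem coeff_add_right (ξ η η' : X) (T : X ⊗ₕ K →L[ℂ] X ⊗ₕ K) :
    coeff ξ (η + η') T = coeff ξ η T + coeff ξ η' T :=
  ext_inner_clm fun k l => by simp [inner_coeff, tmul_add_left]

theorem coeff_smul_left (c : ℂ) (ξ η : X) (T : X ⊗ₕ K →L[ℂ] X ⊗ₕ K) :
    coeff (c • ξ) η T = (starRingEnd ℂ c) • coeff ξ η T :=
  ext_inner_clm fun k l => by simp [inner_coeff, tmul_smul_left, mul_comm]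

theorem coeff_smul_right (c : ℂ) (ξ η : X) (T : X ⊗ₕ K →L[ℂ] X ⊗ₕ K) :
    coeff ξ (c • η) T = c • coeff ξ η T :=
  ext_inner_clm fun k l => by simp [inner_coeff, tmul_smul_left]

theorem coeff_add (ξ η : X) (S T : X ⊗ₕ K →L[ℂ] X ⊗ₕ K) :
    coeff ξ η (S + T) = coeff ξ η S + coeff ξ η T :=
  ext_inner_clm fun k l => by simp [inner_coeff]

theorem coeff_smul (c : ℂ) (ξ η : X) (T : X ⊗ₕ K →L[ℂ] X ⊗ₕ K) :
    coeff ξ η (c • T) = c • coeff ξ η T :=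
  ext_inner_clm fun k l => by simp [inner_coeff]

theorem norm_ket_le (ξ : X) : ‖(ket ξ : K →L[ℂ] X ⊗ₕ K)‖ ≤ ‖ξ‖ :=
  ContinuousLinearMap.opNorm_le_bound _ (norm_nonneg _) fun k => by rw [ket_apply, norm_tmul]

theorem norm_coeff_le (ξ η : X) (T : X ⊗ₕ K →L[ℂ] X ⊗ₕ K) :
    ‖coeff ξ η T‖ ≤ ‖ξ‖ * ‖T‖ * ‖η‖ := by
  calc ‖coeff ξ η T‖ ≤ ‖ContinuousLinearMap.adjoint (ket ξ : K →L[ℂ] X ⊗ₕ K)‖ *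
        ‖T.comp (ket η : K →L[ℂ] X ⊗ₕ K)‖ := ContinuousLinearMap.opNorm_comp_le _ _
    _ ≤ ‖(ket ξ : K →L[ℂ] X ⊗ₕ K)‖ * (‖T‖ * ‖(ket η : K →L[ℂ] X ⊗ₕ K)‖) := by
        rw [LinearIsometryEquiv.norm_map]
        gcongr
        exact ContinuousLinearMap.opNorm_comp_le _ _
    _ ≤ ‖ξ‖ * (‖T‖ * ‖η‖) := by gcongr <;> exact norm_ket_le _
    _ = _ := by ring

/-- The bounded operator of a bounded sesquilinear form. -/
theorem exists_clm_of_form (B : X → X → ℂ) (C : ℝ)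
    (h1 : ∀ x x' y, B (x + x') y = B x y + B x' y) (h2 : ∀ x y y', B x (y + y') = B x y + B x y')
    (h3 : ∀ (c : ℂ) x y, B (c • x) y = (starRingEnd ℂ c) * B x y)
    (h4 : ∀ (c : ℂ) x y, B x (c • y) = c * B x y) (h5 : ∀ x y, ‖B x y‖ ≤ C * ‖x‖ * ‖y‖) :
    ∃ S : X →L[ℂ] X, (∀ x y, ⟪x, S y⟫_ℂ = B x y) := by
  let B' : X →L⋆[ℂ] X →L[ℂ] ℂ :=
    LinearMap.mkContinuous₂ (LinearMap.mk₂'ₛₗ (starRingEnd ℂ) (RingHom.id ℂ) B h1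
      (by simpa using h3) h2 (by simpa using h4)) C h5
  refine ⟨ContinuousLinearMap.adjoint (InnerProductSpace.continuousLinearMapOfBilin B'),
    fun x y => ?_⟩
  rw [ContinuousLinearMap.adjoint_inner_right, InnerProductSpace.continuousLinearMapOfBilin_apply]
  rfl

variable (X) in
/-- The algebra `B(X) ⊗ M` of operators on `X ⊗ K` all of whose coefficients along `X` lie in
`M`, described as the commutant of `1 ⊗ M'`. -/
def amp (M : VonNeumannAlgebra K) : VonNeumannAlgebra (X ⊗ₕ K) :=
  commutantOf {S | ∃ y ∈ M.commutant, S = mapT 1 y}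

theorem mem_amp {M : VonNeumannAlgebra K} {T : X ⊗ₕ K →L[ℂ] X ⊗ₕ K} :
    T ∈ amp X M ↔ ∀ y ∈ M.commutant, mapT 1 y * T = T * mapT 1 y := by
  rw [amp, mem_commutantOf]
  constructor
  · intro h y hy; exact (h _ ⟨y, hy, rfl⟩).1
  · rintro h _ ⟨y, hy, rfl⟩
    refine ⟨h y hy, ?_⟩
    rw [star_mapT, star_one]; exact h _ (star_mem hy)

theorem coeff_mapT_mul (ξ η : X) (y : K →L[ℂ] K) (T : X ⊗ₕ K →L[ℂ] X ⊗ₕ K) :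
    coeff ξ η (mapT 1 y * T) = y * coeff ξ η T := by
  refine ext_inner_clm fun k l => ?_
  rw [inner_coeff, mul_apply_eq_comp, mul_apply_eq_comp,
    ← ContinuousLinearMap.adjoint_inner_left, ← ContinuousLinearMap.adjoint_inner_left y,
    inner_coeff, ← ContinuousLinearMap.star_eq_adjoint, star_mapT, mapT_tmul]
  simp [ContinuousLinearMap.star_eq_adjoint]

theorem coeff_mul_mapT (ξ η : X) (y : K →L[ℂ] K) (T : X ⊗ₕ K →L[ℂ] X ⊗ₕ K) :
    coeff ξ η (T * mapT 1 y) = coeff ξ η T * y := by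
  refine ext_inner_clm fun k l => ?_
  rw [inner_coeff, mul_apply_eq_comp, mul_apply_eq_comp,
    inner_coeff, mapT_tmul]
  simp

theorem coeff_mem {M : VonNeumannAlgebra K} {T : X ⊗ₕ K →L[ℂ] X ⊗ₕ K} (hT : T ∈ amp X M)
    (ξ η : X) : coeff ξ η T ∈ M := by
  rw [← M.commutant_commutant, VonNeumannAlgebra.mem_commutant_iff]
  intro y hy
  rw [← coeff_mapT_mul, ← coeff_mul_mapT, mem_amp.mp hT y hy]

theorem mem_amp_of_coeff {M : VonNeumannAlgebra K} {T : X ⊗ₕ K →L[ℂ] X ⊗ₕ K}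
    (h : ∀ ξ η, coeff ξ η T ∈ M) : T ∈ amp X M := by
  rw [mem_amp]
  intro y hy
  apply ext_coeff
  intro ξ η
  rw [coeff_mapT_mul, coeff_mul_mapT]
  exact ((VonNeumannAlgebra.mem_commutant_iff.mp hy) _ (h ξ η)).symm

/-- `coeff` with values in `M`. -/
def coeffIn {M : VonNeumannAlgebra K} (ξ η : X) (T : amp X M) : M :=
  ⟨coeff ξ η T, coeff_mem T.2 ξ η⟩

theorem exists_slice {M : VonNeumannAlgebra K} (φ : StrongDual ℂ M) (T : amp X M) :
    ∃ S : X →L[ℂ] X, ∀ ξ η, ⟪ξ, S η⟫_ℂ = φ (coeffIn ξ η T) := by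
  refine exists_clm_of_form (fun ξ η => φ (coeffIn ξ η T)) (‖φ‖ * ‖T‖) ?_ ?_ ?_ ?_ ?_
  · intro x x' y
    rw [← map_add]; congr 1; exact Subtype.ext (coeff_add_left _ _ _ _)
  · intro x y y'
    rw [← map_add]; congr 1; exact Subtype.ext (coeff_add_right _ _ _ _)
  · intro c x y
    rw [← smul_eq_mul, ← map_smul]; congr 1; exact Subtype.ext (coeff_smul_left _ _ _ _)
  · intro c x y
    rw [← smul_eq_mul, ← map_smul]; congr 1; exact Subtype.ext (coeff_smul_right _ _ _ _)
  · intro x y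
    have h : ‖coeffIn x y T‖ ≤ ‖x‖ * ‖T‖ * ‖y‖ := norm_coeff_le x y _
    calc ‖φ (coeffIn x y T)‖ ≤ ‖φ‖ * ‖coeffIn x y T‖ := φ.le_opNorm _
      _ ≤ ‖φ‖ * (‖x‖ * ‖T‖ * ‖y‖) := by gcongr
      _ = _ := by ring

/-- The slice map `id ⊗ φ`, determined by `⟪ξ, (id ⊗ φ)(T) η⟫ = φ (coeff ξ η T)`. -/
def slice {M : VonNeumannAlgebra K} (φ : StrongDual ℂ M) (T : amp X M) : X →L[ℂ] X :=
  (exists_slice φ T).choose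

theorem inner_slice {M : VonNeumannAlgebra K} (φ : StrongDual ℂ M) (T : amp X M) (ξ η : X) :
    ⟪ξ, slice φ T η⟫_ℂ = φ (coeffIn ξ η T) := (exists_slice φ T).choose_spec ξ η

end Slices

section Amplification

variable {X : Type*} [NormedAddCommGroup X] [InnerProductSpace ℂ X] [CompleteSpace X]
variable {K : Type*} [NormedAddCommGroup K] [InnerProductSpace ℂ K] [CompleteSpace K]
variable {L : Type*} [NormedAddCommGroup L] [InnerProductSpace ℂ L] [CompleteSpace L]

/-- The representation of `n × n` matrices over `M` on the `n`-fold direct sum of `L`. -/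
def matRep {M : VonNeumannAlgebra K} (f : M →⋆ₐ[ℂ] (L →L[ℂ] L)) (n : ℕ) :
    CStarMatrix (Fin n) (Fin n) M →⋆ₙₐ[ℂ]
      (PiLp 2 (fun _ : Fin n => L) →L[ℂ] PiLp 2 (fun _ : Fin n => L)) where
  toFun A := (PiLp.continuousLinearEquiv 2 ℂ (fun _ : Fin n => L)).symm.toContinuousLinearMap.comp
    (ContinuousLinearMap.pi fun b => ∑ a, (f (A b a)).comp (PiLp.proj 2 (fun _ : Fin n => L) a))
  map_smul' c A := by
    ext h b; simp [Finset.smul_sum]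
  map_zero' := by
    ext h b; simp
  map_add' A B := by
    ext h b; simp [Finset.sum_add_distrib]
  map_mul' A B := by
    ext h b
    simp [CStarMatrix.mul_apply, map_sum, map_mul,]
    rw [Finset.sum_comm]
  map_star' A := by
    rw [ContinuousLinearMap.star_eq_adjoint, ContinuousLinearMap.eq_adjoint_iff]
    intro x y
    simp [PiLp.inner_apply, sum_inner, inner_sum, CStarMatrix.star_apply, map_star,
      ContinuousLinearMap.star_eq_adjoint, ContinuousLinearMap.adjoint_inner_left]
    rw [Finset.sum_comm]

theorem matRep_apply {M : VonNeumannAlgebra K} (f : M →⋆ₐ[ℂ] (L →L[ℂ] L)) (n : ℕ)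
    (A : CStarMatrix (Fin n) (Fin n) M) (h : PiLp 2 (fun _ : Fin n => L)) (b : Fin n) :
    matRep f n A h b = ∑ a, f (A b a) (h a) := by
  simp [matRep]

/-- The isometry `(h_a) ↦ ∑ e_a ⊗ h_a` of an orthonormal family. -/
def frame {n : ℕ} (e : Fin n → X) (he : Orthonormal ℂ e) :
    PiLp 2 (fun _ : Fin n => L) →ₗᵢ[ℂ] X ⊗ₕ L where
  toFun h := ∑ a, tmul (e a) (h a)
  map_add' x y := by simp [tmul_add_right, Finset.sum_add_distrib]
  map_smul' c x := by simp [tmul_smul_right, Finset.smul_sum]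
  norm_map' x := by
    have h : ⟪∑ a, tmul (e a) (x a), ∑ a, tmul (e a) (x a)⟫_ℂ = ⟪x, x⟫_ℂ := by
      simp only [PiLp.inner_apply, sum_inner, inner_sum, inner_tmul, orthonormal_iff_ite.mp he]
      simp
    change ‖∑ a, tmul (e a) (x a)‖ = ‖x‖
    rw [@norm_eq_sqrt_re_inner ℂ, @norm_eq_sqrt_re_inner ℂ _ _ _ _ x, h]

theorem frame_apply {n : ℕ} (e : Fin n → X) (he : Orthonormal ℂ e)
    (h : PiLp 2 (fun _ : Fin n => L)) : frame e he h = ∑ a, tmul (e a) (h a) := rfl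

theorem norm_matRep_le {M : VonNeumannAlgebra K} (f : M →⋆ₐ[ℂ] (L →L[ℂ] L)) (T : amp X M)
    {n : ℕ} (e : Fin n → X) (he : Orthonormal ℂ e) :
    ‖matRep f n (CStarMatrix.ofMatrix (fun b a => coeffIn (e b) (e a) T))‖ ≤ ‖T‖ := by
  set A : CStarMatrix (Fin n) (Fin n) M :=
    CStarMatrix.ofMatrix (fun b a => coeffIn (e b) (e a) T) with hA
  have hinj : Function.Injective (matRep (incl M) n) := by
    intro A B hAB
    ext b a x
    have := congrArg (fun S => S (WithLp.toLp 2 (Pi.single a x)) b) hAB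
    simp only [matRep_apply] at this
    rw [Finset.sum_eq_single a, Finset.sum_eq_single a] at this
    · simpa [incl] using this
    all_goals simp +contextual
  calc ‖matRep f n A‖ ≤ ‖A‖ := NonUnitalStarAlgHom.norm_apply_le _ _
    _ = ‖matRep (incl M) n A‖ := (NonUnitalStarAlgHom.norm_map _ hinj A).symm
    _ ≤ ‖T‖ := by
      refine ContinuousLinearMap.opNorm_le_bound _ (norm_nonneg _) fun h => ?_
      have key : ∀ g, ⟪g, matRep (incl M) n A h⟫_ℂ =
          ⟪frame e he g, (T : X ⊗ₕ K →L[ℂ] X ⊗ₕ K) (frame e he h)⟫_ℂ := by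
        intro g
        have hin : ∀ b a, (incl M) (A b a) = coeff (e b) (e a) (T : X ⊗ₕ K →L[ℂ] X ⊗ₕ K) :=
          fun b a => rfl
        simp only [PiLp.inner_apply, matRep_apply, frame_apply, map_sum, sum_inner, inner_sum,
          hin, inner_coeff]
        exact Finset.sum_comm
      set g := matRep (incl M) n A h with hg
      have h1 : ‖g‖ * ‖g‖ ≤ ‖g‖ * (‖T‖ * ‖h‖) := by
        rw [← @inner_self_eq_norm_mul_norm ℂ, key g]
        refine (RCLike.re_le_norm _).trans ((norm_inner_le_norm _ _).trans ?_)
        rw [(frame e he).norm_map]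
        gcongr
        refine ((T : X ⊗ₕ K →L[ℂ] X ⊗ₕ K).le_opNorm _).trans ?_
        rw [(frame e he).norm_map]; rfl
      rcases (norm_nonneg g).eq_or_lt with h0 | h0
      · rw [← h0]; positivity
      · exact le_of_mul_le_mul_left h1 h0

theorem tmul_sum_left {ι : Type*} (s : Finset ι) (v : ι → X) (l : L) :
    tmul (∑ i ∈ s, v i) l = ∑ i ∈ s, tmul (v i) l := by
  classical
  induction s using Finset.induction_on with
  | empty => simpa using tmul_smul_left (0 : ℂ) (0 : X) l
  | insert i s hi ih => rw [Finset.sum_insert hi, Finset.sum_insert hi, tmul_add_left, ih]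

theorem coeffIn_expand {M : VonNeumannAlgebra K} (T : amp X M) {n : ℕ} (e : Fin n → X) (c d : Fin n → ℂ) :
    coeffIn (∑ b, c b • e b) (∑ a, d a • e a) T =
      ∑ b, ∑ a, (starRingEnd ℂ (c b) * d a) • coeffIn (e b) (e a) T := by
  have h : ∀ z : M, ∀ w : M, (∀ k l, ⟪k, (z : K →L[ℂ] K) l⟫_ℂ = ⟪k, (w : K →L[ℂ] K) l⟫_ℂ) → z = w :=
    fun z w h => Subtype.ext (ext_inner_clm h)
  refine h _ _ fun k l => ?_
  have h2 : ((∑ b, ∑ a, (starRingEnd ℂ (c b) * d a) • coeffIn (e b) (e a) T : M) : K →L[ℂ] K) =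
      ∑ b, ∑ a, (starRingEnd ℂ (c b) * d a) • coeff (e b) (e a) (T : X ⊗ₕ K →L[ℂ] X ⊗ₕ K) := by
    change inclL M _ = _
    simp only [map_sum, map_smul]
    rfl
  have h3 : ⟪k, (coeffIn (∑ b, c b • e b) (∑ a, d a • e a) T : K →L[ℂ] K) l⟫_ℂ =
    ⟪tmul (∑ b, c b • e b) k, (T : X ⊗ₕ K →L[ℂ] X ⊗ₕ K) (tmul (∑ a, d a • e a) l)⟫_ℂ :=
    inner_coeff _ _ _ _ _
  rw [h2, h3]
  simp only [tmul_sum_left, tmul_smul_left, map_sum, map_smul, sum_inner, inner_sum,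
    inner_smul_left, inner_smul_right, sum_apply, smul_apply, inner_coeff]
  simp only [Finset.mul_sum]
  rw [Finset.sum_comm]
  refine Finset.sum_congr rfl fun b _ => Finset.sum_congr rfl fun a _ => ?_
  ring

theorem adjoint_frame {n : ℕ} (e : Fin n → X) (he : Orthonormal ℂ e) (ξ : X) (l : L) :
    ContinuousLinearMap.adjoint (frame (L := L) e he).toContinuousLinearMap (tmul ξ l) =
      WithLp.toLp 2 (fun a => ⟪e a, ξ⟫_ℂ • l) := by
  refine ext_inner_left ℂ fun g => ?_
  rw [ContinuousLinearMap.adjoint_inner_right]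
  simp [frame_apply, PiLp.inner_apply, sum_inner, inner_tmul, inner_smul_right]

theorem exists_idTensor_frame {M : VonNeumannAlgebra K} (f : M →⋆ₐ[ℂ] (L →L[ℂ] L))
    (T : amp X M) {n : ℕ} (e : Fin n → X) (he : Orthonormal ℂ e) :
    ∃ S : X ⊗ₕ L →L[ℂ] X ⊗ₕ L, ‖S‖ ≤ ‖T‖ ∧
      ∀ ξ η, ξ = ∑ a, ⟪e a, ξ⟫_ℂ • e a → η = ∑ a, ⟪e a, η⟫_ℂ • e a →
        coeff ξ η S = f (coeffIn ξ η T) := by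
  let R := matRep f n (CStarMatrix.ofMatrix (fun b a => coeffIn (e b) (e a) T))
  let V : PiLp 2 (fun _ : Fin n => L) →L[ℂ] X ⊗ₕ L := (frame e he).toContinuousLinearMap
  have hV : ‖V‖ ≤ 1 := ContinuousLinearMap.opNorm_le_bound _ zero_le_one fun h => by
    rw [one_mul]; exact ((frame e he).norm_map h).le
  refine ⟨V.comp (R.comp (ContinuousLinearMap.adjoint V)), ?_, ?_⟩
  · calc ‖V.comp (R.comp (ContinuousLinearMap.adjoint V))‖
        ≤ ‖V‖ * (‖R‖ * ‖ContinuousLinearMap.adjoint V‖) :=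
          (ContinuousLinearMap.opNorm_comp_le _ _).trans
            (mul_le_mul_of_nonneg_left (ContinuousLinearMap.opNorm_comp_le _ _) (norm_nonneg _))
      _ ≤ 1 * (‖T‖ * 1) := by
          rw [LinearIsometryEquiv.norm_map]
          gcongr
          exact norm_matRep_le f T e he
      _ = ‖T‖ := by ring
  · intro ξ η hξ hη
    refine ext_inner_clm fun k l => ?_
    have h1 : ⟪k, coeff ξ η (V.comp (R.comp (ContinuousLinearMap.adjoint V))) l⟫_ℂ =
        ⟪ContinuousLinearMap.adjoint V (tmul ξ k),
          R (ContinuousLinearMap.adjoint V (tmul η l))⟫_ℂ := by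
      rw [inner_coeff, ContinuousLinearMap.adjoint_inner_left]; rfl
    have h2 : coeffIn ξ η T =
        ∑ b, ∑ a, (starRingEnd ℂ ⟪e b, ξ⟫_ℂ * ⟪e a, η⟫_ℂ) • coeffIn (e b) (e a) T := by
      conv_lhs => rw [hξ, hη]
      exact coeffIn_expand T e _ _
    rw [h1, h2, adjoint_frame, adjoint_frame, PiLp.inner_apply]
    simp only [R, matRep_apply, map_sum, map_smul, sum_apply, smul_apply, inner_sum,
      inner_smul_left, inner_smul_right]
    refine Finset.sum_congr rfl fun b _ => Finset.sum_congr rfl fun a _ => ?_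
    have h3 : CStarMatrix.ofMatrix (fun b a => coeffIn (e b) (e a) T) b a =
      coeffIn (e b) (e a) T := rfl
    rw [h3]
    ring

theorem exists_idTensor_finite {M : VonNeumannAlgebra K} (f : M →⋆ₐ[ℂ] (L →L[ℂ] L))
    (T : amp X M) (s : Finset X) : ∃ S : X ⊗ₕ L →L[ℂ] X ⊗ₕ L, ‖S‖ ≤ ‖T‖ ∧
      ∀ ξ ∈ s, ∀ η ∈ s, coeff ξ η S = f (coeffIn ξ η T) := by
  let W := Submodule.span ℂ (s : Set X)
  have : FiniteDimensional ℂ W := FiniteDimensional.span_finset ℂ s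
  let b := stdOrthonormalBasis ℂ W
  have he : Orthonormal ℂ (fun a => (b a : X)) := b.orthonormal.comp_linearIsometry W.subtypeₗᵢ
  have hexp : ∀ ξ ∈ s, ξ = ∑ a, ⟪(b a : X), ξ⟫_ℂ • (b a : X) := by
    intro ξ hξ
    have := congrArg (Subtype.val) (b.sum_repr' ⟨ξ, Submodule.subset_span hξ⟩)
    simpa using this.symm
  obtain ⟨S, h1, h2⟩ := exists_idTensor_frame f T _ he
  exact ⟨S, h1, fun ξ hξ η hη => h2 ξ η (hexp ξ hξ) (hexp η hη)⟩

theorem exists_idTensor {M : VonNeumannAlgebra K} (f : M →⋆ₐ[ℂ] (L →L[ℂ] L)) (T : amp X M) :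
    ∃ S : X ⊗ₕ L →L[ℂ] X ⊗ₕ L, ∀ ξ η, coeff ξ η S = f (coeffIn ξ η T) := by
  classical
  choose S hS hSc using exists_idTensor_finite f T
  let U : Ultrafilter (Finset X) := Ultrafilter.of Filter.atTop
  have hlim : ∀ x y, ∃ z, Filter.Tendsto (fun s => ⟪x, S s y⟫_ℂ) U (nhds z) := by
    intro x y
    have hb : ∀ s, ⟪x, S s y⟫_ℂ ∈ Metric.closedBall (0 : ℂ) (‖x‖ * (‖T‖ * ‖y‖)) := by
      intro s
      rw [mem_closedBall_zero_iff]
      refine (norm_inner_le_norm _ _).trans ?_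
      gcongr
      exact ((S s).le_opNorm y).trans (by gcongr; exact hS s)
    obtain ⟨z, -, hz⟩ := (isCompact_closedBall (0 : ℂ) (‖x‖ * (‖T‖ * ‖y‖))).ultrafilter_le_nhds'
      (U.map fun s => ⟪x, S s y⟫_ℂ) (Ultrafilter.mem_map.mpr (Filter.Eventually.of_forall hb))
    exact ⟨z, hz⟩
  choose B hB using hlim
  have hBn : ∀ x y, ‖B x y‖ ≤ ‖T‖ * ‖x‖ * ‖y‖ := by
    intro x y
    refine le_of_tendsto (hB x y).norm (Filter.Eventually.of_forall fun s => ?_)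
    refine (norm_inner_le_norm _ _).trans ?_
    calc ‖x‖ * ‖S s y‖ ≤ ‖x‖ * (‖T‖ * ‖y‖) := by
          gcongr
          exact ((S s).le_opNorm y).trans (by gcongr; exact hS s)
      _ = _ := by ring
  obtain ⟨S', hS'⟩ := exists_clm_of_form B ‖T‖
    (fun x x' y => tendsto_nhds_unique (hB (x + x') y)
      (by simpa only [inner_add_left] using (hB x y).add (hB x' y)))
    (fun x y y' => tendsto_nhds_unique (hB x (y + y'))
      (by simpa only [inner_add_right, map_add] using (hB x y).add (hB x y')))
    (fun c x y => tendsto_nhds_unique (hB (c • x) y)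
      (by simpa only [inner_smul_left] using (hB x y).const_mul _))
    (fun c x y => tendsto_nhds_unique (hB x (c • y))
      (by simpa only [inner_smul_right, map_smul] using (hB x y).const_mul _)) hBn
  refine ⟨S', fun ξ η => ext_inner_clm fun k l => ?_⟩
  rw [inner_coeff, hS']
  refine tendsto_nhds_unique (hB _ _) ?_
  refine tendsto_const_nhds.congr' ?_
  have : ∀ᶠ s in (U : Filter (Finset X)), {ξ, η} ≤ s :=
    (Ultrafilter.of_le Filter.atTop) (Filter.eventually_ge_atTop _)
  filter_upwards [this] with s hs
  rw [← hSc s ξ (hs (by simp)) η (hs (by simp)), inner_coeff]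

/-- The map `id ⊗ f` for a `*`-homomorphism `f`, determined by
`coeff ξ η ((id ⊗ f)(T)) = f (coeff ξ η T)`. -/
def idTensor {M : VonNeumannAlgebra K} (f : M →⋆ₐ[ℂ] (L →L[ℂ] L)) (T : amp X M) :
    X ⊗ₕ L →L[ℂ] X ⊗ₕ L :=
  (exists_idTensor f T).choose

theorem coeff_idTensor {M : VonNeumannAlgebra K} (f : M →⋆ₐ[ℂ] (L →L[ℂ] L)) (T : amp X M)
    (ξ η : X) : coeff ξ η (idTensor f T) = f (coeffIn ξ η T) :=
  (exists_idTensor f T).choose_spec ξ η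

end Amplification

section VonNeumannTensor

variable {H : Type*} [NormedAddCommGroup H] [InnerProductSpace ℂ H] [CompleteSpace H]
variable {K : Type*} [NormedAddCommGroup K] [InnerProductSpace ℂ K] [CompleteSpace K]
variable {L : Type*} [NormedAddCommGroup L] [InnerProductSpace ℂ L] [CompleteSpace L]

/-- The normal spatial tensor product: the von Neumann algebra generated by the operators
`x ⊗ y` with `x ∈ M` and `y ∈ N`. -/
def vnTensor (M : VonNeumannAlgebra H) (N : VonNeumannAlgebra K) : VonNeumannAlgebra (H ⊗ₕ K) :=
  generatedBy {S | ∃ x ∈ M, ∃ y ∈ N, S = mapT x y}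

infixr:70 " ⊗ᵥ " => vnTensor

variable {M : VonNeumannAlgebra H} {N : VonNeumannAlgebra K}

theorem commutes_of_mem_vnTensor {T S : H ⊗ₕ K →L[ℂ] H ⊗ₕ K} (hT : T ∈ M ⊗ᵥ N)
    (hS : ∀ x ∈ M, ∀ y ∈ N, mapT x y * S = S * mapT x y) : S * T = T * S := by
  refine VonNeumannAlgebra.mem_commutant_iff.mp hT S ?_
  rw [mem_commutantOf]
  rintro _ ⟨x, hx, y, hy, rfl⟩
  refine ⟨hS x hx y hy, ?_⟩
  rw [star_mapT]
  exact hS _ (star_mem hx) _ (star_mem hy)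

theorem right_commutes {T : H ⊗ₕ K →L[ℂ] H ⊗ₕ K} (hT : T ∈ M ⊗ᵥ N) {z : K →L[ℂ] K}
    (hz : z ∈ N.commutant) : mapT 1 z * T = T * mapT 1 z := by
  refine commutes_of_mem_vnTensor hT fun x _ y hy => ?_
  rw [← mapT_mul, ← mapT_mul, one_mul, mul_one, VonNeumannAlgebra.mem_commutant_iff.mp hz y hy]

theorem left_commutes {T : H ⊗ₕ K →L[ℂ] H ⊗ₕ K} (hT : T ∈ M ⊗ᵥ N) {z : H →L[ℂ] H}
    (hz : z ∈ M.commutant) : mapT z 1 * T = T * mapT z 1 := by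
  refine commutes_of_mem_vnTensor hT fun x hx y _ => ?_
  rw [← mapT_mul, ← mapT_mul, one_mul, mul_one, VonNeumannAlgebra.mem_commutant_iff.mp hz x hx]

/-- The elementary tensor `x ⊗ y` in `M ⊗ᵥ N`. -/
def elem (x : M) (y : N) : (M ⊗ᵥ N : VonNeumannAlgebra (H ⊗ₕ K)) :=
  ⟨mapT x y, by
    rw [vnTensor, generatedBy, VonNeumannAlgebra.mem_commutant_iff]
    intro S hS
    exact ((mem_commutantOf.mp hS) _ ⟨x, x.2, y, y.2, rfl⟩).1.symm⟩

/-- The inclusion `M ⊗ᵥ N ⊆ B(H) ⊗ N`. -/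
def toAmp (T : (M ⊗ᵥ N : VonNeumannAlgebra (H ⊗ₕ K))) : amp H N :=
  ⟨T, mem_amp.mpr fun _ hz => right_commutes T.2 hz⟩

theorem conj_flipU (S : H →L[ℂ] H) (T : K →L[ℂ] K) :
    (flipU H K).conjStarAlgEquiv (mapT S T) = mapT T S := by
  apply ext_tmul
  intro k ξ
  have h : (flipU H K).symm (tmul k ξ) = tmul ξ k := by
    rw [LinearIsometryEquiv.symm_apply_eq, flipU_tmul]
  rw [LinearIsometryEquiv.conjStarAlgEquiv_apply_apply, h, mapT_tmul, flipU_tmul, mapT_tmul]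

/-- The flipped operator of an element of `M ⊗ᵥ N`, as an element of `B(K) ⊗ M`. -/
def flipAmp (T : (M ⊗ᵥ N : VonNeumannAlgebra (H ⊗ₕ K))) : amp K M :=
  ⟨(flipU H K).conjStarAlgEquiv (T : H ⊗ₕ K →L[ℂ] H ⊗ₕ K), mem_amp.mpr fun z hz => by
    rw [← conj_flipU z 1, ← map_mul, ← map_mul, left_commutes T.2 hz]⟩

/-- The map `f ⊗ id` for a `*`-homomorphism `f`. -/
def tensorId (f : M →⋆ₐ[ℂ] (L →L[ℂ] L)) (T : (M ⊗ᵥ N : VonNeumannAlgebra (H ⊗ₕ K))) :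
    L ⊗ₕ K →L[ℂ] L ⊗ₕ K :=
  (flipU K L).conjStarAlgEquiv (idTensor f (flipAmp T))

/-- The left slice map `φ ⊗ id`. -/
def leftSlice (φ : StrongDual ℂ M) (T : (M ⊗ᵥ N : VonNeumannAlgebra (H ⊗ₕ K))) : K →L[ℂ] K :=
  slice φ (flipAmp T)

theorem coeff_mul_left (ξ η : H) (z : H →L[ℂ] H) (T : H ⊗ₕ K →L[ℂ] H ⊗ₕ K) :
    coeff ξ η (mapT z 1 * T) = coeff (star z ξ) η T := by
  refine ext_inner_clm fun k l => ?_
  rw [inner_coeff, inner_coeff, mul_apply_eq_comp, ← ContinuousLinearMap.adjoint_inner_left,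
    ← ContinuousLinearMap.star_eq_adjoint, star_mapT, mapT_tmul]
  simp

theorem coeff_mul_right (ξ η : H) (z : H →L[ℂ] H) (T : H ⊗ₕ K →L[ℂ] H ⊗ₕ K) :
    coeff ξ η (T * mapT z 1) = coeff ξ (z η) T := by
  refine ext_inner_clm fun k l => ?_
  rw [inner_coeff, inner_coeff, mul_apply_eq_comp, mapT_tmul]
  simp

theorem slice_mem (φ : StrongDual ℂ N) (T : (M ⊗ᵥ N : VonNeumannAlgebra (H ⊗ₕ K))) :
    slice φ (toAmp T) ∈ M := by
  suffices h : slice φ (toAmp T) ∈ M.commutant.commutant by rwa [M.commutant_commutant] at h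
  rw [VonNeumannAlgebra.mem_commutant_iff]
  intro z hz
  refine ext_inner_clm fun ξ η => ?_
  rw [mul_apply_eq_comp, mul_apply_eq_comp, inner_slice, ← ContinuousLinearMap.adjoint_inner_left,
    inner_slice]
  congr 1
  apply Subtype.ext
  change coeff (star z ξ) η (T : H ⊗ₕ K →L[ℂ] H ⊗ₕ K) = coeff ξ (z η) (T : H ⊗ₕ K →L[ℂ] H ⊗ₕ K)
  rw [← coeff_mul_left, ← coeff_mul_right, left_commutes T.2 hz]

theorem norm_slice_le {X : Type*} [NormedAddCommGroup X] [InnerProductSpace ℂ X] [CompleteSpace X]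
    (φ : StrongDual ℂ N) (T : amp X N) : ‖slice φ T‖ ≤ ‖φ‖ * ‖T‖ := by
  refine ContinuousLinearMap.opNorm_le_bound _ (by positivity) fun η => ?_
  set ζ := slice φ T η with hζ
  have h1 : ‖ζ‖ * ‖ζ‖ ≤ ‖ζ‖ * (‖φ‖ * ‖T‖ * ‖η‖) := by
    rw [← @inner_self_eq_norm_mul_norm ℂ]
    conv_lhs => rw [hζ]
    refine (RCLike.re_le_norm _).trans ?_
    rw [← hζ, hζ, inner_slice, ← hζ]
    have h2 : ‖coeffIn ζ η T‖ ≤ ‖ζ‖ * ‖T‖ * ‖η‖ := norm_coeff_le _ _ _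
    calc _ ≤ ‖φ‖ * ‖coeffIn ζ η T‖ := φ.le_opNorm _
      _ ≤ ‖φ‖ * (‖ζ‖ * ‖T‖ * ‖η‖) := by gcongr
      _ = _ := by ring
  rcases (norm_nonneg ζ).eq_or_lt with h0 | h0
  · rw [← h0]; positivity
  · exact le_of_mul_le_mul_left h1 h0

/-- The right slice map `id ⊗ φ` from `M ⊗ᵥ N` to `M`. -/
def rightSlice (φ : StrongDual ℂ N) : (M ⊗ᵥ N : VonNeumannAlgebra (H ⊗ₕ K)) →L[ℂ] M :=
  LinearMap.mkContinuous
    { toFun := fun T => ⟨slice φ (toAmp T), slice_mem φ T⟩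
      map_add' := fun S T => by
        refine Subtype.ext (ext_inner_clm fun ξ η => ?_)
        change ⟪ξ, slice φ (toAmp (S + T)) η⟫_ℂ =
          ⟪ξ, slice φ (toAmp S) η + slice φ (toAmp T) η⟫_ℂ
        rw [inner_add_right, inner_slice, inner_slice, inner_slice, ← map_add]
        congr 1
        exact Subtype.ext (coeff_add _ _ _ _)
      map_smul' := fun c T => by
        refine Subtype.ext (ext_inner_clm fun ξ η => ?_)
        change ⟪ξ, slice φ (toAmp (c • T)) η⟫_ℂ = ⟪ξ, c • slice φ (toAmp T) η⟫_ℂ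
        rw [inner_smul_right, inner_slice, inner_slice, ← smul_eq_mul, ← map_smul]
        congr 1
        exact Subtype.ext (coeff_smul _ _ _ _) } ‖φ‖ (fun T => norm_slice_le φ (toAmp T))

theorem coe_rightSlice (φ : StrongDual ℂ N) (T : (M ⊗ᵥ N : VonNeumannAlgebra (H ⊗ₕ K))) :
    (rightSlice φ T : H →L[ℂ] H) = slice φ (toAmp T) := rfl

/-- The product functional `φ ⊗ ψ` on `M ⊗ᵥ N`. -/
def prodFunctional (φ : StrongDual ℂ M) (ψ : StrongDual ℂ N) :
    StrongDual ℂ (M ⊗ᵥ N : VonNeumannAlgebra (H ⊗ₕ K)) := φ.comp (rightSlice ψ)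

theorem prodFunctional_elem (φ : StrongDual ℂ M) (ψ : StrongDual ℂ N) (x : M) (y : N) :
    prodFunctional φ ψ (elem x y) = φ x * ψ y := by
  have h : rightSlice ψ (elem x y) = ψ y • x := by
    refine Subtype.ext (ext_inner_clm fun ξ η => ?_)
    change ⟪ξ, slice ψ (toAmp (elem x y)) η⟫_ℂ = ⟪ξ, ψ y • (x : H →L[ℂ] H) η⟫_ℂ
    rw [inner_slice]
    have h2 : coeffIn ξ η (toAmp (elem x y)) = ⟪ξ, (x : H →L[ℂ] H) η⟫_ℂ • y := by
      refine Subtype.ext (ext_inner_clm fun k l => ?_)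
      change ⟪k, coeff ξ η (mapT (x : H →L[ℂ] H) (y : K →L[ℂ] K)) l⟫_ℂ =
        ⟪k, ⟪ξ, (x : H →L[ℂ] H) η⟫_ℂ • (y : K →L[ℂ] K) l⟫_ℂ
      rw [inner_coeff, mapT_tmul, inner_tmul, inner_smul_right]
    rw [h2, map_smul, inner_smul_right, smul_eq_mul, mul_comm]
  change φ (rightSlice ψ (elem x y)) = _
  rw [h, map_smul, smul_eq_mul, mul_comm]

theorem nonneg_iff_inner (T : H →L[ℂ] H) : 0 ≤ T ↔ ∀ ξ, 0 ≤ ⟪ξ, T ξ⟫_ℂ := by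
  rw [ContinuousLinearMap.nonneg_iff_isPositive, ContinuousLinearMap.isPositive_iff_complex]
  constructor
  · intro h ξ
    obtain ⟨h1, h2⟩ := h ξ
    rw [← inner_conj_symm, ← h1, Complex.conj_ofReal]
    exact_mod_cast h2
  · intro h ξ
    have h1 := h ξ
    rw [← inner_conj_symm] at h1
    have h2 : 0 ≤ ⟪T ξ, ξ⟫_ℂ := by simpa using (star_nonneg_iff (R := ℂ)).mpr h1
    rw [Complex.nonneg_iff] at h2
    exact ⟨Complex.ext rfl (by simpa using h2.2), h2.1⟩

theorem prodFunctional_nonneg (φ : NormalPos M) (ψ : NormalPos N)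
    (T : (M ⊗ᵥ N : VonNeumannAlgebra (H ⊗ₕ K))) (hT : 0 ≤ T) :
    0 ≤ prodFunctional φ.toDual ψ.toDual T := by
  refine φ.nonneg _ ?_
  change (0 : H →L[ℂ] H) ≤ slice ψ.toDual (toAmp T)
  rw [nonneg_iff_inner]
  intro ξ
  rw [inner_slice]
  refine ψ.nonneg _ ?_
  change (0 : K →L[ℂ] K) ≤ coeff ξ ξ (T : H ⊗ₕ K →L[ℂ] H ⊗ₕ K)
  rw [nonneg_iff_inner]
  intro k
  rw [inner_coeff]
  exact (nonneg_iff_inner _).mp (show (0 : H ⊗ₕ K →L[ℂ] H ⊗ₕ K) ≤ T from hT) _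

end VonNeumannTensor

section GNS

variable {H : Type*} [NormedAddCommGroup H] [InnerProductSpace ℂ H] [CompleteSpace H]
variable {K : Type*} [NormedAddCommGroup K] [InnerProductSpace ℂ K] [CompleteSpace K]
variable {M : VonNeumannAlgebra H} {N : VonNeumannAlgebra K}

/-- The GNS map `Γ` of a positive functional. -/
def gnsMap (φ : M →ₚ[ℂ] ℂ) : M →ₗ[ℂ] φ.GNS :=
  (UniformSpace.Completion.toComplₗᵢ (𝕜 := ℂ) (E := φ.PreGNS)).toLinearMap.comp
    φ.toPreGNS.toLinearMap

theorem inner_gnsMap (φ : M →ₚ[ℂ] ℂ) (x y : M) :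
    ⟪gnsMap φ x, gnsMap φ y⟫_ℂ = φ (star x * y) := by
  change ⟪((φ.toPreGNS x : φ.PreGNS) : φ.GNS), ((φ.toPreGNS y : φ.PreGNS) : φ.GNS)⟫_ℂ = _
  rw [UniformSpace.Completion.inner_coe, PositiveLinearMap.preGNS_inner_def]
  rfl

theorem denseRange_gnsMap (φ : M →ₚ[ℂ] ℂ) : DenseRange (gnsMap φ) :=
  (UniformSpace.Completion.denseRange_coe (α := φ.PreGNS)).comp φ.toPreGNS.surjective.denseRange
    (UniformSpace.Completion.continuous_coe _)

/-- A normal positive functional as a positive linear map. -/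
def NormalPos.toPos (φ : NormalPos M) : M →ₚ[ℂ] ℂ :=
  PositiveLinearMap.mk₀ φ.toDual.toLinearMap φ.nonneg

/-- The product of two normal positive functionals as a positive linear map on the von Neumann
tensor product. -/
def prodPos (φ : NormalPos M) (ψ : NormalPos N) :
    (M ⊗ᵥ N : VonNeumannAlgebra (H ⊗ₕ K)) →ₚ[ℂ] ℂ :=
  PositiveLinearMap.mk₀ (prodFunctional φ.toDual ψ.toDual).toLinearMap (prodFunctional_nonneg φ ψ)

/-- The GNS Hilbert space of a normal positive functional. -/
abbrev NormalPos.Space (φ : NormalPos M) : Type _ := φ.toPos.GNS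

/-- The GNS map of a normal positive functional. -/
abbrev NormalPos.Γ (φ : NormalPos M) : M →ₗ[ℂ] φ.Space := gnsMap φ.toPos

theorem dense_span_prod (φ : NormalPos M) (ψ : NormalPos N) :
    Dense (Submodule.span ℂ (Set.range fun p : M × N => tmul (φ.Γ p.1) (ψ.Γ p.2)) :
      Set (φ.Space ⊗ₕ ψ.Space)) :=
  dense_span_tmul_of_dense (denseRange_gnsMap φ.toPos |>.mono Submodule.subset_span)
    (denseRange_gnsMap ψ.toPos |>.mono Submodule.subset_span)

theorem inner_prod_gns (φ : NormalPos M) (ψ : NormalPos N) (p q : M × N) :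
    ⟪tmul (φ.Γ p.1) (ψ.Γ p.2), tmul (φ.Γ q.1) (ψ.Γ q.2)⟫_ℂ =
      ⟪gnsMap (prodPos φ ψ) (elem p.1 p.2), gnsMap (prodPos φ ψ) (elem q.1 q.2)⟫_ℂ := by
  rw [inner_tmul, inner_gnsMap, inner_gnsMap, inner_gnsMap]
  have h : star (elem p.1 p.2) * elem q.1 q.2 = elem (star p.1 * q.1) (star p.2 * q.2) := by
    apply Subtype.ext
    change star (mapT (p.1 : H →L[ℂ] H) (p.2 : K →L[ℂ] K)) *
      mapT (q.1 : H →L[ℂ] H) (q.2 : K →L[ℂ] K) = mapT (star (p.1 : H →L[ℂ] H) * (q.1 : H →L[ℂ] H))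
        (star (p.2 : K →L[ℂ] K) * (q.2 : K →L[ℂ] K))
    rw [star_mapT, mapT_mul]
  rw [h]
  exact (prodFunctional_elem φ.toDual ψ.toDual _ _).symm

/-- The isometry `Γ_φ(x) ⊗ Γ_ψ(y) ↦ Γ_{φ ⊗ ψ}(x ⊗ y)` identifying the tensor product of the two
GNS spaces with the GNS space of the product functional. -/
def gnsProd (φ : NormalPos M) (ψ : NormalPos N) :
    φ.Space ⊗ₕ ψ.Space →L[ℂ] (prodPos φ ψ).GNS :=
  (Finsupp.linearCombination ℂ fun p : M × N =>
    gnsMap (prodPos φ ψ) (elem p.1 p.2)).extendOfNorm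
    (Finsupp.linearCombination ℂ fun p : M × N => tmul (φ.Γ p.1) (ψ.Γ p.2))

theorem gnsProd_tmul (φ : NormalPos M) (ψ : NormalPos N) (x : M) (y : N) :
    gnsProd φ ψ (tmul (φ.Γ x) (ψ.Γ y)) = gnsMap (prodPos φ ψ) (elem x y) := by
  have := LinearMap.extendOfNorm_eq
    (f := Finsupp.linearCombination ℂ fun p : M × N => gnsMap (prodPos φ ψ) (elem p.1 p.2))
    (denseRange_linearCombination (dense_span_prod φ ψ))
    ⟨1, fun c => by
      rw [one_mul]; exact (norm_linearCombination _ _ (inner_prod_gns φ ψ) c).ge⟩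
    (Finsupp.single (x, y) 1)
  simpa [gnsProd] using this

/-- The map `Ξ = Γ_φ ⊗ Γ_ψ` from `M ⊗ᵥ N` to the tensor product of the GNS spaces: the GNS map of
`φ ⊗ ψ`, transported by the adjoint (that is, the inverse, since elementary tensors span a strongly
dense subspace) of the identification `gnsProd`. -/
def Xi (φ : NormalPos M) (ψ : NormalPos N) :
    (M ⊗ᵥ N : VonNeumannAlgebra (H ⊗ₕ K)) →ₗ[ℂ] φ.Space ⊗ₕ ψ.Space :=
  (ContinuousLinearMap.adjoint (gnsProd φ ψ)).toLinearMap.comp (gnsMap (prodPos φ ψ))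

theorem inner_Xi (φ : NormalPos M) (ψ : NormalPos N) (x : M) (y : N)
    (a : (M ⊗ᵥ N : VonNeumannAlgebra (H ⊗ₕ K))) :
    ⟪tmul (φ.Γ x) (ψ.Γ y), Xi φ ψ a⟫_ℂ =
      prodFunctional φ.toDual ψ.toDual (star (elem x y) * a) := by
  change ⟪_, ContinuousLinearMap.adjoint (gnsProd φ ψ) (gnsMap (prodPos φ ψ) a)⟫_ℂ = _
  rw [ContinuousLinearMap.adjoint_inner_right, gnsProd_tmul, inner_gnsMap]
  rfl

theorem Xi_elem (φ : NormalPos M) (ψ : NormalPos N) (x : M) (y : N) :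
    Xi φ ψ (elem x y) = tmul (φ.Γ x) (ψ.Γ y) := by
  have h : innerSL ℂ (Xi φ ψ (elem x y)) = innerSL ℂ (tmul (φ.Γ x) (ψ.Γ y)) := by
    refine ContinuousLinearMap.ext_on (dense_span_prod φ ψ) ?_
    rintro _ ⟨p, rfl⟩
    have h1 : ⟪tmul (φ.Γ p.1) (ψ.Γ p.2), Xi φ ψ (elem x y)⟫_ℂ =
        ⟪tmul (φ.Γ p.1) (ψ.Γ p.2), tmul (φ.Γ x) (ψ.Γ y)⟫_ℂ := by
      rw [inner_Xi, inner_prod_gns φ ψ p (x, y), inner_gnsMap]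
      rfl
    have h2 := congrArg (starRingEnd ℂ) h1
    simpa using h2
  exact (innerSL_inj (𝕜 := ℂ)).mp h

end GNS

section Legs

variable {H : Type*} [NormedAddCommGroup H] [InnerProductSpace ℂ H] [CompleteSpace H]
variable {K : Type*} [NormedAddCommGroup K] [InnerProductSpace ℂ K] [CompleteSpace K]
variable {L : Type*} [NormedAddCommGroup L] [InnerProductSpace ℂ L] [CompleteSpace L]

variable (L) in
/-- Leg numbering: `b ↦ b₁₂ = b ⊗ 1`. -/
def leg12 (b : H ⊗ₕ K →L[ℂ] H ⊗ₕ K) : H ⊗ₕ K ⊗ₕ L →L[ℂ] H ⊗ₕ K ⊗ₕ L :=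
  (assocU H K L).conjStarAlgEquiv (mapT b 1)

variable (K) in
/-- Leg numbering: `u ↦ u₁₃`. -/
def leg13 (u : H ⊗ₕ L →L[ℂ] H ⊗ₕ L) : H ⊗ₕ K ⊗ₕ L →L[ℂ] H ⊗ₕ K ⊗ₕ L :=
  (swapU H K L).conjStarAlgEquiv (mapT 1 u)

theorem conj_swapU (z : L →L[ℂ] L) : (swapU H K L).conjStarAlgEquiv (mapT 1 (mapT 1 z)) =
    mapT 1 (mapT 1 z) := by
  apply ContinuousLinearMap.ext_on (dense_span_tmul3 (H := H) (K := K) (L := L))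
  rintro _ ⟨⟨ξ, k, l⟩, rfl⟩
  have h : (swapU H K L).symm (tmul ξ (tmul k l)) = tmul k (tmul ξ l) := by
    rw [LinearIsometryEquiv.symm_apply_eq, swapU_tmul]
  rw [LinearIsometryEquiv.conjStarAlgEquiv_apply_apply]
  simp [h, mapT_tmul, swapU_tmul]

theorem conj_assocU_symm (z : L →L[ℂ] L) : (assocU H K L).symm.conjStarAlgEquiv
    (mapT 1 (mapT 1 z)) = mapT 1 z := by
  apply ContinuousLinearMap.ext_on (dense_span_tmul3' (H := H) (K := K) (L := L))
  rintro _ ⟨⟨ξ, k, l⟩, rfl⟩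
  rw [LinearIsometryEquiv.conjStarAlgEquiv_apply_apply]
  simp only [LinearIsometryEquiv.symm_symm, assocU_tmul, mapT_tmul]
  rw [LinearIsometryEquiv.symm_apply_eq]
  change _ = assocU H K L (tmul (tmul ξ k) (z l))
  rw [assocU_tmul]
  rfl

theorem leg13_commutes {u : H ⊗ₕ L →L[ℂ] H ⊗ₕ L} {z : L →L[ℂ] L}
    (h : mapT 1 z * u = u * mapT 1 z) :
    mapT 1 (mapT 1 z) * leg13 K u = leg13 K u * mapT 1 (mapT 1 z) := by
  rw [leg13, ← conj_swapU, ← map_mul, ← map_mul, ← mapT_mul, ← mapT_mul, h]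

end Legs

section Quantum

variable {HG : Type*} [NormedAddCommGroup HG] [InnerProductSpace ℂ HG] [CompleteSpace HG]
variable {HN : Type*} [NormedAddCommGroup HN] [InnerProductSpace ℂ HN] [CompleteSpace HN]
variable {HC : Type*} [NormedAddCommGroup HC] [InnerProductSpace ℂ HC] [CompleteSpace HC]

variable (HG) in
/-- A Hopf-von Neumann algebra whose underlying von Neumann algebra acts on `HG`. -/
structure HopfVonNeumannAlgebra where
  /-- The underlying von Neumann algebra. -/
  alg : VonNeumannAlgebra HG
  /-- The comultiplication, a unital `*`-homomorphism. -/
  comul : alg →⋆ₐ[ℂ] (alg ⊗ᵥ alg : VonNeumannAlgebra (HG ⊗ₕ HG))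
  normal : IsNormalMap comul
  /-- Coassociativity: `(Δ ⊗ id) Δ = (id ⊗ Δ) Δ`. -/
  coassoc : ∀ x, (assocU HG HG HG).conjStarAlgEquiv
      (tensorId ((incl (alg ⊗ᵥ alg)).comp comul) (comul x)) =
    idTensor ((incl (alg ⊗ᵥ alg)).comp comul) (toAmp (comul x))

/-- The comultiplication as a map to the bounded operators on `HG ⊗ HG`. -/
def HopfVonNeumannAlgebra.Δ (G : HopfVonNeumannAlgebra HG) :
    G.alg →⋆ₐ[ℂ] (HG ⊗ₕ HG →L[ℂ] HG ⊗ₕ HG) := (incl (G.alg ⊗ᵥ G.alg)).comp G.comul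

/-- The convolution `θ * ψ = (θ ⊗ ψ) Δ`. -/
def HopfVonNeumannAlgebra.conv (G : HopfVonNeumannAlgebra HG) (θ ψ : StrongDual ℂ G.alg) :
    StrongDual ℂ G.alg :=
  (prodFunctional θ ψ).comp ⟨G.comul.toAlgHom.toLinearMap, map_continuous G.comul⟩

/-- An action of a Hopf-von Neumann algebra on a von Neumann algebra `N`. -/
structure HopfAction (G : HopfVonNeumannAlgebra HG) (N : VonNeumannAlgebra HN) where
  /-- The underlying unital `*`-homomorphism. -/
  hom : N →⋆ₐ[ℂ] (N ⊗ᵥ G.alg : VonNeumannAlgebra (HN ⊗ₕ HG))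
  normal : IsNormalMap hom
  /-- The action identity `(α ⊗ id) α = (id ⊗ Δ) α`. -/
  action : ∀ a, (assocU HN HG HG).conjStarAlgEquiv
      (tensorId ((incl (N ⊗ᵥ G.alg)).comp hom) (hom a)) = idTensor G.Δ (toAmp (hom a))

/-- Invariance of a functional under an action: `(ω ⊗ id) α = ω(·) 1`. -/
def HopfAction.Invariant {G : HopfVonNeumannAlgebra HG} {N : VonNeumannAlgebra HN} (α : HopfAction G N)
    (ω : NormalPos N) : Prop :=
  ∀ a, leftSlice ω.toDual (α.hom a) = ω.toDual a • (1 : HG →L[ℂ] HG)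

/-- A corepresentation: `(id ⊗ Δ)(u) = u₁₂ u₁₃`. -/
def IsCorepresentation (G : HopfVonNeumannAlgebra HG) {C : VonNeumannAlgebra HC}
    (u : (C ⊗ᵥ G.alg : VonNeumannAlgebra (HC ⊗ₕ HG))) : Prop :=
  idTensor G.Δ (toAmp u) =
    leg12 HG (u : HC ⊗ₕ HG →L[ℂ] HC ⊗ₕ HG) * leg13 HG (u : HC ⊗ₕ HG →L[ℂ] HC ⊗ₕ HG)

/-- An approximately invariant net of normal states `m`: `m_i * θ - m_i → 0` in norm and
`θ * m_i - m_i → 0` in the weak topology `σ(L¹(G), L^∞(G))`, for every normal state `θ`. -/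
def IsApproxInvariant (G : HopfVonNeumannAlgebra HG) {ι : Type*} [Preorder ι]
    (m : ι → NormalPos G.alg) : Prop :=
  (∀ i, (m i).IsState) ∧ ∀ θ : NormalPos G.alg, θ.IsState →
    Filter.Tendsto (fun i => ‖G.conv (m i).toDual θ.toDual - (m i).toDual‖) Filter.atTop (nhds 0) ∧
    ∀ x, Filter.Tendsto (fun i => G.conv θ.toDual (m i).toDual x - (m i).toDual x)
      Filter.atTop (nhds 0)

variable {G : HopfVonNeumannAlgebra HG} {N : VonNeumannAlgebra HN} (α : HopfAction G N)
variable {C : VonNeumannAlgebra HC}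

/-- The map `id ⊗ α` on `C ⊗ᵥ N`. -/
def HopfAction.ampl (a : (C ⊗ᵥ N : VonNeumannAlgebra (HC ⊗ₕ HN))) :
    HC ⊗ₕ HN ⊗ₕ HG →L[ℂ] HC ⊗ₕ HN ⊗ₕ HG :=
  idTensor ((incl (N ⊗ᵥ G.alg)).comp α.hom) (toAmp a)

theorem ampl_commutes (a : (C ⊗ᵥ N : VonNeumannAlgebra (HC ⊗ₕ HN))) {z : HG →L[ℂ] HG}
    (hz : z ∈ G.alg.commutant) :
    mapT 1 (mapT 1 z) * α.ampl a = α.ampl a * mapT 1 (mapT 1 z) := by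
  apply ext_coeff
  intro ξ η
  rw [coeff_mapT_mul, coeff_mul_mapT, HopfAction.ampl, coeff_idTensor]
  exact right_commutes (α.hom (coeffIn ξ η (toAmp a))).2 hz

variable (u : (C ⊗ᵥ G.alg : VonNeumannAlgebra (HC ⊗ₕ HG)))

/-- The operator `u₁₃ (id ⊗ α)(a)`, regarded as acting on `(HC ⊗ HN) ⊗ HG`. -/
def HopfAction.twisted (a : (C ⊗ᵥ N : VonNeumannAlgebra (HC ⊗ₕ HN))) : amp (HC ⊗ₕ HN) G.alg :=
  ⟨(assocU HC HN HG).symm.conjStarAlgEquiv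
    (leg13 HN (u : HC ⊗ₕ HG →L[ℂ] HC ⊗ₕ HG) * α.ampl a), mem_amp.mpr fun z hz => by
      have h1 := leg13_commutes (K := HN) (right_commutes u.2 hz)
      have h2 := ampl_commutes α a hz
      rw [← conj_assocU_symm, ← map_mul, ← map_mul, ← mul_assoc, h1, mul_assoc, h2, mul_assoc]⟩

/-- The average `(id ⊗ id ⊗ θ)(u₁₃ (id ⊗ α)(a))`. -/
def HopfAction.average (θ : NormalPos G.alg) (a : (C ⊗ᵥ N : VonNeumannAlgebra (HC ⊗ₕ HN))) :
    HC ⊗ₕ HN →L[ℂ] HC ⊗ₕ HN :=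
  slice θ.toDual (α.twisted u a)

variable (μ : NormalPos C) (ω : NormalPos N)

/-- The defining property of `V_u(θ)`: it maps `Ξ(a)` to
`Ξ((id ⊗ id ⊗ θ)(u₁₃ (id ⊗ α)(a)))` for all `a` in `C ⊗ᵥ N`, where the average belongs to
`C ⊗ᵥ N`. -/
def HopfAction.IsV (θ : NormalPos G.alg) (V : μ.Space ⊗ₕ ω.Space →L[ℂ] μ.Space ⊗ₕ ω.Space) : Prop :=
  ∀ a : (C ⊗ᵥ N : VonNeumannAlgebra (HC ⊗ₕ HN)),
    ∃ h : α.average u θ a ∈ C ⊗ᵥ N, V (Xi μ ω a) = Xi μ ω ⟨α.average u θ a, h⟩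

open Classical in
/-- The bounded operator `V_u(θ)` on the tensor product of the two GNS spaces. -/
def HopfAction.V (θ : NormalPos G.alg) : μ.Space ⊗ₕ ω.Space →L[ℂ] μ.Space ⊗ₕ ω.Space :=
  if h : ∃ V, α.IsV u μ ω θ V then h.choose else 0

/-- The common fixed vectors of the operators `V_u(θ)`, over all normal states `θ`. -/
def HopfAction.fixedSpace : Submodule ℂ (μ.Space ⊗ₕ ω.Space) :=
  ⨅ θ : {θ : NormalPos G.alg // θ.IsState}, (α.V u μ ω θ - 1).ker

instance HopfAction.completeSpace_fixedSpace : CompleteSpace (α.fixedSpace u μ ω) := by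
  apply IsClosed.completeSpace_coe (hs := ?_)
  rw [HopfAction.fixedSpace, Submodule.coe_iInf]
  exact isClosed_iInter fun θ => (α.V u μ ω θ - 1).isClosed_ker

/-- The orthogonal projection `P_u` onto the common fixed vectors. -/
def HopfAction.P : μ.Space ⊗ₕ ω.Space →L[ℂ] μ.Space ⊗ₕ ω.Space :=
  (α.fixedSpace u μ ω).starProjection

/-- The set `N_u` of all `b` in `C ⊗ᵥ N` with `(id ⊗ α)(b) = u₁₃* b₁₂`. -/
def HopfAction.fixedSet : Set (C ⊗ᵥ N : VonNeumannAlgebra (HC ⊗ₕ HN)) :=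
  {b | α.ampl b = leg13 HN (star (u : HC ⊗ₕ HG →L[ℂ] HC ⊗ₕ HG)) *
    leg12 HG (b : HC ⊗ₕ HN →L[ℂ] HC ⊗ₕ HN)}

end Quantum

end QErg

end

open QErg

/-! Write avg_θ(a) for (id ⊗ id ⊗ θ)(u₁₃ (id ⊗ α)(a)). On GNS vectors these averages become
contractions. By Kadison–Schwarz for slices (`star_rightSlice_mul_le`), avg_θ(a)* avg_θ(a) is at
most θ(1) times the slice of (id ⊗ α)(a*a), the unitary u₁₃ cancelling. Invariance of ω gives that
slice the μ ⊗ ω-value θ(1) (μ ⊗ ω)(a*a). Hence V(θ) exists with norm at most θ(1)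
(`HopfAction.norm_Xi_avg_le`). The corepresentation and action identities together give avg_φ avg_ψ
= avg_(φ*ψ) for normal ψ (`HopfAction.avg_avg`).

Strong convergence is then a mean ergodic theorem (`tendsto_starProjection_of_absorb`). Since m * θ
- m tends to 0 in norm, V(m) kills every V(θ)x - x in the limit. A vector x orthogonal to all of
these satisfies ⟪x, V(θ)x⟫ = ‖x‖², so contractivity forces V(θ)x = x. Thus the space splits into
fixed vectors and vectors on which V(m) tends to 0.

If μ is faithful, Ξ is injective (`Xi_injective`). The averages of a over the net are bounded by
‖a‖, so they have an ultraweak cluster point b, and Ξ(b) = P Ξ(a) because Ξ is weakly normal. This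
defines E as a contraction (`HopfAction.exists_expectation`). Its range is N_u: being fixed by all
averages means u₁₃ (id ⊗ α)(b) = b ⊗ 1, since vector states determine an operator. Normality and
strong convergence come from the norm density of the functionals ⟪Ξ(c), Ξ(·)⟫ in the predual
(`predual_le_closure_Xi`).

All identities on tensor products are reduced to elementary tensors. What permits this is
`predual_eq_zero`, a substitute for Kaplansky density: a normal functional vanishing on a unital
*-algebra with bicommutant `M` vanishes on `M`. -/

noncomputable section

namespace QErg

/-! ### Bicommutant density, and normal functionals vanishing on a generating *-subalgebra. -/

section Density
variable {H : Type*} [NormedAddCommGroup H] [InnerProductSpace ℂ H] [CompleteSpace H]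

/-- The diagonal action of an operator on a finite direct sum. -/
def diagOp (n : ℕ) (a : H →L[ℂ] H) :
    PiLp 2 (fun _ : Fin n => H) →L[ℂ] PiLp 2 (fun _ : Fin n => H) :=
  (PiLp.continuousLinearEquiv 2 ℂ (fun _ : Fin n => H)).symm.toContinuousLinearMap.comp
    (ContinuousLinearMap.pi fun b => a.comp (PiLp.proj 2 (fun _ : Fin n => H) b))

theorem diagOp_apply {n : ℕ} (a : H →L[ℂ] H) (x : PiLp 2 (fun _ : Fin n => H)) (i : Fin n) :
    diagOp n a x i = a (x i) := by
  simp [diagOp]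

theorem inner_diagOp {n : ℕ} (a : H →L[ℂ] H) (x y : PiLp 2 (fun _ : Fin n => H)) :
    ⟪x, diagOp n a y⟫_ℂ = ⟪diagOp n (star a) x, y⟫_ℂ := by
  simp [PiLp.inner_apply, diagOp_apply, ContinuousLinearMap.star_eq_adjoint,
    ContinuousLinearMap.adjoint_inner_left]

/-- The coordinate inclusion into a finite direct sum. -/
def injOp (n : ℕ) (j : Fin n) : H →L[ℂ] PiLp 2 (fun _ : Fin n => H) :=
  (PiLp.continuousLinearEquiv 2 ℂ (fun _ : Fin n => H)).symm.toContinuousLinearMap.comp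
    (ContinuousLinearMap.single ℂ (fun _ : Fin n => H) j)

theorem sum_injOp {n : ℕ} (x : PiLp 2 (fun _ : Fin n => H)) : ∑ j, injOp n j (x j) = x := by
  ext i
  have : ∀ s : Finset (Fin n), (∑ j ∈ s, injOp n j (x j) : PiLp 2 (fun _ : Fin n => H)) i
      = ∑ j ∈ s, (injOp n j (x j) : PiLp 2 (fun _ : Fin n => H)) i := fun s => by
    simp
  rw [this, Finset.sum_eq_single i]
  · simp [injOp]
  · intro j _ hj; simp [injOp, hj.symm]
  · simp

theorem diagOp_injOp {n : ℕ} (a : H →L[ℂ] H) (j : Fin n) (x : H) :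
    diagOp n a (injOp n j x) = injOp n j (a x) := by
  ext i
  rw [diagOp_apply]
  by_cases h : i = j
  · subst h; simp [injOp]
  · simp [injOp, h]

/-- Von Neumann's argument. The closure of the orbit of ξ under the diagonal action of `A` reduces
that action, so its projection commutes with diagonal `A`. The matrix entries of the projection
therefore commute with `A`, hence with `a`. As `A` is unital, ξ lies in the orbit closure, and so
does its image under `a`. -/
theorem mem_closure_bicommutant (A : StarSubalgebra ℂ (H →L[ℂ] H)) {a : H →L[ℂ] H}
    (ha : ∀ s : H →L[ℂ] H, (∀ y ∈ A, y * s = s * y) → s * a = a * s) {n : ℕ}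
    (ξ : PiLp 2 (fun _ : Fin n => H)) :
    diagOp n a ξ ∈ closure ((fun y => diagOp n y ξ) '' (A : Set (H →L[ℂ] H))) := by
  let V₀ : Submodule ℂ (PiLp 2 (fun _ : Fin n => H)) :=
    { carrier := (fun y => diagOp n y ξ) '' (A : Set (H →L[ℂ] H))
      add_mem' := by
        rintro _ _ ⟨x, hx, rfl⟩ ⟨y, hy, rfl⟩
        exact ⟨x + y, A.add_mem hx hy, by ext i; simp [diagOp_apply]⟩
      zero_mem' := ⟨0, A.zero_mem, by ext i; simp [diagOp_apply]⟩
      smul_mem' := by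
        rintro c _ ⟨x, hx, rfl⟩
        exact ⟨c • x, A.smul_mem hx c, by ext i; simp [diagOp_apply]⟩ }
  let V := V₀.topologicalClosure
  have : CompleteSpace V := V₀.isClosed_topologicalClosure.completeSpace_coe
  have hinv : ∀ y ∈ A, ∀ v ∈ V, diagOp n y v ∈ V := by
    intro y hy v hv
    have hm : Set.MapsTo (diagOp n y) (V₀ : Set (PiLp 2 (fun _ : Fin n => H))) V₀ := by
      rintro _ ⟨x, hx, rfl⟩
      exact ⟨y * x, A.mul_mem hy hx, by ext i; simp [diagOp_apply]⟩
    exact hm.closure (diagOp n y).continuous hv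
  have hinv' : ∀ y ∈ A, ∀ v ∈ Vᗮ, diagOp n y v ∈ Vᗮ := by
    intro y hy v hv w hw
    rw [inner_diagOp]
    exact hv _ (hinv _ (star_mem hy) w hw)
  let P := V.starProjection
  have hP : ∀ y ∈ A, ∀ x, P (diagOp n y x) = diagOp n y (P x) := by
    intro y hy x
    refine (Submodule.eq_starProjection_of_mem_of_inner_eq_zero (hinv y hy _ (V.starProjection_apply_mem x)) ?_)
    intro w hw
    rw [← map_sub]
    exact (Submodule.mem_orthogonal' _ _).mp (hinv' y hy _ (Submodule.sub_starProjection_mem_orthogonal (K := V) x)) w hw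
  have hPa : ∀ x, P (diagOp n a x) = diagOp n a (P x) := by
    have hij : ∀ i j, ∀ x : H, (P (injOp n j (a x))) i = a ((P (injOp n j x)) i) := by
      intro i j x
      have h := ha ((PiLp.proj 2 (fun _ : Fin n => H) i : _ →L[ℂ] H).comp (P.comp (injOp n j))) (by
        intro y hy
        ext z
        change y ((P (injOp n j z)) i) = (P (injOp n j (y z))) i
        rw [← diagOp_injOp, hP y hy, diagOp_apply])
      exact congrArg (fun T => T x) h
    intro x
    conv_lhs => rw [← sum_injOp x]
    conv_rhs => rw [← sum_injOp x]
    simp only [map_sum, diagOp_injOp]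
    refine Finset.sum_congr rfl fun j _ => ?_
    ext i
    rw [hij, diagOp_apply]
  have hξ : ξ ∈ V := V₀.le_topologicalClosure ⟨1, A.one_mem, by ext i; simp [diagOp_apply]⟩
  have h1 : P ξ = ξ := Submodule.starProjection_eq_self_iff.mpr hξ
  have h2 : diagOp n a ξ ∈ V := by
    have := hPa ξ
    rw [h1] at this
    rw [← this]; exact V.starProjection_apply_mem _
  exact h2

/-- The adjoint is not strongly continuous, so self-adjoint parts of approximants need not converge
strongly. They do converge weakly, and on convex sets weak and norm closures agree; Hahn–Banach
makes this precise. -/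
theorem mem_closure_selfAdjoint (A : StarSubalgebra ℂ (H →L[ℂ] H)) {a : H →L[ℂ] H}
    (ha : ∀ s : H →L[ℂ] H, (∀ y ∈ A, y * s = s * y) → s * a = a * s) (hsa : star a = a) {n : ℕ}
    (ξ : PiLp 2 (fun _ : Fin n => H)) :
    diagOp n a ξ ∈ closure ((fun y => diagOp n y ξ) '' {y | y ∈ A ∧ star y = y}) := by
  set S := (fun y => diagOp n y ξ) '' {y : H →L[ℂ] H | y ∈ A ∧ star y = y} with hS
  have hconv : Convex ℝ S := by
    rintro _ ⟨x, ⟨hx, hx'⟩, rfl⟩ _ ⟨y, ⟨hy, hy'⟩, rfl⟩ s t _ _ _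
    refine ⟨(s : ℂ) • x + (t : ℂ) • y, ⟨A.add_mem (A.smul_mem hx _) (A.smul_mem hy _), ?_⟩, ?_⟩
    · simp [hx', hy']
    · ext i; simp [diagOp_apply]
  by_contra hcon
  obtain ⟨f, c, hf, hc⟩ := RCLike.geometric_hahn_banach_closed_point (𝕜 := ℂ) hconv.closure isClosed_closure hcon
  have hzero : ∀ y ∈ A, star y = y → RCLike.re (f (diagOp n y ξ)) = 0 := by
    intro y hy hy'
    by_contra hne
    have hb : ∀ t : ℝ, t * RCLike.re (f (diagOp n y ξ)) < c := by
      intro t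
      have := hf (diagOp n ((t : ℂ) • y) ξ) (subset_closure ⟨_, ⟨A.smul_mem hy _, by simp [hy']⟩, rfl⟩)
      have h2 : diagOp n ((t : ℂ) • y) ξ = (t : ℂ) • diagOp n y ξ := by
        ext i; simp [diagOp_apply]
      rw [h2, map_smul] at this
      simpa using this
    have := hb (c / RCLike.re (f (diagOp n y ξ)))
    rw [div_mul_cancel₀ _ hne] at this
    exact lt_irrefl _ this
  have hc0 : 0 < c := by
    have := hf _ (subset_closure ⟨0, ⟨A.zero_mem, star_zero _⟩, rfl⟩)
    rwa [hzero 0 A.zero_mem (star_zero _)] at this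
  let z := (InnerProductSpace.toDual ℂ (PiLp 2 (fun _ : Fin n => H))).symm f
  have hz : ∀ x, f x = ⟪z, x⟫_ℂ := fun x => by simp [z]
  have hre : ∀ y : H →L[ℂ] H, star y = y → RCLike.re (f (diagOp n y ξ)) =
      (RCLike.re ⟪z, diagOp n y ξ⟫_ℂ + RCLike.re ⟪ξ, diagOp n y z⟫_ℂ) / 2 := by
    intro y hy
    have h : RCLike.re ⟪ξ, diagOp n y z⟫_ℂ = RCLike.re ⟪z, diagOp n y ξ⟫_ℂ := by
      rw [inner_diagOp, hy, inner_re_symm]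
    rw [hz, h, add_self_div_two]
  -- simultaneous approximation on `ξ` and `z`
  have hlim : RCLike.re (f (diagOp n a ξ)) = 0 := by
    rw [hre a hsa]
    let ζ : PiLp 2 (fun _ : Fin (n + n) => H) := WithLp.toLp 2 (Fin.append (fun i => ξ i) (fun i => z i))
    let F : PiLp 2 (fun _ : Fin (n + n) => H) → ℝ := fun x =>
      (RCLike.re (∑ i, ⟪z i, x (Fin.castAdd n i)⟫_ℂ) + RCLike.re (∑ i, ⟪ξ i, x (Fin.natAdd n i)⟫_ℂ)) / 2
    have hF : Continuous F := by
      simp only [F]; fun_prop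
    have hFy : ∀ y : H →L[ℂ] H, F (diagOp (n + n) y ζ) =
        (RCLike.re ⟪z, diagOp n y ξ⟫_ℂ + RCLike.re ⟪ξ, diagOp n y z⟫_ℂ) / 2 := by
      intro y
      simp only [F, ζ, diagOp_apply, PiLp.inner_apply, Fin.append_left, Fin.append_right]
    rw [← hFy]
    have hmem := mem_closure_bicommutant A ha ζ
    have hcl : IsClosed (F ⁻¹' {0}) := isClosed_singleton.preimage hF
    refine hcl.closure_subset_iff.mpr ?_ hmem
    rintro _ ⟨y, hy, rfl⟩
    change F _ = 0
    rw [hFy]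
    -- `F` sees only the self-adjoint part of `y`, on which the real part of `f` is already known to
    -- vanish.
    have h0 := hzero ((2⁻¹ : ℂ) • (y + star y)) (A.smul_mem (A.add_mem hy (star_mem (s := A) hy)) _)
      (by simp [add_comm])
    rw [hz] at h0
    have h3 : diagOp n ((2⁻¹ : ℂ) • (y + star y)) ξ = (2⁻¹ : ℂ) • (diagOp n y ξ + diagOp n (star y) ξ) := by
      ext i; simp [diagOp_apply]
    have h4 : RCLike.re ⟪z, diagOp n (star y) ξ⟫_ℂ = RCLike.re ⟪ξ, diagOp n y z⟫_ℂ := by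
      rw [inner_diagOp, star_star, inner_re_symm]
    have h5 : (2⁻¹ : ℂ) = ((2⁻¹ : ℝ) : ℂ) := by norm_num
    rw [h3, inner_smul_right, inner_add_right, h5, RCLike.re_eq_complex_re,
      Complex.re_ofReal_mul, Complex.add_re] at h0
    simp only [RCLike.re_eq_complex_re] at h4 ⊢
    rw [h4] at h0
    linarith
  rw [hlim] at hc
  linarith

/-- The resolvent-type element `(1 + y²)⁻¹` of a self-adjoint operator. -/
def sqInv (y : H →L[ℂ] H) : H →L[ℂ] H := cfc (fun t : ℝ => (1 + t ^ 2)⁻¹) y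

theorem continuous_sqInv_fun : Continuous fun t : ℝ => (1 + t ^ 2)⁻¹ :=
  Continuous.inv₀ (by fun_prop) fun t => by positivity

theorem norm_sqInv_le (y : H →L[ℂ] H) : ‖sqInv y‖ ≤ 1 := by
  refine norm_cfc_le zero_le_one fun t _ => ?_
  rw [Real.norm_eq_abs, abs_of_pos (by positivity)]
  exact inv_le_one_of_one_le₀ (by nlinarith [sq_nonneg t])

theorem mul_sqInv_eq_cfc {y : H →L[ℂ] H} (hy : IsSelfAdjoint y) :
    y * sqInv y = cfc (fun t : ℝ => t * (1 + t ^ 2)⁻¹) y := by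
  rw [cfc_mul (fun t : ℝ => t) _ y continuous_id.continuousOn continuous_sqInv_fun.continuousOn,
    cfc_id' ℝ y hy]
  rfl

theorem norm_mul_sqInv_le {y : H →L[ℂ] H} (hy : IsSelfAdjoint y) : ‖y * sqInv y‖ ≤ 1 := by
  rw [mul_sqInv_eq_cfc hy]
  refine norm_cfc_le zero_le_one fun t _ => ?_
  rw [Real.norm_eq_abs, abs_mul, abs_of_pos (show (0 : ℝ) < (1 + t ^ 2)⁻¹ by positivity),
    ← div_eq_mul_inv, div_le_one (by positivity)]
  nlinarith [sq_abs t, sq_nonneg (|t| - 1)]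

theorem sq_mul_sqInv {y : H →L[ℂ] H} (hy : IsSelfAdjoint y) : (1 + y * y) * sqInv y = 1 := by
  have h1 : (1 + y * y) = cfc (fun t : ℝ => 1 + t ^ 2) y := by
    rw [cfc_const_add _ _ _ (by fun_prop), cfc_pow_id (R := ℝ) y 2 hy, sq]
    simp
  rw [h1, sqInv, ← cfc_mul _ _ y (by fun_prop) continuous_sqInv_fun.continuousOn]
  rw [← cfc_one ℝ y hy]
  refine cfc_congr fun t _ => mul_inv_cancel₀ (by positivity)

theorem sqInv_commute {y : H →L[ℂ] H} (hy : IsSelfAdjoint y) : y * sqInv y = sqInv y * y := by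
  conv_lhs => rw [sqInv]
  conv_lhs => enter [1]; rw [← cfc_id' ℝ y hy]
  rw [(cfc_commute_cfc (fun t : ℝ => t) (fun t : ℝ => (1 + t ^ 2)⁻¹) y).eq, cfc_id' ℝ y hy]
  rfl

theorem sqInv_mul_sq {y : H →L[ℂ] H} (hy : IsSelfAdjoint y) : sqInv y * (1 + y * y) = 1 := by
  have h : sqInv y * (y * y) = y * y * sqInv y := by
    rw [← mul_assoc, ← sqInv_commute hy, mul_assoc, ← sqInv_commute hy, mul_assoc]
  rw [mul_add, h, mul_one, ← one_add_mul, sq_mul_sqInv hy]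

/-- A resolvent-type identity behind the strong continuity of t ↦ t(1 + t²)⁻¹. The factors to the
left of `b - y` are contractions whatever `y` is, and those to the right depend on `b` only, so it
suffices that `y` be close to `b` on fixed vectors. -/
theorem mul_sqInv_sub {y b : H →L[ℂ] H} (hy : IsSelfAdjoint y) (hb : IsSelfAdjoint b) :
    b * sqInv b - y * sqInv y =
      sqInv y * ((b - y) * sqInv b) - (y * sqInv y) * ((b - y) * (b * sqInv b)) := by
  have h1 : b * sqInv b = sqInv y * ((1 + y * y) * b) * sqInv b := by
    rw [← mul_assoc (sqInv y), sqInv_mul_sq hy, one_mul]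
  have h2 : y * sqInv y = sqInv y * (y * (1 + b * b)) * sqInv b := by
    rw [mul_assoc, mul_assoc y, sq_mul_sqInv hb, mul_one, sqInv_commute hy]
  calc b * sqInv b - y * sqInv y = sqInv y * ((1 + y * y) * b) * sqInv b -
        sqInv y * (y * (1 + b * b)) * sqInv b := by rw [← h1, ← h2]
    _ = sqInv y * ((b - y) * sqInv b) - (sqInv y * y) * ((b - y) * (b * sqInv b)) := by noncomm_ring
    _ = _ := by rw [sqInv_commute hy]

theorem sqInv_mem {S : StarSubalgebra ℂ (H →L[ℂ] H)} (hS : IsClosed (S : Set (H →L[ℂ] H)))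
    {y : H →L[ℂ] H} (hy : y ∈ S) : sqInv y ∈ S :=
  cfc_mem (𝕜' := ℂ) _ hy

/-- An element of the linear span of the vector functionals is strongly continuous. -/
theorem exists_vectors_of_mem_span {M : VonNeumannAlgebra H} {ψ : StrongDual ℂ M}
    (h : ψ ∈ Submodule.span ℂ {φ : StrongDual ℂ M | ∃ η ξ : H, φ = vectorFunctional M η ξ}) :
    ∃ l : List H, ∀ x : M, ‖ψ x‖ ≤ (l.map fun ξ => ‖(x : H →L[ℂ] H) ξ‖).sum := by
  induction h using Submodule.span_induction with
  | mem φ h =>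
    obtain ⟨η, ξ, rfl⟩ := h
    refine ⟨[(‖η‖ : ℂ) • ξ], fun x => ?_⟩
    simpa [norm_smul, vectorFunctional_apply] using norm_inner_le_norm (𝕜 := ℂ) η ((x : H →L[ℂ] H) ξ)
  | zero => exact ⟨[], fun x => by simp⟩
  | add φ ψ _ _ h1 h2 =>
    obtain ⟨l1, h1⟩ := h1
    obtain ⟨l2, h2⟩ := h2
    refine ⟨l1 ++ l2, fun x => ?_⟩
    rw [List.map_append, List.sum_append]
    exact (norm_add_le _ _).trans (add_le_add (h1 x) (h2 x))
  | smul c φ _ h =>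
    obtain ⟨l, h⟩ := h
    refine ⟨l.map fun ξ => c • ξ, fun x => ?_⟩
    have : ((l.map fun ξ => c • ξ).map fun ξ => ‖(x : H →L[ℂ] H) ξ‖).sum =
        ‖c‖ * (l.map fun ξ => ‖(x : H →L[ℂ] H) ξ‖).sum := by
      rw [← List.sum_map_mul_left, List.map_map]
      congr 1
      refine List.map_congr_left fun ξ _ => ?_
      simp [norm_smul]
    rw [this, smul_apply, norm_smul]
    gcongr
    exact h x

theorem exists_selfAdjoint_approx (A : StarSubalgebra ℂ (H →L[ℂ] H)) {a : H →L[ℂ] H}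
    (ha : ∀ s : H →L[ℂ] H, (∀ y ∈ A, y * s = s * y) → s * a = a * s) (hsa : star a = a)
    (l : List H) {ε : ℝ} (hε : 0 < ε) :
    ∃ y ∈ A, star y = y ∧ ∀ ξ ∈ l, ‖(a - y) ξ‖ < ε := by
  obtain ⟨_, ⟨y, ⟨hy, hy'⟩, rfl⟩, hd⟩ := Metric.mem_closure_iff.mp
    (mem_closure_selfAdjoint A ha hsa (WithLp.toLp 2 fun i => l.get i)) ε hε
  refine ⟨y, hy, hy', fun ξ hξ => ?_⟩
  obtain ⟨i, rfl⟩ := List.get_of_mem hξ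
  rw [dist_eq_norm] at hd
  refine lt_of_le_of_lt ?_ hd
  refine le_of_eq_of_le ?_ (PiLp.norm_apply_le _ i)
  simp [diagOp_apply]

theorem exists_selfAdjoint_approx_sum (A : StarSubalgebra ℂ (H →L[ℂ] H)) {a : H →L[ℂ] H}
    (ha : ∀ s : H →L[ℂ] H, (∀ y ∈ A, y * s = s * y) → s * a = a * s) (hsa : star a = a)
    (l : List H) {ε : ℝ} (hε : 0 < ε) :
    ∃ y ∈ A, star y = y ∧ (l.map fun ξ => ‖(a - y) ξ‖).sum < ε := by
  obtain ⟨y, hy, hy', h⟩ := exists_selfAdjoint_approx A ha hsa l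
    (div_pos hε (by positivity : (0 : ℝ) < l.length + 1))
  refine ⟨y, hy, hy', ?_⟩
  have := List.sum_le_card_nsmul (l.map fun ξ => ‖(a - y) ξ‖) (ε / (l.length + 1)) (by
    intro x hx
    obtain ⟨ξ, hξ, rfl⟩ := List.mem_map.mp hx
    exact (h ξ hξ).le)
  refine this.trans_lt ?_
  rw [List.length_map, nsmul_eq_mul, ← mul_div_assoc, div_lt_iff₀ (by positivity)]
  nlinarith

/-- A norm limit of strongly continuous functionals is controlled only on bounded sets, while the
bicommutant approximants of `b` may be unbounded. Passing from y to y(1 + y²)⁻¹ puts everything in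
the unit ball and keeps strong convergence. -/
theorem predual_eq_zero_mul_sqInv {M : VonNeumannAlgebra H} {A : StarSubalgebra ℂ (H →L[ℂ] H)}
    (hA : ∀ y ∈ A, y ∈ M)
    (hM : ∀ a ∈ M, ∀ s : H →L[ℂ] H, (∀ y ∈ A, y * s = s * y) → s * a = a * s)
    {φ : StrongDual ℂ M} (hφ : φ ∈ predual M) (h0 : ∀ x : M, (x : H →L[ℂ] H) ∈ A → φ x = 0)
    (b : M) (hb : star b = b) (c : M) (hc : (c : H →L[ℂ] H) = sqInv (b : H →L[ℂ] H)) :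
    φ (b * c) = 0 := by
  have hbs : IsSelfAdjoint (b : H →L[ℂ] H) := congrArg Subtype.val hb
  refine norm_le_zero_iff.mp (le_of_forall_pos_le_add fun ε hε => ?_)
  -- `φ - ψ` will be evaluated at a difference of two contractions, of norm at most 2, so ε/4 costs
  -- ε/2.
  obtain ⟨ψ, hψ, hd⟩ := Metric.mem_closure_iff.mp (show φ ∈ closure _ from hφ) (ε / 4) (by positivity)
  obtain ⟨l, hl⟩ := exists_vectors_of_mem_span hψ
  -- These are the vectors on which `b - y` acts in `mul_sqInv_sub`.
  obtain ⟨y, hy, hy', hs⟩ := exists_selfAdjoint_approx_sum A (hM b b.2) (congrArg Subtype.val hb)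
    (l.map (fun ξ => sqInv (b : H →L[ℂ] H) ξ) ++
      l.map (fun ξ => ((b : H →L[ℂ] H) * sqInv (b : H →L[ℂ] H)) ξ)) (half_pos hε)
  -- Functional calculus leaves `A` but stays in its norm closure, where φ still vanishes by norm
  -- continuity.
  have hcl : y * sqInv y ∈ A.topologicalClosure :=
    mul_mem (A.le_topologicalClosure hy)
      (sqInv_mem A.isClosed_topologicalClosure (A.le_topologicalClosure hy))
  have hcl' : ∀ z ∈ A.topologicalClosure, z ∈ M := fun z hz =>
    (isClosed_vonNeumann M).closure_subset_iff.mpr hA hz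
  let z : M := ⟨y * sqInv y, hcl' _ hcl⟩
  have hz : φ z = 0 := by
    obtain ⟨w, hw, hwz⟩ := mem_closure_iff_seq_limit.mp (show y * sqInv y ∈ closure _ from hcl)
    have ht : Filter.Tendsto (fun n => (⟨w n, hA _ (hw n)⟩ : M)) Filter.atTop (nhds z) :=
      tendsto_subtype_rng.mpr hwz
    have := (φ.continuous.tendsto z).comp ht
    refine tendsto_nhds_unique this ?_
    refine tendsto_const_nhds.congr fun n => (h0 _ (hw n)).symm
  have hn1 : ‖b * c‖ ≤ 1 := by
    change ‖(b : H →L[ℂ] H) * (c : H →L[ℂ] H)‖ ≤ 1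
    rw [hc]; exact norm_mul_sqInv_le hbs
  have hn2 : ‖z‖ ≤ 1 := norm_mul_sqInv_le hy'
  have h1 : ‖(φ - ψ) (b * c - z)‖ ≤ ε / 2 := by
    calc ‖(φ - ψ) (b * c - z)‖ ≤ ‖φ - ψ‖ * ‖b * c - z‖ := (φ - ψ).le_opNorm _
      _ ≤ ε / 4 * (1 + 1) := by
        gcongr
        · rw [← dist_eq_norm]; exact hd.le
        · exact (norm_sub_le _ _).trans (add_le_add hn1 hn2)
      _ = ε / 2 := by ring
  have h2 : ‖ψ (b * c - z)‖ ≤ ε / 2 := by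
    refine (hl _).trans (le_trans ?_ hs.le)
    rw [List.map_append, List.sum_append, List.map_map, List.map_map, ← List.sum_map_add]
    refine List.sum_le_sum fun ξ _ => ?_
    have h3 : ((b * c - z : M) : H →L[ℂ] H) = sqInv y * (((b : H →L[ℂ] H) - y) * sqInv (b : H →L[ℂ] H)) -
        (y * sqInv y) * (((b : H →L[ℂ] H) - y) * ((b : H →L[ℂ] H) * sqInv (b : H →L[ℂ] H))) := by
      rw [← mul_sqInv_sub hy' hbs, ← hc]; rfl
    rw [h3]
    refine (norm_sub_le _ _).trans (add_le_add ?_ ?_)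
    · refine ((sqInv y).le_opNorm _).trans ?_
      exact mul_le_of_le_one_left (norm_nonneg _) (norm_sqInv_le y)
    · refine ((y * sqInv y).le_opNorm _).trans ?_
      exact mul_le_of_le_one_left (norm_nonneg _) (norm_mul_sqInv_le hy')
  have h4 : φ (b * c) = (φ - ψ) (b * c - z) + ψ (b * c - z) := by
    rw [sub_apply, sub_add_cancel, map_sub, hz, sub_zero]
  rw [h4, zero_add]
  exact (norm_add_le _ _).trans (by linarith)

theorem norm_sqInv_sub_one_le {y : H →L[ℂ] H} (hy : IsSelfAdjoint y) :
    ‖sqInv y - 1‖ ≤ ‖y‖ ^ 2 := by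
  have h : sqInv y - 1 = - (y * y * sqInv y) := by
    conv_lhs => rw [← sq_mul_sqInv hy]
    noncomm_ring
  rw [h, norm_neg]
  calc ‖y * y * sqInv y‖ ≤ ‖y‖ * ‖y‖ * 1 := by
        refine (norm_mul_le _ _).trans ?_
        gcongr
        · exact norm_mul_le _ _
        · exact norm_sqInv_le y
    _ = ‖y‖ ^ 2 := by ring

/-- A normal functional on `M` vanishing on a unital `*`-subalgebra with bicommutant `M`
vanishes. -/
theorem predual_eq_zero {M : VonNeumannAlgebra H} {A : StarSubalgebra ℂ (H →L[ℂ] H)}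
    (hA : ∀ y ∈ A, y ∈ M)
    (hM : ∀ a ∈ M, ∀ s : H →L[ℂ] H, (∀ y ∈ A, y * s = s * y) → s * a = a * s)
    {φ : StrongDual ℂ M} (hφ : φ ∈ predual M) (h0 : ∀ x : M, (x : H →L[ℂ] H) ∈ A → φ x = 0)
    (x : M) : φ x = 0 := by
  have hsa : ∀ b : M, star b = b → φ b = 0 := by
    intro b hb
    have hbs : IsSelfAdjoint (b : H →L[ℂ] H) := congrArg Subtype.val hb
    -- Scaling removes the factor `sqInv`: φ vanishes at b(1 + t²b²)⁻¹, which differs from b by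
    -- O(t²) in norm.
    have key : ∀ t : ℝ, 0 < t → ‖φ b‖ ≤ ‖φ‖ * ‖b‖ ^ 3 * t ^ 2 := by
      intro t ht
      have htb : IsSelfAdjoint (((t : ℂ) • b : M) : H →L[ℂ] H) := by
        change star ((t : ℂ) • (b : H →L[ℂ] H)) = (t : ℂ) • (b : H →L[ℂ] H)
        rw [star_smul, hbs.star_eq]; simp
      have hmem : sqInv (((t : ℂ) • b : M) : H →L[ℂ] H) ∈ M :=
        sqInv_mem (S := M.toStarSubalgebra) (isClosed_vonNeumann M) ((t : ℂ) • b).2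
      have h1 := predual_eq_zero_mul_sqInv hA hM hφ h0 ((t : ℂ) • b) (Subtype.ext htb) ⟨_, hmem⟩ rfl
      rw [smul_mul_assoc, map_smul, smul_eq_mul, mul_eq_zero] at h1
      have h2 := h1.resolve_left (by exact_mod_cast ht.ne')
      have h3 : φ b = - φ (b * (⟨_, hmem⟩ - 1)) := by
        rw [mul_sub, map_sub, h2, mul_one]; simp
      rw [h3, norm_neg]
      calc ‖φ (b * (⟨_, hmem⟩ - 1))‖ ≤ ‖φ‖ * (‖b‖ * ‖(⟨_, hmem⟩ - 1 : M)‖) :=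
            (φ.le_opNorm _).trans (by gcongr; exact norm_mul_le _ _)
        _ ≤ ‖φ‖ * (‖b‖ * ‖(t : ℂ) • b‖ ^ 2) := by
            gcongr
            exact norm_sqInv_sub_one_le htb
        _ = _ := by rw [norm_smul, Complex.norm_real, Real.norm_eq_abs, mul_pow, sq_abs]; ring
    have hlim : Filter.Tendsto (fun t : ℝ => ‖φ‖ * ‖b‖ ^ 3 * t ^ 2) (nhdsWithin 0 (Set.Ioi 0)) (nhds 0) := by
      have : Continuous fun t : ℝ => ‖φ‖ * ‖b‖ ^ 3 * t ^ 2 := by fun_prop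
      have h := (this.tendsto 0).mono_left (nhdsWithin_le_nhds (s := Set.Ioi 0))
      simpa using h
    have := ge_of_tendsto hlim (Filter.eventually_of_mem self_mem_nhdsWithin key)
    exact norm_le_zero_iff.mp this
  have hdec : x = (2⁻¹ : ℂ) • (x + star x) + (2⁻¹ * Complex.I : ℂ) • ((-Complex.I) • (x - star x)) := by
    rw [smul_smul, smul_add, smul_sub]
    have : (2⁻¹ * Complex.I * -Complex.I : ℂ) = 2⁻¹ := by
      rw [mul_assoc, mul_neg, Complex.I_mul_I]; norm_num
    rw [this]
    have h2 : x = (2⁻¹ : ℂ) • x + (2⁻¹ : ℂ) • x := by rw [← add_smul]; norm_num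
    conv_lhs => rw [h2]
    abel
  rw [hdec, map_add, map_smul, map_smul, hsa, hsa, smul_zero, smul_zero, add_zero]
  · rw [star_smul, star_sub, star_star]
    simp only [star_neg, Complex.star_def, Complex.conj_I, neg_neg, neg_smul, smul_sub]
    abel
  · rw [star_add, star_star, add_comm]

end Density

/-! ### Elementary tensors determine normal functionals. -/

section Tensor
variable {H : Type*} [NormedAddCommGroup H] [InnerProductSpace ℂ H] [CompleteSpace H]
variable {K : Type*} [NormedAddCommGroup K] [InnerProductSpace ℂ K] [CompleteSpace K]

/-- The linear span of a submonoid closed under the adjoint, as a unital `*`-subalgebra. -/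
def starSpan (S : Submonoid (H →L[ℂ] H)) (hS : ∀ x ∈ S, star x ∈ S) :
    StarSubalgebra ℂ (H →L[ℂ] H) where
  toSubalgebra := Algebra.adjoin ℂ (S : Set (H →L[ℂ] H))
  star_mem' := by
    intro x hx
    change star x ∈ Subalgebra.toSubmodule (Algebra.adjoin ℂ (S : Set (H →L[ℂ] H)))
    have hx' : x ∈ Subalgebra.toSubmodule (Algebra.adjoin ℂ (S : Set (H →L[ℂ] H))) := hx
    clear hx
    rw [Algebra.adjoin_eq_span, Submonoid.closure_eq] at hx' ⊢
    induction hx' using Submodule.span_induction with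
    | mem x h => exact Submodule.subset_span (hS x h)
    | zero => rw [star_zero]; exact Submodule.zero_mem _
    | add x y _ _ hx hy => rw [star_add]; exact Submodule.add_mem _ hx hy
    | smul c x _ hx => rw [star_smul]; exact Submodule.smul_mem _ _ hx

theorem mem_starSpan {S : Submonoid (H →L[ℂ] H)} {hS : ∀ x ∈ S, star x ∈ S} {x : H →L[ℂ] H} :
    x ∈ starSpan S hS ↔ x ∈ Submodule.span ℂ (S : Set (H →L[ℂ] H)) := by
  have : Subalgebra.toSubmodule (Algebra.adjoin ℂ (S : Set (H →L[ℂ] H))) =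
      Submodule.span ℂ (S : Set (H →L[ℂ] H)) := by
    rw [Algebra.adjoin_eq_span, Submonoid.closure_eq]
  rw [← this]; rfl

/-- The elementary tensors, as a submonoid. -/
def elemSubmonoid (M : VonNeumannAlgebra H) (N : VonNeumannAlgebra K) :
    Submonoid (H ⊗ₕ K →L[ℂ] H ⊗ₕ K) where
  carrier := {S | ∃ x ∈ M, ∃ y ∈ N, S = mapT x y}
  one_mem' := ⟨1, one_mem M, 1, one_mem N, mapT_one_one.symm⟩
  mul_mem' := by
    rintro _ _ ⟨x, hx, y, hy, rfl⟩ ⟨x', hx', y', hy', rfl⟩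
    exact ⟨x * x', mul_mem hx hx', y * y', mul_mem hy hy', (mapT_mul _ _ _ _).symm⟩

/-- A normal functional on `M ⊗ᵥ N` is determined by its values on elementary tensors. -/
theorem predual_eq_zero_of_elem {M : VonNeumannAlgebra H} {N : VonNeumannAlgebra K}
    {φ : StrongDual ℂ (M ⊗ᵥ N : VonNeumannAlgebra (H ⊗ₕ K))} (hφ : φ ∈ predual (M ⊗ᵥ N))
    (h : ∀ x y, φ (elem x y) = 0) (T : (M ⊗ᵥ N : VonNeumannAlgebra (H ⊗ₕ K))) : φ T = 0 := by
  have hS : ∀ x ∈ elemSubmonoid M N, star x ∈ elemSubmonoid M N := by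
    rintro _ ⟨x, hx, y, hy, rfl⟩
    exact ⟨star x, star_mem hx, star y, star_mem hy, star_mapT _ _⟩
  have hmem : ∀ y ∈ starSpan (elemSubmonoid M N) hS,
      ∃ hy : y ∈ M ⊗ᵥ N, φ ⟨y, hy⟩ = 0 := by
    intro y hy
    rw [mem_starSpan] at hy
    induction hy using Submodule.span_induction with
    | mem x hx =>
      obtain ⟨x, hx, y, hy, rfl⟩ := hx
      exact ⟨(elem ⟨x, hx⟩ ⟨y, hy⟩).2, h ⟨x, hx⟩ ⟨y, hy⟩⟩
    | zero => exact ⟨zero_mem _, map_zero φ⟩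
    | add x y _ _ hx hy =>
      obtain ⟨hx, hx'⟩ := hx
      obtain ⟨hy, hy'⟩ := hy
      refine ⟨add_mem hx hy, ?_⟩
      have := map_add φ ⟨x, hx⟩ ⟨y, hy⟩
      rw [hx', hy', add_zero] at this
      exact this
    | smul c x _ hx =>
      obtain ⟨hx, hx'⟩ := hx
      refine ⟨SMulMemClass.smul_mem c hx, ?_⟩
      have := map_smul φ c ⟨x, hx⟩
      rw [hx', smul_zero] at this
      exact this
  refine predual_eq_zero (A := starSpan (elemSubmonoid M N) hS) (fun y hy => (hmem y hy).1) ?_ hφ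
    (fun x hx => (hmem x hx).2) T
  intro a ha s hs
  refine commutes_of_mem_vnTensor ha fun x hx y hy => hs _ ?_
  rw [mem_starSpan]
  exact Submodule.subset_span ⟨x, hx, y, hy, rfl⟩

end Tensor

/-! ### Normal operator-valued maps and duality between the algebra and its predual. -/

section Predual
variable {H : Type*} [NormedAddCommGroup H] [InnerProductSpace ℂ H] [CompleteSpace H]
variable {K : Type*} [NormedAddCommGroup K] [InnerProductSpace ℂ K] [CompleteSpace K]
variable {L : Type*} [NormedAddCommGroup L] [InnerProductSpace ℂ L] [CompleteSpace L]
variable {L' : Type*} [NormedAddCommGroup L'] [InnerProductSpace ℂ L'] [CompleteSpace L']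
variable {M : VonNeumannAlgebra H} {N : VonNeumannAlgebra K}

instance completeSpace_vonNeumann : CompleteSpace M :=
  (isClosed_vonNeumann M).completeSpace_coe

theorem isClosed_predual : IsClosed (predual M : Set (StrongDual ℂ M)) :=
  Submodule.isClosed_topologicalClosure _

theorem vectorFunctional_mem_predual (η ξ : H) : vectorFunctional M η ξ ∈ predual M :=
  Submodule.le_topologicalClosure _ (Submodule.subset_span ⟨η, ξ, rfl⟩)

/-- A continuous linear map carrying vector functionals into a closed subspace carries the whole
predual into it. -/
theorem predual_map_mem {E : Type*} [NormedAddCommGroup E] [NormedSpace ℂ E]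
    (F : StrongDual ℂ M →L[ℂ] E) (W : Submodule ℂ E) (hW : IsClosed (W : Set E))
    (h : ∀ η ξ : H, F (vectorFunctional M η ξ) ∈ W) {φ : StrongDual ℂ M} (hφ : φ ∈ predual M) :
    F φ ∈ W := by
  have h1 : Submodule.span ℂ {φ : StrongDual ℂ M | ∃ η ξ : H, φ = vectorFunctional M η ξ} ≤
      W.comap F.toLinearMap := by
    rw [Submodule.span_le]
    rintro _ ⟨η, ξ, rfl⟩
    exact h η ξ
  exact Submodule.topologicalClosure_minimal _ h1 (hW.preimage F.continuous) hφ

/-- Used for identities that are linear and norm continuous in a normal functional, such as Fubini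
rules for slices: vector functionals then suffice. -/
theorem predual_eq_of_vectorFunctional {E : Type*} [NormedAddCommGroup E] [NormedSpace ℂ E]
    (F F' : StrongDual ℂ M →L[ℂ] E)
    (h : ∀ η ξ : H, F (vectorFunctional M η ξ) = F' (vectorFunctional M η ξ)) {φ : StrongDual ℂ M}
    (hφ : φ ∈ predual M) : F φ = F' φ := by
  have := predual_map_mem (F - F') ⊥ (by simp) (fun η ξ => by simp [h]) hφ
  simpa [sub_eq_zero] using this

/-- The functional `x ↦ ⟪η, f x ξ⟫`. -/
def matrixFunctional (f : M →L[ℂ] (L →L[ℂ] L)) (η ξ : L) : StrongDual ℂ M :=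
  (innerSL ℂ η).comp ((ContinuousLinearMap.apply ℂ L ξ).comp f)

theorem matrixFunctional_apply (f : M →L[ℂ] (L →L[ℂ] L)) (η ξ : L) (x : M) :
    matrixFunctional f η ξ x = ⟪η, f x ξ⟫_ℂ := rfl

/-- An operator-valued map is normal if all its matrix coefficients are. -/
def IsNormalOp (f : M →L[ℂ] (L →L[ℂ] L)) : Prop := ∀ η ξ, matrixFunctional f η ξ ∈ predual M

theorem continuous_matrixFunctional_left (f : M →L[ℂ] (L →L[ℂ] L)) (ξ : L) :
    Continuous fun η => matrixFunctional f η ξ := by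
  unfold matrixFunctional
  exact ((innerSL ℂ (E := L)).continuous).clm_comp continuous_const

theorem continuous_matrixFunctional_right (f : M →L[ℂ] (L →L[ℂ] L)) (η : L) :
    Continuous fun ξ => matrixFunctional f η ξ := by
  unfold matrixFunctional
  exact continuous_const.clm_comp
    (((ContinuousLinearMap.apply ℂ L).continuous).clm_comp continuous_const)

/-- Matrix coefficients depend sesquilinearly and norm continuously on their two vectors, and the
predual is a norm closed subspace; the two vectors are extended one after the other. -/
theorem isNormalOp_of_dense {ι : Type*} {v : ι → L}
    (hv : Dense (Submodule.span ℂ (Set.range v) : Set L)) (f : M →L[ℂ] (L →L[ℂ] L))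
    (h : ∀ i j, matrixFunctional f (v i) (v j) ∈ predual M) : IsNormalOp f := by
  have h1 : ∀ j η, matrixFunctional f η (v j) ∈ predual M := by
    intro j η
    have hc : IsClosed {η | matrixFunctional f η (v j) ∈ predual M} :=
      isClosed_predual.preimage (continuous_matrixFunctional_left f (v j))
    refine hc.closure_subset_iff.mpr ?_ (hv η)
    intro x hx
    induction hx using Submodule.span_induction with
    | mem x hx => obtain ⟨i, rfl⟩ := hx; exact h i j
    | zero =>
      change matrixFunctional f 0 (v j) ∈ predual M
      have : matrixFunctional f 0 (v j) = 0 := by ext; simp [matrixFunctional_apply]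
      rw [this]; exact zero_mem _
    | add x y _ _ hx hy =>
      change matrixFunctional f (x + y) (v j) ∈ predual M
      have : matrixFunctional f (x + y) (v j) =
          matrixFunctional f x (v j) + matrixFunctional f y (v j) := by
        ext; simp [matrixFunctional_apply]
      rw [this]; exact add_mem hx hy
    | smul c x _ hx =>
      change matrixFunctional f (c • x) (v j) ∈ predual M
      have : matrixFunctional f (c • x) (v j) = (starRingEnd ℂ c) • matrixFunctional f x (v j) := by
        ext; simp [matrixFunctional_apply, mul_comm]
      rw [this]; exact Submodule.smul_mem _ _ hx
  intro η ξ
  have hc : IsClosed {ξ | matrixFunctional f η ξ ∈ predual M} :=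
    isClosed_predual.preimage (continuous_matrixFunctional_right f η)
  refine hc.closure_subset_iff.mpr ?_ (hv ξ)
  intro x hx
  induction hx using Submodule.span_induction with
  | mem x hx => obtain ⟨i, rfl⟩ := hx; exact h1 i η
  | zero =>
    change matrixFunctional f η 0 ∈ predual M
    have : matrixFunctional f η 0 = 0 := by ext; simp [matrixFunctional_apply]
    rw [this]; exact zero_mem _
  | add x y _ _ hx hy =>
    change matrixFunctional f η (x + y) ∈ predual M
    have : matrixFunctional f η (x + y) = matrixFunctional f η x + matrixFunctional f η y := by
      ext; simp [matrixFunctional_apply]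
    rw [this]; exact add_mem hx hy
  | smul c x _ hx =>
    change matrixFunctional f η (c • x) ∈ predual M
    have : matrixFunctional f η (c • x) = c • matrixFunctional f η x := by
      ext; simp [matrixFunctional_apply]
    rw [this]; exact Submodule.smul_mem _ _ hx

/-- Left multiplication of an operator-valued map. -/
def opMulLeft (a : L →L[ℂ] L) (f : M →L[ℂ] (L →L[ℂ] L)) : M →L[ℂ] (L →L[ℂ] L) :=
  (ContinuousLinearMap.mul ℂ (L →L[ℂ] L) a).comp f

/-- Right multiplication of an operator-valued map. -/
def opMulRight (f : M →L[ℂ] (L →L[ℂ] L)) (a : L →L[ℂ] L) : M →L[ℂ] (L →L[ℂ] L) :=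
  ((ContinuousLinearMap.mul ℂ (L →L[ℂ] L)).flip a).comp f

theorem IsNormalOp.mulLeft {f : M →L[ℂ] (L →L[ℂ] L)} (hf : IsNormalOp f) (a : L →L[ℂ] L) :
    IsNormalOp (opMulLeft a f) := by
  intro η ξ
  convert hf (star a η) ξ using 1
  ext x
  change ⟪η, a (f x ξ)⟫_ℂ = ⟪star a η, f x ξ⟫_ℂ
  rw [ContinuousLinearMap.star_eq_adjoint, ContinuousLinearMap.adjoint_inner_left]

theorem IsNormalOp.mulRight {f : M →L[ℂ] (L →L[ℂ] L)} (hf : IsNormalOp f) (a : L →L[ℂ] L) :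
    IsNormalOp (opMulRight f a) := fun η ξ => hf η (a ξ)

theorem IsNormalOp.sub {f g : M →L[ℂ] (L →L[ℂ] L)} (hf : IsNormalOp f) (hg : IsNormalOp g) :
    IsNormalOp (f - g) := by
  intro η ξ
  convert sub_mem (hf η ξ) (hg η ξ) using 1
  ext x
  simp [matrixFunctional_apply]

/-- Conjugation by a unitary, as a bounded linear map. -/
def conjL (U : L ≃ₗᵢ[ℂ] L') : (L →L[ℂ] L) →L[ℂ] (L' →L[ℂ] L') :=
  ⟨U.conjStarAlgEquiv.toAlgEquiv.toLinearMap, map_continuous U.conjStarAlgEquiv⟩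

theorem conjL_apply (U : L ≃ₗᵢ[ℂ] L') (T : L →L[ℂ] L) : conjL U T = U.conjStarAlgEquiv T := rfl

theorem inner_conjL (U : L ≃ₗᵢ[ℂ] L') (T : L →L[ℂ] L) (η ξ : L') :
    ⟪η, conjL U T ξ⟫_ℂ = ⟪U.symm η, T (U.symm ξ)⟫_ℂ := by
  rw [conjL_apply, LinearIsometryEquiv.conjStarAlgEquiv_apply_apply,
    ← LinearIsometryEquiv.inner_map_map U (U.symm η), LinearIsometryEquiv.apply_symm_apply]

theorem IsNormalOp.conj {f : M →L[ℂ] (L →L[ℂ] L)} (hf : IsNormalOp f) (U : L ≃ₗᵢ[ℂ] L') :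
    IsNormalOp ((conjL U).comp f) := by
  intro η ξ
  convert hf (U.symm η) (U.symm ξ) using 1
  ext x
  exact inner_conjL U (f x) η ξ

theorem IsNormalOp.comp {f : N →L[ℂ] (L →L[ℂ] L)} (hf : IsNormalOp f) {g : M →L[ℂ] N}
    (hg : IsNormalMap g) : IsNormalOp (f.comp g) := by
  intro η ξ
  obtain ⟨ψ, hψ, h⟩ := hg _ (hf η ξ)
  convert hψ using 1
  ext x
  exact (h x).symm

/-- Precomposition with `g` is norm continuous on functionals, so testing vector functionals of `P`
is enough, and these pull back to matrix coefficients of `f`. -/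
theorem IsNormalOp.predual_comp {f : M →L[ℂ] (L →L[ℂ] L)} (hf : IsNormalOp f)
    {P : VonNeumannAlgebra L} (g : M →L[ℂ] P) (hg : ∀ x, (g x : L →L[ℂ] L) = f x)
    {φ : StrongDual ℂ P} (hφ : φ ∈ predual P) : φ.comp g ∈ predual M := by
  refine predual_map_mem ((ContinuousLinearMap.compL ℂ M P ℂ).flip g) _ isClosed_predual ?_ hφ
  intro η ξ
  convert hf η ξ using 1
  ext x
  change ⟪η, (g x : L →L[ℂ] L) ξ⟫_ℂ = _
  rw [hg]; rfl

theorem isNormalOp_inclL : IsNormalOp (inclL M) := fun η ξ => vectorFunctional_mem_predual η ξ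

theorem predual_mul_left {φ : StrongDual ℂ M} (hφ : φ ∈ predual M) (a : M) :
    φ.comp (ContinuousLinearMap.mul ℂ M a) ∈ predual M :=
  (isNormalOp_inclL.mulLeft (a : H →L[ℂ] H)).predual_comp _ (fun _ => rfl) hφ

theorem predual_mul_right {φ : StrongDual ℂ M} (hφ : φ ∈ predual M) (a : M) :
    φ.comp ((ContinuousLinearMap.mul ℂ M).flip a) ∈ predual M :=
  (isNormalOp_inclL.mulRight (a : H →L[ℂ] H)).predual_comp _ (fun _ => rfl) hφ

theorem IsNormalOp.eq_of_elem {f g : (M ⊗ᵥ N : VonNeumannAlgebra (H ⊗ₕ K)) →L[ℂ] (L →L[ℂ] L)}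
    (hf : IsNormalOp f) (hg : IsNormalOp g) (h : ∀ x y, f (elem x y) = g (elem x y))
    (T : (M ⊗ᵥ N : VonNeumannAlgebra (H ⊗ₕ K))) : f T = g T := by
  refine ext_inner_clm fun k l => ?_
  have := predual_eq_zero_of_elem ((hf.sub hg) k l) (fun x y => by
    simp [matrixFunctional_apply, h]) T
  rwa [matrixFunctional_apply, sub_apply, sub_apply, inner_sub_right, sub_eq_zero] at this

/-- Membership in `P` means commuting with P', and for each S in P' the maps S f(·) and f(·) S are
normal, so they can be compared on elementary tensors. -/
theorem IsNormalOp.mem_of_elem {f : (M ⊗ᵥ N : VonNeumannAlgebra (H ⊗ₕ K)) →L[ℂ] (L →L[ℂ] L)}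
    (hf : IsNormalOp f) (P : VonNeumannAlgebra L) (h : ∀ x y, f (elem x y) ∈ P)
    (T : (M ⊗ᵥ N : VonNeumannAlgebra (H ⊗ₕ K))) : f T ∈ P := by
  rw [← P.commutant_commutant, VonNeumannAlgebra.mem_commutant_iff]
  intro S hS
  exact (hf.mulLeft S).eq_of_elem (hf.mulRight S) (fun x y =>
    (VonNeumannAlgebra.mem_commutant_iff.mp hS _ (h x y)).symm) T

/-- Multiplication is only separately normal, so one variable is extended from elementary tensors at
a time. -/
theorem IsNormalOp.map_mul_of_elem
    {f : (M ⊗ᵥ N : VonNeumannAlgebra (H ⊗ₕ K)) →L[ℂ] (L →L[ℂ] L)} (hf : IsNormalOp f)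
    (h : ∀ x y x' y', f (elem x y * elem x' y') = f (elem x y) * f (elem x' y'))
    (S T : (M ⊗ᵥ N : VonNeumannAlgebra (H ⊗ₕ K))) : f (S * T) = f S * f T := by
  have hl : ∀ a : (M ⊗ᵥ N : VonNeumannAlgebra (H ⊗ₕ K)),
      IsNormalMap (ContinuousLinearMap.mul ℂ _ a) := fun a φ hφ =>
    ⟨_, predual_mul_left hφ a, fun _ => rfl⟩
  have hr : ∀ a : (M ⊗ᵥ N : VonNeumannAlgebra (H ⊗ₕ K)),
      IsNormalMap ((ContinuousLinearMap.mul ℂ _).flip a) := fun a φ hφ =>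
    ⟨_, predual_mul_right hφ a, fun _ => rfl⟩
  refine (hf.comp (hl S)).eq_of_elem (hf.mulLeft (f S)) (fun x y => ?_) T
  exact (hf.comp (hr (elem x y))).eq_of_elem (hf.mulRight (f (elem x y))) (fun x' y' => h _ _ _ _) S

/-- Every bounded functional on the predual is the evaluation at an element of the algebra. -/
theorem exists_eval (F : StrongDual ℂ M →ₗ[ℂ] ℂ) (R : ℝ) (hF : ∀ φ, ‖F φ‖ ≤ R * ‖φ‖) :
    ∃ x : M, ∀ φ ∈ predual M, F φ = φ x := by
  -- A negative bound forces `F` to vanish; otherwise the form (η, ξ) ↦ F(ω_{η,ξ}) is bounded by `R`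
  -- and gives an operator.
  by_cases hR : 0 ≤ R
  swap
  · have h0 : ∀ φ : StrongDual ℂ M, F φ = 0 := fun φ => norm_le_zero_iff.mp ((hF φ).trans
      (mul_nonpos_of_nonpos_of_nonneg (le_of_not_ge hR) (norm_nonneg _)))
    exact ⟨0, fun φ _ => by rw [h0, map_zero]⟩
  have hn : ∀ η ξ : H, ‖vectorFunctional M η ξ‖ ≤ ‖η‖ * ‖ξ‖ := fun η ξ =>
    ContinuousLinearMap.opNorm_le_bound _ (by positivity) fun x => by
      rw [vectorFunctional_apply]
      refine (norm_inner_le_norm _ _).trans ?_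
      rw [mul_assoc]
      gcongr
      rw [mul_comm]
      exact (x : H →L[ℂ] H).le_opNorm ξ
  obtain ⟨S, hS⟩ := exists_clm_of_form (fun η ξ => F (vectorFunctional M η ξ)) R
    (fun x x' y => by
      rw [← map_add]; congr 1; ext z; simp [vectorFunctional_apply])
    (fun x x' y => by
      rw [← map_add]; congr 1; ext z; simp [vectorFunctional_apply])
    (fun c x y => by
      rw [← smul_eq_mul, ← map_smul]; congr 1; ext z
      simp [vectorFunctional_apply, mul_comm])
    (fun c x y => by
      rw [← smul_eq_mul, ← map_smul]; congr 1; ext z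
      simp [vectorFunctional_apply])
    (fun x y => by
      rw [mul_assoc]
      exact (hF _).trans (by gcongr; exact hn x y))
  -- For y in the commutant, ω_{η,yξ} and ω_{y*η,ξ} coincide on `M`, so `S` commutes with y.
  have hmem : S ∈ M := by
    rw [← M.commutant_commutant, VonNeumannAlgebra.mem_commutant_iff]
    intro y hy
    refine ext_inner_clm fun k l => ?_
    rw [mul_apply_eq_comp, mul_apply_eq_comp, hS, ← ContinuousLinearMap.adjoint_inner_left, hS]
    congr 1
    ext x
    rw [vectorFunctional_apply, vectorFunctional_apply, ContinuousLinearMap.adjoint_inner_left]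
    have := VonNeumannAlgebra.mem_commutant_iff.mp hy _ x.2
    exact congrArg (fun T => ⟪k, T l⟫_ℂ) this.symm
  refine ⟨⟨S, hmem⟩, fun φ hφ => ?_⟩
  refine predual_eq_of_vectorFunctional (F.mkContinuous R hF)
    (ContinuousLinearMap.apply ℂ ℂ (⟨S, hmem⟩ : M)) (fun η ξ => ?_) hφ
  exact (hS η ξ).symm

/-- A subspace of the predual separating the points of the algebra is dense. -/
theorem predual_le_closure (D : Submodule ℂ (StrongDual ℂ M))
    (hD : D ≤ predual M) (h : ∀ x : M, (∀ φ ∈ D, φ x = 0) → x = 0) : predual M ≤ D.topologicalClosure := by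
  intro φ hφ
  by_contra hcon
  obtain ⟨F, c, hF, hc⟩ := RCLike.geometric_hahn_banach_closed_point (𝕜 := ℂ)
    (D.topologicalClosure.restrictScalars ℝ).convex D.isClosed_topologicalClosure hcon
  have hc0 : 0 < c := by
    have := hF 0 (zero_mem _)
    simpa using this
  have hzero : ∀ ψ ∈ D, F ψ = 0 := by
    intro ψ hψ
    by_contra hne
    -- Rescaled so that `F` takes the value `c` exactly, against the strict separation.
    have hb := hF (((c : ℂ) / F ψ) • ψ) (D.le_topologicalClosure (D.smul_mem _ hψ))
    rw [map_smul, smul_eq_mul, div_mul_cancel₀ _ hne] at hb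
    simp at hb
  obtain ⟨x, hx⟩ := exists_eval (M := M) F.toLinearMap ‖F‖ F.le_opNorm
  have hx0 : x = 0 := h x fun ψ hψ => (hx ψ (hD hψ)).symm.trans (hzero ψ hψ)
  have h1 := hx φ hφ
  rw [hx0, map_zero] at h1
  change F φ = 0 at h1
  rw [h1, map_zero] at hc
  linarith

/-- Bounded families in a von Neumann algebra converge ultraweakly along ultrafilters. -/
theorem exists_ultraweak_limit {ι : Type*} (U : Ultrafilter ι) (x : ι → M) (R : ℝ)
    (hx : ∀ i, ‖x i‖ ≤ R) :
    ∃ b : M, ‖b‖ ≤ R ∧ ∀ φ ∈ predual M, Filter.Tendsto (fun i => φ (x i)) U (nhds (φ b)) := by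
  have hb : ∀ (φ : StrongDual ℂ M) i, ‖φ (x i)‖ ≤ R * ‖φ‖ := fun φ i => by
    rw [mul_comm]; exact (φ.le_opNorm _).trans (by gcongr; exact hx i)
  have hlim : ∀ φ : StrongDual ℂ M, ∃ z, Filter.Tendsto (fun i => φ (x i)) U (nhds z) := by
    intro φ
    obtain ⟨z, -, hz⟩ := (isCompact_closedBall (0 : ℂ) (R * ‖φ‖)).ultrafilter_le_nhds'
      (U.map fun i => φ (x i)) (Ultrafilter.mem_map.mpr (Filter.Eventually.of_forall fun i => by
        simpa using hb φ i))
    exact ⟨z, hz⟩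
  choose B hB using hlim
  obtain ⟨b, h⟩ := exists_eval (M := M)
    { toFun := B
      map_add' := fun φ ψ => tendsto_nhds_unique (hB (φ + ψ)) ((hB φ).add (hB ψ))
      map_smul' := fun c φ => tendsto_nhds_unique (hB (c • φ)) ((hB φ).const_mul c) } R
    (fun φ => le_of_tendsto (hB φ).norm (Filter.Eventually.of_forall (hb φ)))
  have hconv : ∀ φ ∈ predual M, Filter.Tendsto (fun i => φ (x i)) U (nhds (φ b)) := fun φ hφ => by
    rw [← h φ hφ]; exact hB φ
  refine ⟨b, ?_, hconv⟩
  obtain ⟨i₀, -⟩ := U.nonempty_of_mem Filter.univ_mem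
  refine ContinuousLinearMap.opNorm_le_bound _ ((norm_nonneg _).trans (hx i₀)) fun ξ => ?_
  set ζ := (b : H →L[ℂ] H) ξ with hζ
  have h1 : ‖ζ‖ * ‖ζ‖ ≤ ‖ζ‖ * (R * ‖ξ‖) := by
    rw [← @inner_self_eq_norm_mul_norm ℂ]
    refine (RCLike.re_le_norm _).trans ?_
    refine le_of_tendsto (hconv _ (vectorFunctional_mem_predual ζ ξ)).norm
      (Filter.Eventually.of_forall fun i => ?_)
    refine (norm_inner_le_norm _ _).trans ?_
    gcongr
    exact ((x i : H →L[ℂ] H).le_opNorm ξ).trans (by gcongr; exact hx i)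
  rcases (norm_nonneg ζ).eq_or_lt with h0 | h0
  · change ‖ζ‖ ≤ _
    rw [← h0]; exact mul_nonneg ((norm_nonneg _).trans (hx i₀)) (norm_nonneg _)
  · exact le_of_mul_le_mul_left h1 h0

end Predual

/-! ### The maps id ⊗ f and f ⊗ id as normal *-homomorphisms, and slices. -/

section NormalTensor
variable {H : Type*} [NormedAddCommGroup H] [InnerProductSpace ℂ H] [CompleteSpace H]
variable {K : Type*} [NormedAddCommGroup K] [InnerProductSpace ℂ K] [CompleteSpace K]
variable {L : Type*} [NormedAddCommGroup L] [InnerProductSpace ℂ L] [CompleteSpace L]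
variable {M : VonNeumannAlgebra H} {N : VonNeumannAlgebra K}

/-- A `*`-homomorphism into the bounded operators, as a bounded linear map. -/
def homL (f : M →⋆ₐ[ℂ] (L →L[ℂ] L)) : M →L[ℂ] (L →L[ℂ] L) :=
  ⟨f.toAlgHom.toLinearMap, map_continuous f⟩

theorem homL_apply (f : M →⋆ₐ[ℂ] (L →L[ℂ] L)) (x : M) : homL f x = f x := rfl

/-- The matrix coefficient along the first leg, as a bounded linear map. -/
def coeffL (ξ η : H) : (H ⊗ₕ K →L[ℂ] H ⊗ₕ K) →L[ℂ] (K →L[ℂ] K) :=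
  LinearMap.mkContinuous
    { toFun := coeff ξ η
      map_add' := coeff_add ξ η
      map_smul' := fun c T => coeff_smul c ξ η T } (‖ξ‖ * ‖η‖) (fun T =>
        (norm_coeff_le ξ η T).trans (by rw [mul_right_comm]))

/-- The matrix coefficient along the first leg, as a map from `M ⊗ᵥ N` to `N`. -/
def coeffInL (ξ η : H) : (M ⊗ᵥ N : VonNeumannAlgebra (H ⊗ₕ K)) →L[ℂ] N :=
  ((coeffL ξ η).comp (inclL (M ⊗ᵥ N))).codRestrict (N.toStarSubalgebra.toSubalgebra.toSubmodule)
    fun T => (coeffIn ξ η (toAmp T)).2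

theorem coeffInL_apply (ξ η : H) (T : (M ⊗ᵥ N : VonNeumannAlgebra (H ⊗ₕ K))) :
    coeffInL ξ η T = coeffIn ξ η (toAmp T) := rfl

theorem predual_comp_coeffInL (ξ η : H) {φ : StrongDual ℂ N} (hφ : φ ∈ predual N) :
    φ.comp (coeffInL (M := M) ξ η) ∈ predual (M ⊗ᵥ N) := by
  refine IsNormalOp.predual_comp (f := (coeffL ξ η).comp (inclL (M ⊗ᵥ N))) (fun k l => ?_) _
    (fun _ => rfl) hφ
  convert vectorFunctional_mem_predual (M := M ⊗ᵥ N) (tmul ξ k) (tmul η l) using 1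
  ext T
  exact inner_coeff ξ η _ k l

/-- The map `id ⊗ f` on `M ⊗ᵥ N`, as a bounded linear map. -/
def idL (f : N →⋆ₐ[ℂ] (L →L[ℂ] L)) :
    (M ⊗ᵥ N : VonNeumannAlgebra (H ⊗ₕ K)) →L[ℂ] (H ⊗ₕ L →L[ℂ] H ⊗ₕ L) :=
  let F : (M ⊗ᵥ N : VonNeumannAlgebra (H ⊗ₕ K)) →ₗ[ℂ] (H ⊗ₕ L →L[ℂ] H ⊗ₕ L) :=
    { toFun := fun T => idTensor f (toAmp T)
      map_add' := fun S T => ext_coeff fun ξ η => by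
        rw [coeff_add, coeff_idTensor, coeff_idTensor, coeff_idTensor, ← map_add,
          ← coeffInL_apply, map_add]
        rfl
      map_smul' := fun c T => ext_coeff fun ξ η => by
        rw [RingHom.id_apply, coeff_smul, coeff_idTensor, coeff_idTensor, ← map_smul,
          ← coeffInL_apply, map_smul]
        rfl }
  -- `idTensor` is known only through its coefficients. These are continuous and separate operators,
  -- so the closed graph theorem applies.
  ⟨F, F.continuous_of_seq_closed_graph fun u x y hx hy => ext_coeff fun ξ η => by
    have h1 := ((coeffL (K := L) ξ η).continuous.tendsto y).comp hy
    have h2 := ((map_continuous f).tendsto _).comp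
      (((coeffInL (M := M) (N := N) ξ η).continuous.tendsto x).comp hx)
    refine tendsto_nhds_unique h1 ?_
    change Filter.Tendsto _ _ (nhds (coeff ξ η (idTensor f (toAmp x))))
    rw [coeff_idTensor]
    refine h2.congr fun n => ?_
    exact (coeff_idTensor f (toAmp (u n)) ξ η).symm⟩

theorem idL_apply (f : N →⋆ₐ[ℂ] (L →L[ℂ] L)) (T : (M ⊗ᵥ N : VonNeumannAlgebra (H ⊗ₕ K))) :
    idL f T = idTensor f (toAmp T) := rfl

theorem coeff_idL (f : N →⋆ₐ[ℂ] (L →L[ℂ] L)) (T : (M ⊗ᵥ N : VonNeumannAlgebra (H ⊗ₕ K)))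
    (ξ η : H) : coeff ξ η (idL f T) = f (coeffIn ξ η (toAmp T)) := coeff_idTensor f _ ξ η

theorem inner_idL (f : N →⋆ₐ[ℂ] (L →L[ℂ] L)) (T : (M ⊗ᵥ N : VonNeumannAlgebra (H ⊗ₕ K)))
    (ξ η : H) (k l : L) : ⟪tmul ξ k, idL f T (tmul η l)⟫_ℂ =
      ⟪k, f (coeffIn ξ η (toAmp T)) l⟫_ℂ := by
  rw [← inner_coeff, coeff_idL]

theorem isNormalOp_idL {f : N →⋆ₐ[ℂ] (L →L[ℂ] L)} (hf : IsNormalOp (homL f)) :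
    IsNormalOp (idL (M := M) f) := by
  refine isNormalOp_of_dense dense_span_tmul _ fun p q => ?_
  convert predual_comp_coeffInL (M := M) p.1 q.1 (hf p.2 q.2) using 1
  ext T
  exact inner_idL f T _ _ _ _

theorem coeff_mapT (ξ η : H) (x : H →L[ℂ] H) (y : K →L[ℂ] K) :
    coeff ξ η (mapT x y) = ⟪ξ, x η⟫_ℂ • y :=
  ext_inner_clm fun k l => by
    rw [inner_coeff, mapT_tmul, inner_tmul, smul_apply, inner_smul_right]

theorem coeffIn_elem (ξ η : H) (x : M) (y : N) :
    coeffIn ξ η (toAmp (elem x y)) = ⟪ξ, (x : H →L[ℂ] H) η⟫_ℂ • y :=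
  Subtype.ext (ext_inner_clm fun k l => by
    change ⟪k, coeff ξ η (mapT (x : H →L[ℂ] H) (y : K →L[ℂ] K)) l⟫_ℂ =
      ⟪k, ⟪ξ, (x : H →L[ℂ] H) η⟫_ℂ • (y : K →L[ℂ] K) l⟫_ℂ
    rw [coeff_mapT]
    rfl)

theorem idL_elem (f : N →⋆ₐ[ℂ] (L →L[ℂ] L)) (x : M) (y : N) :
    idL f (elem x y) = mapT (x : H →L[ℂ] H) (f y) :=
  ext_coeff fun ξ η => by rw [coeff_idL, coeffIn_elem, coeff_mapT, map_smul]

theorem elem_mul_elem (x x' : M) (y y' : N) :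
    elem x y * elem x' y' = elem (x * x') (y * y') := Subtype.ext (mapT_mul _ _ _ _).symm

/-- Coefficients along the first leg are not multiplicative, so the product rule is checked on
elementary tensors and extended by normality. -/
theorem idL_mul {f : N →⋆ₐ[ℂ] (L →L[ℂ] L)} (hf : IsNormalOp (homL f))
    (S T : (M ⊗ᵥ N : VonNeumannAlgebra (H ⊗ₕ K))) : idL f (S * T) = idL f S * idL f T := by
  refine (isNormalOp_idL hf).map_mul_of_elem (fun x y x' y' => ?_) S T
  rw [elem_mul_elem, idL_elem, idL_elem, idL_elem, ← mapT_mul, map_mul]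
  rfl

theorem coeff_star (ξ η : H) (T : H ⊗ₕ K →L[ℂ] H ⊗ₕ K) :
    coeff ξ η (star T) = star (coeff η ξ T) :=
  ext_inner_clm fun k l => by
    rw [inner_coeff, ContinuousLinearMap.star_eq_adjoint, ContinuousLinearMap.star_eq_adjoint,
      ContinuousLinearMap.adjoint_inner_right, ContinuousLinearMap.adjoint_inner_right,
      ← inner_conj_symm, ← inner_coeff, inner_conj_symm]

theorem idL_star (f : N →⋆ₐ[ℂ] (L →L[ℂ] L)) (T : (M ⊗ᵥ N : VonNeumannAlgebra (H ⊗ₕ K))) :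
    idL f (star T) = star (idL f T) :=
  ext_coeff fun ξ η => by
    rw [coeff_idL, coeff_star, coeff_idL, ← map_star]
    congr 1
    exact Subtype.ext (coeff_star ξ η _)

theorem elem_one_one : elem (1 : M) (1 : N) = 1 := Subtype.ext mapT_one_one

theorem idL_one (f : N →⋆ₐ[ℂ] (L →L[ℂ] L)) :
    idL f (1 : (M ⊗ᵥ N : VonNeumannAlgebra (H ⊗ₕ K))) = 1 := by
  rw [← elem_one_one, idL_elem, map_one]
  exact mapT_one_one

variable (M) in
/-- The `*`-homomorphism `id ⊗ f` on `M ⊗ᵥ N` for a normal `*`-homomorphism `f`. -/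
def idHom (f : N →⋆ₐ[ℂ] (L →L[ℂ] L)) (hf : IsNormalOp (homL f)) :
    (M ⊗ᵥ N : VonNeumannAlgebra (H ⊗ₕ K)) →⋆ₐ[ℂ] (H ⊗ₕ L →L[ℂ] H ⊗ₕ L) where
  toFun := idL f
  map_one' := idL_one f
  map_mul' := idL_mul hf
  map_zero' := map_zero _
  map_add' := map_add _
  commutes' c := by
    rw [Algebra.algebraMap_eq_smul_one, map_smul, idL_one, Algebra.algebraMap_eq_smul_one]
  map_star' := idL_star f

/-- The flip `M ⊗ᵥ N → N ⊗ᵥ M`. -/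
def flipL : (M ⊗ᵥ N : VonNeumannAlgebra (H ⊗ₕ K)) →L[ℂ]
    (N ⊗ᵥ M : VonNeumannAlgebra (K ⊗ₕ H)) :=
  ((conjL (flipU H K)).comp (inclL (M ⊗ᵥ N))).codRestrict
    ((N ⊗ᵥ M).toStarSubalgebra.toSubalgebra.toSubmodule) fun T =>
      (isNormalOp_inclL.conj (flipU H K)).mem_of_elem (N ⊗ᵥ M)
        (fun x y => by
          change (flipU H K).conjStarAlgEquiv (mapT (x : H →L[ℂ] H) (y : K →L[ℂ] K)) ∈ _
          rw [conj_flipU]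
          exact (elem y x).2) T

theorem flipL_mul (S T : (M ⊗ᵥ N : VonNeumannAlgebra (H ⊗ₕ K))) :
    flipL (S * T) = flipL S * flipL T := Subtype.ext (map_mul (flipU H K).conjStarAlgEquiv _ _)

theorem isNormalMap_flipL : IsNormalMap (flipL (M := M) (N := N)) := fun φ hφ =>
  ⟨φ.comp flipL, (isNormalOp_inclL.conj (flipU H K)).predual_comp _ (fun _ => rfl) hφ,
    fun _ => rfl⟩

/-- The map `f ⊗ id` on `M ⊗ᵥ N`, as a bounded linear map. -/
def homIdL (f : M →⋆ₐ[ℂ] (L →L[ℂ] L)) :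
    (M ⊗ᵥ N : VonNeumannAlgebra (H ⊗ₕ K)) →L[ℂ] (L ⊗ₕ K →L[ℂ] L ⊗ₕ K) :=
  (conjL (flipU K L)).comp ((idL f).comp flipL)

theorem isNormalOp_homIdL {f : M →⋆ₐ[ℂ] (L →L[ℂ] L)} (hf : IsNormalOp (homL f)) :
    IsNormalOp (homIdL (N := N) f) :=
  ((isNormalOp_idL hf).comp isNormalMap_flipL).conj _

theorem homIdL_mul {f : M →⋆ₐ[ℂ] (L →L[ℂ] L)} (hf : IsNormalOp (homL f))
    (S T : (M ⊗ᵥ N : VonNeumannAlgebra (H ⊗ₕ K))) : homIdL f (S * T) = homIdL f S * homIdL f T := by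
  change conjL _ (idL f (flipL (S * T))) = _
  rw [flipL_mul, idL_mul hf]
  exact map_mul (flipU K L).conjStarAlgEquiv _ _

theorem flipL_elem (x : M) (y : N) : flipL (elem x y) = elem y x :=
  Subtype.ext (conj_flipU _ _)

theorem homIdL_elem (f : M →⋆ₐ[ℂ] (L →L[ℂ] L)) (x : M) (y : N) :
    homIdL f (elem x y) = mapT (f x) (y : K →L[ℂ] K) := by
  change conjL _ (idL f (flipL (elem x y))) = _
  rw [flipL_elem, idL_elem]
  exact conj_flipU _ _

theorem inner_homIdL (f : M →⋆ₐ[ℂ] (L →L[ℂ] L)) (T : (M ⊗ᵥ N : VonNeumannAlgebra (H ⊗ₕ K)))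
    (k l : L) (g h : K) : ⟪tmul k g, homIdL f T (tmul l h)⟫_ℂ =
      ⟪k, f (coeffIn g h (flipAmp T)) l⟫_ℂ := by
  have h1 : ∀ (k : L) (g : K), (flipU K L).symm (tmul k g) = tmul g k := fun k g => by
    rw [LinearIsometryEquiv.symm_apply_eq, flipU_tmul]
  change ⟪_, conjL _ _ _⟫_ℂ = _
  rw [inner_conjL, h1, h1]
  exact inner_idL f (flipL T) g h k l

/-- Needed so that the second leg of f ⊗ id can be sliced by functionals on `N`. -/
theorem homIdL_mem_amp {f : M →⋆ₐ[ℂ] (L →L[ℂ] L)} (hf : IsNormalOp (homL f))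
    (T : (M ⊗ᵥ N : VonNeumannAlgebra (H ⊗ₕ K))) : homIdL f T ∈ amp L N := by
  refine (isNormalOp_homIdL hf).mem_of_elem _ (fun x y => mem_amp_of_coeff fun ξ η => ?_) T
  rw [homIdL_elem, coeff_mapT]
  exact SMulMemClass.smul_mem _ y.2

/-- The slice of a fixed operator, as a bounded linear map of the functional. -/
def sliceL {X : Type*} [NormedAddCommGroup X] [InnerProductSpace ℂ X] [CompleteSpace X]
    (T : amp X N) : StrongDual ℂ N →L[ℂ] (X →L[ℂ] X) :=
  LinearMap.mkContinuous
    { toFun := fun φ => slice φ T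
      map_add' := fun φ ψ => ext_inner_clm fun ξ η => by
        simp [inner_slice]
      map_smul' := fun c φ => ext_inner_clm fun ξ η => by
        simp [inner_slice] } ‖T‖ (fun φ => (norm_slice_le φ T).trans (mul_comm _ _).le)

theorem inner_coeff_flip (T : (M ⊗ᵥ N : VonNeumannAlgebra (H ⊗ₕ K))) (g h : K) (ξ η : H) :
    ⟪ξ, (coeffIn g h (flipAmp T) : H →L[ℂ] H) η⟫_ℂ =
      ⟪tmul ξ g, (T : H ⊗ₕ K →L[ℂ] H ⊗ₕ K) (tmul η h)⟫_ℂ := by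
  have h1 : ∀ (ξ : H) (g : K), (flipU H K).symm (tmul g ξ) = tmul ξ g := fun k g => by
    rw [LinearIsometryEquiv.symm_apply_eq, flipU_tmul]
  refine (inner_coeff g h _ ξ η).trans ?_
  change ⟪_, conjL _ _ _⟫_ℂ = _
  rw [inner_conjL, h1, h1]

/-- Slices by vector functionals are coefficients of the flipped operator; with
`predual_eq_of_vectorFunctional` this reduces statements on normal slices to coefficients. -/
theorem rightSlice_vectorFunctional (T : (M ⊗ᵥ N : VonNeumannAlgebra (H ⊗ₕ K))) (g h : K) :
    rightSlice (vectorFunctional N g h) T = coeffIn g h (flipAmp T) := by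
  refine Subtype.ext (ext_inner_clm fun ξ η => ?_)
  rw [coe_rightSlice, inner_slice, vectorFunctional_apply, inner_coeff_flip]
  exact inner_coeff ξ η _ g h

/-- Right slices, as a bounded linear map of the functional. -/
def rightSliceL (T : (M ⊗ᵥ N : VonNeumannAlgebra (H ⊗ₕ K))) : StrongDual ℂ N →L[ℂ] M :=
  (sliceL (toAmp T)).codRestrict (M.toStarSubalgebra.toSubalgebra.toSubmodule)
    fun φ => slice_mem φ T

/-- Slicing the second leg commutes with applying a homomorphism to the first leg. -/
theorem hom_rightSlice {f : M →⋆ₐ[ℂ] (L →L[ℂ] L)} (hf : IsNormalOp (homL f))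
    {ψ : StrongDual ℂ N} (hψ : ψ ∈ predual N) (T : (M ⊗ᵥ N : VonNeumannAlgebra (H ⊗ₕ K))) :
    f (rightSlice ψ T) = slice ψ (⟨homIdL f T, homIdL_mem_amp hf T⟩ : amp L N) := by
  refine predual_eq_of_vectorFunctional ((homL f).comp (rightSliceL T))
    (sliceL (⟨homIdL f T, homIdL_mem_amp hf T⟩ : amp L N)) (fun g h => ?_) hψ
  change f (rightSlice _ T) = slice _ _
  refine ext_inner_clm fun k l => ?_
  rw [rightSlice_vectorFunctional, inner_slice, ← inner_homIdL]
  exact (inner_coeff k l _ g h).symm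

theorem predual_rightSlice {φ : StrongDual ℂ M} (hφ : φ ∈ predual M) {ψ : StrongDual ℂ N}
    (hψ : ψ ∈ predual N) : prodFunctional φ ψ ∈ predual (M ⊗ᵥ N) := by
  refine IsNormalOp.predual_comp (f := (inclL M).comp (rightSlice ψ)) (fun ξ η => ?_) _
    (fun _ => rfl) hφ
  convert predual_comp_coeffInL (M := M) ξ η hψ using 1
  ext T
  exact inner_slice ψ (toAmp T) ξ η

end NormalTensor

/-! ### GNS maps of product functionals: normality, density, injectivity and strong convergence. -/

section GNSNormal
variable {H : Type*} [NormedAddCommGroup H] [InnerProductSpace ℂ H] [CompleteSpace H]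
variable {K : Type*} [NormedAddCommGroup K] [InnerProductSpace ℂ K] [CompleteSpace K]
variable {M : VonNeumannAlgebra H} {N : VonNeumannAlgebra K}

theorem norm_gnsMap_le (φ : NormalPos M) (x : M) :
    ‖φ.Γ x‖ ≤ Real.sqrt ‖φ.toDual‖ * ‖x‖ := by
  refine Real.le_sqrt_of_sq_le (y := ‖φ.toDual‖ * ‖x‖ ^ 2) ?_ |>.trans (le_of_eq ?_)
  · rw [sq, ← @inner_self_eq_norm_mul_norm ℂ, inner_gnsMap]
    refine (RCLike.re_le_norm _).trans ?_
    refine (φ.toDual.le_opNorm _).trans ?_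
    rw [sq]
    gcongr
    exact (norm_mul_le _ _).trans (by rw [norm_star])
  · rw [Real.sqrt_mul (norm_nonneg _), Real.sqrt_sq (norm_nonneg _)]

/-- The GNS map as a bounded linear map. -/
def gnsL (φ : NormalPos M) : M →L[ℂ] φ.Space := φ.Γ.mkContinuous _ (norm_gnsMap_le φ)

/-- For w = Γ(c) the functional is x ↦ φ(c*x), which is normal; general w follow by density and
closedness of the predual. -/
theorem gnsFunctional_mem_predual (φ : NormalPos M) (w : φ.Space) :
    (innerSL ℂ w).comp (gnsL φ) ∈ predual M := by
  have hc : IsClosed {w : φ.Space | (innerSL ℂ w).comp (gnsL φ) ∈ predual M} :=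
    isClosed_predual.preimage ((innerSL ℂ (E := φ.Space)).continuous.clm_comp continuous_const)
  refine hc.closure_subset_iff.mpr ?_ (denseRange_gnsMap φ.toPos w)
  rintro _ ⟨c, rfl⟩
  have : (innerSL ℂ (gnsMap φ.toPos c)).comp (gnsL φ) =
      φ.toDual.comp (ContinuousLinearMap.mul ℂ M (star c)) := by
    ext x
    exact inner_gnsMap φ.toPos c x
  change (innerSL ℂ (gnsMap φ.toPos c)).comp (gnsL φ) ∈ predual M
  rw [this]
  exact predual_mul_left φ.normal (star c)

/-- The product of two normal positive functionals. -/
def prodNormal (φ : NormalPos M) (ψ : NormalPos N) :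
    NormalPos (M ⊗ᵥ N : VonNeumannAlgebra (H ⊗ₕ K)) where
  toDual := prodFunctional φ.toDual ψ.toDual
  normal := predual_rightSlice φ.normal ψ.normal
  nonneg := prodFunctional_nonneg φ ψ

variable (φ : NormalPos M) (ψ : NormalPos N)

/-- The GNS map of a product functional as a bounded linear map. -/
def gnsProdL : (M ⊗ᵥ N : VonNeumannAlgebra (H ⊗ₕ K)) →L[ℂ] (prodPos φ ψ).GNS :=
  gnsL (prodNormal φ ψ)

theorem gnsProdFunctional_mem_predual (w : (prodPos φ ψ).GNS) :
    (innerSL ℂ w).comp (gnsProdL φ ψ) ∈ predual (M ⊗ᵥ N) :=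
  gnsFunctional_mem_predual (prodNormal φ ψ) w

theorem adjoint_gnsProd_gnsProd (v : φ.Space ⊗ₕ ψ.Space) :
    ContinuousLinearMap.adjoint (gnsProd φ ψ) (gnsProd φ ψ v) = v := by
  have : (ContinuousLinearMap.adjoint (gnsProd φ ψ)).comp (gnsProd φ ψ) =
      ContinuousLinearMap.id ℂ _ := by
    refine ContinuousLinearMap.ext_on (dense_span_prod φ ψ) ?_
    rintro _ ⟨p, rfl⟩
    change ContinuousLinearMap.adjoint (gnsProd φ ψ) (gnsProd φ ψ _) = _
    rw [gnsProd_tmul]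
    exact Xi_elem φ ψ p.1 p.2
  exact congrArg (fun T => T v) this

/-- The identification is onto. For a vector w orthogonal to its range, ⟪w, Γ(·)⟫ is a normal
functional vanishing on elementary tensors, hence zero, and Γ has dense range. So `Xi` is a genuine
GNS map of the product functional. -/
theorem gnsProd_adjoint_gnsProd (z : (prodPos φ ψ).GNS) :
    gnsProd φ ψ (ContinuousLinearMap.adjoint (gnsProd φ ψ) z) = z := by
  set w : (prodPos φ ψ).GNS := z - gnsProd φ ψ (ContinuousLinearMap.adjoint (gnsProd φ ψ) z)
    with hw
  have h0 : ContinuousLinearMap.adjoint (gnsProd φ ψ) w = 0 := by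
    rw [hw, map_sub, adjoint_gnsProd_gnsProd, sub_self]
  have h1 : ∀ b, ((innerSL ℂ w).comp (gnsProdL φ ψ)) b = 0 := by
    refine predual_eq_zero_of_elem (gnsProdFunctional_mem_predual φ ψ w) fun x y => ?_
    change ⟪w, gnsMap (prodPos φ ψ) (elem x y)⟫_ℂ = 0
    rw [← gnsProd_tmul, ← ContinuousLinearMap.adjoint_inner_left, h0, inner_zero_left]
  have h2 : w = 0 := by
    have hcl : IsClosed {z : (prodPos φ ψ).GNS | ⟪w, z⟫_ℂ = 0} :=
      isClosed_singleton.preimage (innerSL ℂ w).continuous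
    have : ⟪w, w⟫_ℂ = 0 := by
      refine hcl.closure_subset_iff.mpr ?_ (denseRange_gnsMap (prodPos φ ψ) w)
      rintro _ ⟨b, rfl⟩
      exact h1 b
    exact inner_self_eq_zero.mp this
  exact (sub_eq_zero.mp h2).symm

theorem inner_Xi_right (w : φ.Space ⊗ₕ ψ.Space) (b : (M ⊗ᵥ N : VonNeumannAlgebra (H ⊗ₕ K))) :
    ⟪w, Xi φ ψ b⟫_ℂ = ⟪gnsProd φ ψ w, gnsMap (prodPos φ ψ) b⟫_ℂ := by
  change ⟪w, ContinuousLinearMap.adjoint (gnsProd φ ψ) (gnsMap (prodPos φ ψ) b)⟫_ℂ = _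
  rw [ContinuousLinearMap.adjoint_inner_right]

theorem gnsProd_Xi (b : (M ⊗ᵥ N : VonNeumannAlgebra (H ⊗ₕ K))) :
    gnsProd φ ψ (Xi φ ψ b) = gnsMap (prodPos φ ψ) b := gnsProd_adjoint_gnsProd φ ψ _

theorem inner_Xi_Xi (a b : (M ⊗ᵥ N : VonNeumannAlgebra (H ⊗ₕ K))) :
    ⟪Xi φ ψ a, Xi φ ψ b⟫_ℂ = prodFunctional φ.toDual ψ.toDual (star a * b) := by
  rw [inner_Xi_right, gnsProd_Xi, inner_gnsMap]
  rfl

theorem norm_Xi_sq (a : (M ⊗ᵥ N : VonNeumannAlgebra (H ⊗ₕ K))) :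
    ((‖Xi φ ψ a‖ ^ 2 : ℝ) : ℂ) = prodFunctional φ.toDual ψ.toDual (star a * a) := by
  rw [← inner_Xi_Xi, inner_self_eq_norm_sq_to_K]
  simp

/-- The GNS map `Ξ` as a bounded linear map. -/
def XiL : (M ⊗ᵥ N : VonNeumannAlgebra (H ⊗ₕ K)) →L[ℂ] φ.Space ⊗ₕ ψ.Space :=
  (ContinuousLinearMap.adjoint (gnsProd φ ψ)).comp (gnsProdL φ ψ)

theorem denseRange_Xi : DenseRange (Xi φ ψ) := by
  have h : Submodule.span ℂ (Set.range fun p : M × N => tmul (φ.Γ p.1) (ψ.Γ p.2)) ≤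
      LinearMap.range (Xi φ ψ) := by
    rw [Submodule.span_le]
    rintro _ ⟨p, rfl⟩
    exact ⟨elem p.1 p.2, Xi_elem φ ψ p.1 p.2⟩
  exact (dense_span_prod φ ψ).mono h

theorem XiFunctional_mem_predual (w : φ.Space ⊗ₕ ψ.Space) :
    (innerSL ℂ w).comp (XiL φ ψ) ∈ predual (M ⊗ᵥ N) := by
  convert gnsProdFunctional_mem_predual φ ψ (gnsProd φ ψ w) using 1
  ext b
  exact inner_Xi_right φ ψ w b

theorem NormalPos.Faithful.eq_zero {φ : NormalPos M} (h : φ.Faithful) {x : M} (hx : 0 ≤ x)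
    (h0 : φ.toDual x = 0) : x = 0 := by
  obtain ⟨y, rfl⟩ := CStarAlgebra.nonneg_iff_eq_star_mul_self.mp hx
  rw [h y h0, mul_zero]

theorem rightSlice_nonneg {T : (M ⊗ᵥ N : VonNeumannAlgebra (H ⊗ₕ K))} (hT : 0 ≤ T) :
    0 ≤ rightSlice (M := M) ψ.toDual T := by
  change (0 : H →L[ℂ] H) ≤ slice ψ.toDual (toAmp T)
  rw [nonneg_iff_inner]
  intro ξ
  rw [inner_slice]
  refine ψ.nonneg _ ?_
  change (0 : K →L[ℂ] K) ≤ coeff ξ ξ (T : H ⊗ₕ K →L[ℂ] H ⊗ₕ K)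
  rw [nonneg_iff_inner]
  intro k
  rw [inner_coeff]
  exact (nonneg_iff_inner _).mp (show (0 : H ⊗ₕ K →L[ℂ] H ⊗ₕ K) ≤ T from hT) _

variable {φ ψ}

/-- Faithfulness is used one leg at a time on a*a: φ kills its positive slice by ψ, so that slice is
zero; then ψ kills each positive diagonal coefficient, so a vanishes on every ξ ⊗ k. -/
theorem Xi_injective (hφ : φ.Faithful) (hψ : ψ.Faithful) : Function.Injective (Xi φ ψ) := by
  rw [injective_iff_map_eq_zero]
  intro a ha
  have h1 := norm_Xi_sq φ ψ a
  rw [ha] at h1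
  have h2 : φ.toDual (rightSlice ψ.toDual (star a * a)) = 0 := by
    change prodFunctional φ.toDual ψ.toDual (star a * a) = 0
    rw [← h1]; simp
  have h3 := hφ.eq_zero (rightSlice_nonneg ψ (star_mul_self_nonneg a)) h2
  have h4 : ∀ ξ : H, coeffIn ξ ξ (toAmp (star a * a)) = 0 := by
    intro ξ
    refine hψ.eq_zero ?_ ?_
    · change (0 : K →L[ℂ] K) ≤ coeff ξ ξ ((star a * a : (M ⊗ᵥ N : VonNeumannAlgebra (H ⊗ₕ K))) : H ⊗ₕ K →L[ℂ] H ⊗ₕ K)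
      rw [nonneg_iff_inner]
      intro k
      rw [inner_coeff]
      exact (nonneg_iff_inner _).mp (star_mul_self_nonneg (a : H ⊗ₕ K →L[ℂ] H ⊗ₕ K)) _
    · have := congrArg (fun T : M => ⟪ξ, (T : H →L[ℂ] H) ξ⟫_ℂ) h3
      rw [← inner_slice]
      simpa [coe_rightSlice] using this
  refine Subtype.ext (ext_tmul fun ξ k => ?_)
  have h5 : ⟪k, coeff ξ ξ (star (a : H ⊗ₕ K →L[ℂ] H ⊗ₕ K) * (a : H ⊗ₕ K →L[ℂ] H ⊗ₕ K)) k⟫_ℂ =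
      0 := by
    have := congrArg (fun T : N => ⟪k, (T : K →L[ℂ] K) k⟫_ℂ) (h4 ξ)
    exact this.trans (inner_zero_right k)
  rw [inner_coeff, mul_apply_eq_comp, ContinuousLinearMap.star_eq_adjoint,
    ContinuousLinearMap.adjoint_inner_right] at h5
  rw [inner_self_eq_zero.mp h5]
  rfl

/-- These functionals separate points: at c = x the value is ‖Ξ(x)‖², and Ξ is injective. -/
theorem predual_le_closure_Xi (hφ : φ.Faithful) (hψ : ψ.Faithful) :
    predual (M ⊗ᵥ N) ≤ (Submodule.span ℂ (Set.range fun c : (M ⊗ᵥ N : VonNeumannAlgebra (H ⊗ₕ K)) =>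
      (innerSL ℂ (Xi φ ψ c)).comp (XiL φ ψ))).topologicalClosure := by
  refine predual_le_closure _ ?_ fun x hx => ?_
  · rw [Submodule.span_le]
    rintro _ ⟨c, rfl⟩
    exact XiFunctional_mem_predual φ ψ _
  · have h := hx _ (Submodule.subset_span ⟨x, rfl⟩)
    have h1 : ⟪Xi φ ψ x, Xi φ ψ x⟫_ℂ = 0 := h
    exact Xi_injective hφ hψ ((inner_self_eq_zero.mp h1).trans (map_zero _).symm)

theorem norm_Xi_mul_right_le (z c : (M ⊗ᵥ N : VonNeumannAlgebra (H ⊗ₕ K))) :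
    ‖Xi φ ψ (z * c)‖ ≤ ‖XiL φ ψ‖ * (‖z‖ * ‖c‖) :=
  ((XiL φ ψ).le_opNorm _).trans (by gcongr; exact norm_mul_le _ _)

/-- On bounded sets, convergence in the GNS space of a faithful functional implies strong
convergence. -/
theorem tendsto_strong_of_Xi (hφ : φ.Faithful) (hψ : ψ.Faithful) {κ : Type*} {l : Filter κ}
    (x : κ → (M ⊗ᵥ N : VonNeumannAlgebra (H ⊗ₕ K))) (b : (M ⊗ᵥ N : VonNeumannAlgebra (H ⊗ₕ K)))
    (R : ℝ) (hx : ∀ i, ‖x i‖ ≤ R)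
    (h : Filter.Tendsto (fun i => Xi φ ψ (x i)) l (nhds (Xi φ ψ b))) (ξ : H ⊗ₕ K) :
    Filter.Tendsto (fun i => (x i : H ⊗ₕ K →L[ℂ] H ⊗ₕ K) ξ) l
      (nhds ((b : H ⊗ₕ K →L[ℂ] H ⊗ₕ K) ξ)) := by
  set z := fun i => x i - b with hz
  have hzR : ∀ i, ‖z i‖ ≤ R + ‖b‖ := fun i => (norm_sub_le _ _).trans (by gcongr; exact hx i)
  have hzX : Filter.Tendsto (fun i => ‖Xi φ ψ (z i)‖) l (nhds 0) := by
    simp only [hz, map_sub]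
    exact tendsto_iff_norm_sub_tendsto_zero.mp h
  have key : ∀ χ ∈ predual (M ⊗ᵥ N), Filter.Tendsto (fun i => χ (star (z i) * z i)) l (nhds 0) := by
    intro χ hχ
    have hspan : ∀ χ ∈ Submodule.span ℂ (Set.range fun c : (M ⊗ᵥ N : VonNeumannAlgebra (H ⊗ₕ K)) =>
        (innerSL ℂ (Xi φ ψ c)).comp (XiL φ ψ)),
        Filter.Tendsto (fun i => χ (star (z i) * z i)) l (nhds 0) := by
      intro χ hχ
      induction hχ using Submodule.span_induction with
      | mem χ hχ =>
        obtain ⟨c, rfl⟩ := hχ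
        refine squeeze_zero_norm (a := fun i => (‖XiL φ ψ‖ * ((R + ‖b‖) * ‖c‖)) * ‖Xi φ ψ (z i)‖)
          (fun i => ?_) (by simpa using hzX.const_mul _)
        change ‖⟪Xi φ ψ c, Xi φ ψ (star (z i) * z i)⟫_ℂ‖ ≤ _
        -- Moving z* to the other side leaves a bounded vector Ξ(zc) against Ξ(z), which tends to 0.
        have : ⟪Xi φ ψ c, Xi φ ψ (star (z i) * z i)⟫_ℂ = ⟪Xi φ ψ (z i * c), Xi φ ψ (z i)⟫_ℂ := by
          rw [inner_Xi_Xi, inner_Xi_Xi, star_mul, mul_assoc]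
        rw [this]
        refine (norm_inner_le_norm _ _).trans ?_
        gcongr
        refine (norm_Xi_mul_right_le _ _).trans ?_
        gcongr
        exact hzR i
      | zero => simpa using tendsto_const_nhds
      | add χ χ' _ _ h1 h2 => simpa using h1.add h2
      | smul c χ _ h1 => simpa using h1.const_mul c
    have hcl := predual_le_closure_Xi hφ hψ hχ
    rw [Metric.tendsto_nhds]
    intro ε hε
    -- Bounds ‖z*z‖ uniformly along the family; the 1 only keeps it positive for the division.
    set B := (R + ‖b‖) ^ 2 + 1 with hB
    have hB0 : 0 < B := by positivity
    obtain ⟨χ', hχ', hd⟩ := Metric.mem_closure_iff.mp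
      (show χ ∈ closure _ from hcl) (ε / (2 * B)) (by positivity)
    filter_upwards [Metric.tendsto_nhds.mp (hspan χ' hχ') (ε / 2) (by positivity)] with i hi
    rw [dist_zero_right] at hi ⊢
    have h1 : ‖star (z i) * z i‖ ≤ B := by
      refine (norm_mul_le _ _).trans ?_
      rw [norm_star, hB, ← sq]
      have := pow_le_pow_left₀ (norm_nonneg _) (hzR i) 2
      linarith
    have h2 : ‖(χ - χ') (star (z i) * z i)‖ ≤ ε / 2 := by
      refine ((χ - χ').le_opNorm _).trans ?_
      rw [dist_eq_norm] at hd
      calc ‖χ - χ'‖ * ‖star (z i) * z i‖ ≤ ε / (2 * B) * B := by gcongr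
        _ = ε / 2 := by field_simp
    have h3 : χ (star (z i) * z i) = (χ - χ') (star (z i) * z i) + χ' (star (z i) * z i) := by simp
    rw [h3]
    exact (norm_add_le _ _).trans_lt (by linarith)
  -- The vector functional at ξ evaluates z*z to ‖zξ‖², which is why z*z was controlled.
  have h1 := key _ (vectorFunctional_mem_predual ξ ξ)
  rw [tendsto_iff_norm_sub_tendsto_zero]
  have h2 : ∀ i, ‖(x i : H ⊗ₕ K →L[ℂ] H ⊗ₕ K) ξ - (b : H ⊗ₕ K →L[ℂ] H ⊗ₕ K) ξ‖ =
      Real.sqrt ‖vectorFunctional (M ⊗ᵥ N) ξ ξ (star (z i) * z i)‖ := by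
    intro i
    have : vectorFunctional (M ⊗ᵥ N) ξ ξ (star (z i) * z i) =
        ⟪(z i : H ⊗ₕ K →L[ℂ] H ⊗ₕ K) ξ, (z i : H ⊗ₕ K →L[ℂ] H ⊗ₕ K) ξ⟫_ℂ :=
      ContinuousLinearMap.adjoint_inner_right (z i : H ⊗ₕ K →L[ℂ] H ⊗ₕ K) _ _
    rw [this, inner_self_eq_norm_sq_to_K, norm_pow, RCLike.norm_ofReal, abs_norm,
      Real.sqrt_sq (norm_nonneg _)]
    rfl
  simp only [h2]
  have := (Real.continuous_sqrt.tendsto _).comp h1.norm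
  simpa [Function.comp_def] using this

end GNSNormal

/-! ### Leg numbering and reassociation of operators on triple tensor products. -/

section LegMaps
variable {H : Type*} [NormedAddCommGroup H] [InnerProductSpace ℂ H] [CompleteSpace H]
variable {K : Type*} [NormedAddCommGroup K] [InnerProductSpace ℂ K] [CompleteSpace K]
variable {L : Type*} [NormedAddCommGroup L] [InnerProductSpace ℂ L] [CompleteSpace L]
variable {X : Type*} [NormedAddCommGroup X] [InnerProductSpace ℂ X] [CompleteSpace X]
variable {M : VonNeumannAlgebra H} {N : VonNeumannAlgebra K}

theorem ext_inner_total {ι : Type*} {v : ι → H}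
    (hv : Dense (Submodule.span ℂ (Set.range v) : Set H)) {S T : H →L[ℂ] H}
    (h : ∀ i j, ⟪v i, S (v j)⟫_ℂ = ⟪v i, T (v j)⟫_ℂ) : S = T := by
  refine ContinuousLinearMap.ext_on hv ?_
  rintro _ ⟨j, rfl⟩
  refine ext_inner_right ℂ fun y => ?_
  have : innerSL ℂ (S (v j)) = innerSL ℂ (T (v j)) := by
    refine ContinuousLinearMap.ext_on hv ?_
    rintro _ ⟨i, rfl⟩
    have := congrArg (starRingEnd ℂ) (h i j)
    simpa using this
  exact congrArg (fun f => f y) this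

theorem mapT_one_add (S T : K →L[ℂ] K) :
    mapT (1 : X →L[ℂ] X) (S + T) = mapT 1 S + mapT 1 T :=
  ext_tmul fun ξ k => by simp [mapT_tmul, tmul_add_right]

theorem mapT_one_smul (c : ℂ) (T : K →L[ℂ] K) :
    mapT (1 : X →L[ℂ] X) (c • T) = c • mapT 1 T :=
  ext_tmul fun ξ k => by simp [mapT_tmul, tmul_smul_right]

variable (X N) in
/-- The representation `y ↦ 1 ⊗ y`. -/
def oneT : N →⋆ₐ[ℂ] (X ⊗ₕ K →L[ℂ] X ⊗ₕ K) where
  toFun y := mapT 1 (y : K →L[ℂ] K)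
  map_one' := mapT_one_one
  map_mul' y z := by
    change mapT 1 ((y : K →L[ℂ] K) * (z : K →L[ℂ] K)) = _
    rw [← mapT_mul, one_mul]
  map_zero' := ext_tmul fun ξ k => by
    change mapT 1 (0 : K →L[ℂ] K) _ = _
    rw [mapT_tmul]
    simpa using tmul_smul_right (0 : ℂ) ξ (0 : K)
  map_add' y z := mapT_one_add (y : K →L[ℂ] K) (z : K →L[ℂ] K)
  commutes' c := by
    change mapT 1 ((algebraMap ℂ (K →L[ℂ] K)) c) = _
    rw [Algebra.algebraMap_eq_smul_one, mapT_one_smul, mapT_one_one, Algebra.algebraMap_eq_smul_one]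
  map_star' y := by
    change mapT 1 (star (y : K →L[ℂ] K)) = _
    rw [star_mapT, star_one]

theorem isNormalOp_oneT : IsNormalOp (homL (oneT X N)) := by
  refine isNormalOp_of_dense dense_span_tmul _ fun p q => ?_
  have : matrixFunctional (homL (oneT X N)) (tmul p.1 p.2) (tmul q.1 q.2) =
      ⟪p.1, q.1⟫_ℂ • vectorFunctional N p.2 q.2 := by
    ext y
    change ⟪tmul p.1 p.2, mapT 1 (y : K →L[ℂ] K) (tmul q.1 q.2)⟫_ℂ = _
    rw [mapT_tmul, inner_tmul]
    rfl
  rw [this]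
  exact Submodule.smul_mem _ _ (vectorFunctional_mem_predual _ _)

theorem assocU_symm_tmul (ξ : H) (k : K) (l : L) :
    (assocU H K L).symm (tmul ξ (tmul k l)) = tmul (tmul ξ k) l := by
  rw [LinearIsometryEquiv.symm_apply_eq, assocU_tmul]

theorem swapU_symm_tmul (ξ : H) (k : K) (l : L) :
    (swapU H K L).symm (tmul ξ (tmul k l)) = tmul k (tmul ξ l) := by
  rw [LinearIsometryEquiv.symm_apply_eq, swapU_tmul]

/-- Reassociation of operators. -/
def reassoc : (H ⊗ₕ K ⊗ₕ L →L[ℂ] H ⊗ₕ K ⊗ₕ L) →L[ℂ] ((H ⊗ₕ K) ⊗ₕ L →L[ℂ] (H ⊗ₕ K) ⊗ₕ L) :=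
  conjL (assocU H K L).symm

theorem reassoc_mul (S T : H ⊗ₕ K ⊗ₕ L →L[ℂ] H ⊗ₕ K ⊗ₕ L) :
    reassoc (S * T) = reassoc S * reassoc T := map_mul (assocU H K L).symm.conjStarAlgEquiv _ _

theorem inner_reassoc (T : H ⊗ₕ K ⊗ₕ L →L[ℂ] H ⊗ₕ K ⊗ₕ L) (ξ ξ' : H) (k k' : K) (l l' : L) :
    ⟪tmul (tmul ξ k) l, reassoc T (tmul (tmul ξ' k') l')⟫_ℂ =
      ⟪tmul ξ (tmul k l), T (tmul ξ' (tmul k' l'))⟫_ℂ := by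
  rw [reassoc, inner_conjL, LinearIsometryEquiv.symm_symm, assocU_tmul, assocU_tmul]

theorem reassoc_injective : Function.Injective (reassoc (H := H) (K := K) (L := L)) :=
  (assocU H K L).symm.conjStarAlgEquiv.injective

theorem coeff_reassoc (T : H ⊗ₕ K ⊗ₕ L →L[ℂ] H ⊗ₕ K ⊗ₕ L) (ξ ξ' : H) (k k' : K) :
    coeff (tmul ξ k) (tmul ξ' k') (reassoc T) = coeff k k' (coeff ξ ξ' T) :=
  ext_inner_clm fun l l' => by
    rw [inner_coeff, inner_reassoc, inner_coeff, inner_coeff]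

theorem reassoc_mapT (x : H →L[ℂ] H) (y : K →L[ℂ] K) (z : L →L[ℂ] L) :
    reassoc (mapT x (mapT y z)) = mapT (mapT x y) z := by
  refine ext_inner_total dense_span_tmul3' fun p q => ?_
  rw [inner_reassoc]
  simp only [mapT_tmul, inner_tmul, mul_assoc]

theorem reassoc_leg12 (b : H ⊗ₕ K →L[ℂ] H ⊗ₕ K) : reassoc (leg12 L b) = mapT b 1 :=
  (assocU H K L).conjStarAlgEquiv.symm_apply_apply _

/-- Presenting v₁₃ as id ⊗ (1 ⊗ ·) applied to v makes coefficients, adjoints and normality available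
from `idL`. -/
theorem leg13_eq_idL (v : (M ⊗ᵥ N : VonNeumannAlgebra (H ⊗ₕ K))) :
    leg13 X (v : H ⊗ₕ K →L[ℂ] H ⊗ₕ K) = idL (oneT X N) v := by
  refine ext_inner_total dense_span_tmul3 fun p q => ?_
  rw [inner_idL]
  change ⟪_, conjL (swapU H X K) _ _⟫_ℂ = ⟪_, mapT 1 (coeff p.1 q.1 (v : H ⊗ₕ K →L[ℂ] H ⊗ₕ K)) _⟫_ℂ
  rw [inner_conjL, swapU_symm_tmul, swapU_symm_tmul, mapT_tmul, mapT_tmul, inner_tmul, inner_tmul,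
    inner_coeff]

theorem leg13_mul (v w : H ⊗ₕ L →L[ℂ] H ⊗ₕ L) : leg13 K (v * w) = leg13 K v * leg13 K w := by
  rw [leg13, leg13, leg13, ← map_mul, ← mapT_mul, one_mul]

theorem leg13_one : leg13 K (1 : H ⊗ₕ L →L[ℂ] H ⊗ₕ L) = 1 := by
  rw [leg13, mapT_one_one, map_one]

end LegMaps

/-! ### Kadison–Schwarz and Fubini for slices. -/

section Slices
variable {H : Type*} [NormedAddCommGroup H] [InnerProductSpace ℂ H] [CompleteSpace H]
variable {K : Type*} [NormedAddCommGroup K] [InnerProductSpace ℂ K] [CompleteSpace K]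
variable {M : VonNeumannAlgebra H} {N : VonNeumannAlgebra K}

theorem NormalPos.mono (φ : NormalPos M) {x y : M} (h : x ≤ y) : φ.toDual x ≤ φ.toDual y := by
  have := φ.nonneg (y - x) (sub_nonneg.mpr h)
  rwa [map_sub, sub_nonneg] at this

theorem inner_self_eq_ofReal (v : H) : ⟪v, v⟫_ℂ = ((‖v‖ ^ 2 : ℝ) : ℂ) := by
  rw [inner_self_eq_norm_sq_to_K]; simp

theorem norm_gnsMap_sq (φ : NormalPos M) (x : M) :
    ((‖φ.Γ x‖ ^ 2 : ℝ) : ℂ) = φ.toDual (star x * x) := by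
  rw [← inner_self_eq_ofReal]
  exact inner_gnsMap φ.toPos x x

theorem norm_apply_le_gnsMap (φ : NormalPos M) (x : M) :
    ‖φ.toDual x‖ ≤ ‖φ.Γ 1‖ * ‖φ.Γ x‖ := by
  have h : φ.toDual x = ⟪gnsMap φ.toPos 1, gnsMap φ.toPos x⟫_ℂ := by
    rw [inner_gnsMap, star_one, one_mul]; rfl
  rw [h]
  exact norm_inner_le_norm _ _

theorem norm_coeff_apply_le (T : H ⊗ₕ K →L[ℂ] H ⊗ₕ K) (ξ η : H) (k : K) :
    ‖coeff ξ η T k‖ ≤ ‖ξ‖ * ‖T (tmul η k)‖ := by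
  change ‖ContinuousLinearMap.adjoint (ket ξ : K →L[ℂ] H ⊗ₕ K) (T (ket η k))‖ ≤ _
  refine (ContinuousLinearMap.le_opNorm _ _).trans ?_
  rw [LinearIsometryEquiv.norm_map]
  gcongr
  · exact norm_ket_le ξ
  · rfl

/-- A coefficient is T between kets, and the ket of ξ has norm at most ‖ξ‖. This is the pointwise
inequality from which Kadison–Schwarz for slices is assembled. -/
theorem star_coeffIn_mul_le (T : (M ⊗ᵥ N : VonNeumannAlgebra (H ⊗ₕ K))) (ξ η : H) :
    star (coeffIn ξ η (toAmp T)) * coeffIn ξ η (toAmp T) ≤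
      ((‖ξ‖ ^ 2 : ℝ) : ℂ) • coeffIn η η (toAmp (star T * T)) := by
  rw [← sub_nonneg]
  change (0 : K →L[ℂ] K) ≤ ((‖ξ‖ ^ 2 : ℝ) : ℂ) • coeff η η (star (T : H ⊗ₕ K →L[ℂ] H ⊗ₕ K) * (T : H ⊗ₕ K →L[ℂ] H ⊗ₕ K)) -
    star (coeff ξ η (T : H ⊗ₕ K →L[ℂ] H ⊗ₕ K)) * coeff ξ η (T : H ⊗ₕ K →L[ℂ] H ⊗ₕ K)
  rw [nonneg_iff_inner]
  intro k
  rw [sub_apply, smul_apply, inner_sub_right, inner_smul_right, inner_coeff, mul_apply_eq_comp,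
    mul_apply_eq_comp, ContinuousLinearMap.star_eq_adjoint, ContinuousLinearMap.star_eq_adjoint,
    ContinuousLinearMap.adjoint_inner_right, ContinuousLinearMap.adjoint_inner_right,
    inner_self_eq_ofReal, inner_self_eq_ofReal, sub_nonneg]
  have := pow_le_pow_left₀ (norm_nonneg _) (norm_coeff_apply_le (T : H ⊗ₕ K →L[ℂ] H ⊗ₕ K) ξ η k) 2
  rw [mul_pow] at this
  rw [← Complex.ofReal_mul]
  exact_mod_cast this

/-- The Kadison–Schwarz inequality for slices by normal positive functionals. -/
theorem star_rightSlice_mul_le (θ : NormalPos N) (T : (M ⊗ᵥ N : VonNeumannAlgebra (H ⊗ₕ K))) :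
    star (rightSlice (M := M) θ.toDual T) * rightSlice θ.toDual T ≤
      θ.toDual 1 • rightSlice θ.toDual (star T * T) := by
  rw [← sub_nonneg]
  have h1 : θ.toDual 1 = ((‖θ.Γ 1‖ ^ 2 : ℝ) : ℂ) := by rw [norm_gnsMap_sq, star_one, one_mul]
  rw [h1]
  change (0 : H →L[ℂ] H) ≤ ((‖θ.Γ 1‖ ^ 2 : ℝ) : ℂ) • slice θ.toDual (toAmp (star T * T)) -
    star (slice θ.toDual (toAmp T)) * slice θ.toDual (toAmp T)
  rw [nonneg_iff_inner]
  intro η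
  set ξ := slice θ.toDual (toAmp T) η with hξ
  rw [sub_apply, smul_apply, inner_sub_right, inner_smul_right, mul_apply_eq_comp,
    ContinuousLinearMap.star_eq_adjoint, ContinuousLinearMap.adjoint_inner_right, ← hξ,
    inner_self_eq_ofReal, inner_slice, sub_nonneg]
  -- Taking ξ to be the sliced vector itself gives θ(x) = ‖ξ‖². Cauchy–Schwarz for θ and the
  -- coefficient inequality then yield ‖ξ‖⁴ ≤ ‖ξ‖² θ(1) q, and ‖ξ‖² cancels unless it is zero.
  set x := coeffIn ξ η (toAmp T) with hx
  have h2 : ‖ξ‖ ^ 2 ≤ ‖θ.Γ 1‖ * ‖θ.Γ x‖ := by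
    refine le_trans ?_ (norm_apply_le_gnsMap θ x)
    rw [hx, ← inner_slice, ← hξ, inner_self_eq_ofReal, Complex.norm_real, Real.norm_eq_abs]
    exact le_abs_self _
  have h3 := θ.mono (star_coeffIn_mul_le T ξ η)
  rw [← hx, ← norm_gnsMap_sq, map_smul, smul_eq_mul] at h3
  set q := θ.toDual (coeffIn η η (toAmp (star T * T))) with hq
  have hq0 : 0 ≤ q := by
    refine θ.nonneg _ ?_
    change (0 : K →L[ℂ] K) ≤ coeff η η (star (T : H ⊗ₕ K →L[ℂ] H ⊗ₕ K) * (T : H ⊗ₕ K →L[ℂ] H ⊗ₕ K))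
    rw [nonneg_iff_inner]
    intro k
    rw [inner_coeff]
    exact (nonneg_iff_inner _).mp (star_mul_self_nonneg (T : H ⊗ₕ K →L[ℂ] H ⊗ₕ K)) _
  obtain ⟨r, hr⟩ : ∃ r : ℝ, q = (r : ℂ) := ⟨q.re, (Complex.eq_re_of_ofReal_le hq0)⟩
  rw [hr] at h3 ⊢
  have h4 : ‖θ.Γ x‖ ^ 2 ≤ ‖ξ‖ ^ 2 * r := by exact_mod_cast h3
  suffices h5 : ‖ξ‖ ^ 2 ≤ ‖θ.Γ 1‖ ^ 2 * r by exact_mod_cast h5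
  rcases (norm_nonneg ξ).eq_or_lt with h0 | h0
  · rw [← h0]
    have : 0 ≤ r := by rw [hr] at hq0; exact_mod_cast hq0
    rw [zero_pow two_ne_zero]
    positivity
  · have h6 : (‖ξ‖ ^ 2) ^ 2 ≤ ‖ξ‖ ^ 2 * (‖θ.Γ 1‖ ^ 2 * r) := by
      calc (‖ξ‖ ^ 2) ^ 2 ≤ (‖θ.Γ 1‖ * ‖θ.Γ x‖) ^ 2 := by gcongr
        _ = ‖θ.Γ 1‖ ^ 2 * ‖θ.Γ x‖ ^ 2 := by ring
        _ ≤ ‖θ.Γ 1‖ ^ 2 * (‖ξ‖ ^ 2 * r) := by gcongr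
        _ = _ := by ring
    rw [sq (‖ξ‖ ^ 2)] at h6
    exact le_of_mul_le_mul_left h6 (by positivity)

/-- Fubini: for a vector functional θ both sides are φ of the same coefficient, and both are norm
continuous in θ. Only one of the two functionals has to be normal. -/
theorem apply_rightSlice_eq (φ : StrongDual ℂ M) {θ : StrongDual ℂ N} (hθ : θ ∈ predual N)
    (T : (M ⊗ᵥ N : VonNeumannAlgebra (H ⊗ₕ K))) :
    φ (rightSlice θ T) = θ (rightSlice φ (flipL T)) := by
  refine predual_eq_of_vectorFunctional (φ.comp (rightSliceL T))
    (ContinuousLinearMap.apply ℂ ℂ (rightSlice φ (flipL T))) (fun g h => ?_) hθ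
  change φ (rightSlice _ T) = ⟪g, slice φ (toAmp (flipL T)) h⟫_ℂ
  rw [rightSlice_vectorFunctional, inner_slice]
  rfl

end Slices

/-! ### The averages as maps of C ⊗ᵥ N, and the operators V_u(θ). -/

section Averages
variable {HG : Type*} [NormedAddCommGroup HG] [InnerProductSpace ℂ HG] [CompleteSpace HG]
variable {HN : Type*} [NormedAddCommGroup HN] [InnerProductSpace ℂ HN] [CompleteSpace HN]
variable {HC : Type*} [NormedAddCommGroup HC] [InnerProductSpace ℂ HC] [CompleteSpace HC]

theorem IsNormalMap.isNormalOp {M : VonNeumannAlgebra HN} {P : VonNeumannAlgebra HG}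
    {f : M →⋆ₐ[ℂ] P} (hf : IsNormalMap f) : IsNormalOp (homL ((incl P).comp f)) := by
  intro η ξ
  obtain ⟨ψ, hψ, h⟩ := hf _ (vectorFunctional_mem_predual η ξ)
  convert hψ using 1
  ext x
  exact (h x).symm

variable {G : HopfVonNeumannAlgebra HG} {N : VonNeumannAlgebra HN} (α : HopfAction G N)
variable {C : VonNeumannAlgebra HC}

/-- The action as a representation on `HN ⊗ HG`. -/
def HopfAction.rep : N →⋆ₐ[ℂ] (HN ⊗ₕ HG →L[ℂ] HN ⊗ₕ HG) := (incl (N ⊗ᵥ G.alg)).comp α.hom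

theorem HopfAction.isNormalOp_rep : IsNormalOp (homL α.rep) := α.normal.isNormalOp

theorem HopfVonNeumannAlgebra.isNormalOp_Δ : IsNormalOp (homL G.Δ) := G.normal.isNormalOp

theorem HopfAction.ampl_eq (a : (C ⊗ᵥ N : VonNeumannAlgebra (HC ⊗ₕ HN))) :
    α.ampl a = idL α.rep a := rfl

/-- The map `a ↦ (id ⊗ α)(a)` as a representation on `(HC ⊗ HN) ⊗ HG`. -/
def HopfAction.amplRep : (C ⊗ᵥ N : VonNeumannAlgebra (HC ⊗ₕ HN)) →⋆ₐ[ℂ]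
    ((HC ⊗ₕ HN) ⊗ₕ HG →L[ℂ] (HC ⊗ₕ HN) ⊗ₕ HG) :=
  StarAlgHom.comp (assocU HC HN HG).symm.conjStarAlgEquiv.toStarAlgHom
    (idHom C α.rep α.isNormalOp_rep)

theorem HopfAction.amplRep_apply (a : (C ⊗ᵥ N : VonNeumannAlgebra (HC ⊗ₕ HN))) :
    α.amplRep a = reassoc (α.ampl a) := rfl

theorem HopfAction.isNormalOp_amplRep : IsNormalOp (homL (α.amplRep (C := C))) :=
  (isNormalOp_idL α.isNormalOp_rep).conj _

theorem opMulLeft_oneT {P : VonNeumannAlgebra HN} (x : HC →L[ℂ] HC) (T : P) :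
    opMulLeft (mapT x 1) (homL (oneT HC P)) T = mapT x (T : HN →L[ℂ] HN) := by
  change mapT x 1 * mapT 1 (T : HN →L[ℂ] HN) = _
  rw [← mapT_mul, one_mul, mul_one]

/-- For fixed x the operator is normal in `T`, so only elementary tensors T = y ⊗ g have to be
tested. -/
theorem reassoc_mapT_mem {A : VonNeumannAlgebra HG} (x : C)
    (T : (N ⊗ᵥ A : VonNeumannAlgebra (HN ⊗ₕ HG))) :
    reassoc (mapT (x : HC →L[ℂ] HC) (T : HN ⊗ₕ HG →L[ℂ] HN ⊗ₕ HG)) ∈ (C ⊗ᵥ N) ⊗ᵥ A := by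
  have hn : IsNormalOp (reassoc.comp
      (opMulLeft (mapT (x : HC →L[ℂ] HC) 1) (homL (oneT HC (N ⊗ᵥ A))))) :=
    (isNormalOp_oneT.mulLeft _).conj _
  have h := hn.mem_of_elem ((C ⊗ᵥ N) ⊗ᵥ A) (fun y g => by
    rw [ContinuousLinearMap.comp_apply, opMulLeft_oneT]
    change reassoc (mapT (x : HC →L[ℂ] HC) (mapT (y : HN →L[ℂ] HN) (g : HG →L[ℂ] HG))) ∈ _
    rw [reassoc_mapT]
    exact (elem (elem x y) g).2) T
  rwa [ContinuousLinearMap.comp_apply, opMulLeft_oneT] at h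

theorem HopfAction.amplRep_mem (a : (C ⊗ᵥ N : VonNeumannAlgebra (HC ⊗ₕ HN))) :
    α.amplRep a ∈ (C ⊗ᵥ N) ⊗ᵥ G.alg := by
  refine α.isNormalOp_amplRep.mem_of_elem _ (fun x y => ?_) a
  rw [homL_apply, α.amplRep_apply, α.ampl_eq, idL_elem]
  exact reassoc_mapT_mem x (α.hom y)

/-- The element `(id ⊗ α)(a)` of `(C ⊗ᵥ N) ⊗ᵥ G`. -/
def HopfAction.amplIn (a : (C ⊗ᵥ N : VonNeumannAlgebra (HC ⊗ₕ HN))) :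
    ((C ⊗ᵥ N) ⊗ᵥ G.alg : VonNeumannAlgebra ((HC ⊗ₕ HN) ⊗ₕ HG)) := ⟨α.amplRep a, α.amplRep_mem a⟩

theorem HopfAction.star_amplIn_mul (a : (C ⊗ᵥ N : VonNeumannAlgebra (HC ⊗ₕ HN))) :
    star (α.amplIn a) * α.amplIn a = α.amplIn (star a * a) := by
  refine Subtype.ext ?_
  change star (α.amplRep a) * α.amplRep a = α.amplRep (star a * a)
  rw [map_mul, map_star]

theorem reassoc_leg13_mem (N : VonNeumannAlgebra HN)
    (u : (C ⊗ᵥ G.alg : VonNeumannAlgebra (HC ⊗ₕ HG))) :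
    reassoc (leg13 HN (u : HC ⊗ₕ HG →L[ℂ] HC ⊗ₕ HG)) ∈ (C ⊗ᵥ N) ⊗ᵥ G.alg := by
  rw [leg13_eq_idL]
  refine IsNormalOp.mem_of_elem (f := (conjL (assocU HC HN HG).symm).comp (idL (oneT HN G.alg)))
    ((isNormalOp_idL isNormalOp_oneT).conj _) _ (fun c g => ?_) u
  change reassoc (idL (oneT HN G.alg) (elem c g)) ∈ _
  rw [idL_elem]
  change reassoc (mapT (c : HC →L[ℂ] HC) (mapT 1 (g : HG →L[ℂ] HG))) ∈ _
  rw [reassoc_mapT]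
  exact (elem (elem c (1 : N)) g).2

variable (N) in
/-- The element `u₁₃` of `(C ⊗ᵥ N) ⊗ᵥ G`. -/
def legIn (u : (C ⊗ᵥ G.alg : VonNeumannAlgebra (HC ⊗ₕ HG))) :
    ((C ⊗ᵥ N) ⊗ᵥ G.alg : VonNeumannAlgebra ((HC ⊗ₕ HN) ⊗ₕ HG)) :=
  ⟨reassoc (leg13 HN (u : HC ⊗ₕ HG →L[ℂ] HC ⊗ₕ HG)), reassoc_leg13_mem N u⟩

theorem reassoc_star {H K L : Type*} [NormedAddCommGroup H] [InnerProductSpace ℂ H] [CompleteSpace H]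
    [NormedAddCommGroup K] [InnerProductSpace ℂ K] [CompleteSpace K]
    [NormedAddCommGroup L] [InnerProductSpace ℂ L] [CompleteSpace L]
    (S : H ⊗ₕ K ⊗ₕ L →L[ℂ] H ⊗ₕ K ⊗ₕ L) : reassoc (star S) = star (reassoc S) :=
  (assocU H K L).symm.conjStarAlgEquiv.map_star' S

theorem reassoc_one {H K L : Type*} [NormedAddCommGroup H] [InnerProductSpace ℂ H] [CompleteSpace H]
    [NormedAddCommGroup K] [InnerProductSpace ℂ K] [CompleteSpace K]
    [NormedAddCommGroup L] [InnerProductSpace ℂ L] [CompleteSpace L] :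
    reassoc (1 : H ⊗ₕ K ⊗ₕ L →L[ℂ] H ⊗ₕ K ⊗ₕ L) = 1 :=
  map_one (assocU H K L).symm.conjStarAlgEquiv

variable (u : (C ⊗ᵥ G.alg : VonNeumannAlgebra (HC ⊗ₕ HG)))

theorem star_legIn_mul (hu : (u : HC ⊗ₕ HG →L[ℂ] HC ⊗ₕ HG) ∈ unitary (HC ⊗ₕ HG →L[ℂ] HC ⊗ₕ HG)) :
    star (legIn N u) * legIn N u = 1 := by
  refine Subtype.ext ?_
  change star (reassoc (leg13 HN (u : HC ⊗ₕ HG →L[ℂ] HC ⊗ₕ HG))) *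
    reassoc (leg13 HN (u : HC ⊗ₕ HG →L[ℂ] HC ⊗ₕ HG)) = 1
  have h : star (leg13 HN (u : HC ⊗ₕ HG →L[ℂ] HC ⊗ₕ HG)) = leg13 HN (star (u : HC ⊗ₕ HG →L[ℂ] HC ⊗ₕ HG)) := by
    rw [leg13_eq_idL, ← idL_star, ← leg13_eq_idL]; rfl
  rw [← reassoc_star, ← reassoc_mul, h, ← leg13_mul, Unitary.star_mul_self_of_mem hu, leg13_one,
    reassoc_one]

/-- The element `u₁₃ (id ⊗ α)(a)` of `(C ⊗ᵥ N) ⊗ᵥ G`. -/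
def HopfAction.twistedIn (a : (C ⊗ᵥ N : VonNeumannAlgebra (HC ⊗ₕ HN))) :
    ((C ⊗ᵥ N) ⊗ᵥ G.alg : VonNeumannAlgebra ((HC ⊗ₕ HN) ⊗ₕ HG)) := legIn N u * α.amplIn a

/-- The average was defined by slicing in B(HC ⊗ HN) ⊗ G; knowing that the operator lies in (C ⊗ᵥ N)
⊗ᵥ G puts its slices in C ⊗ᵥ N. -/
theorem HopfAction.toAmp_twistedIn (a : (C ⊗ᵥ N : VonNeumannAlgebra (HC ⊗ₕ HN))) :
    toAmp (α.twistedIn u a) = α.twisted u a :=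
  Subtype.ext (reassoc_mul (leg13 HN (u : HC ⊗ₕ HG →L[ℂ] HC ⊗ₕ HG)) (α.ampl a)).symm

/-- The linear map `a ↦ u₁₃ (id ⊗ α)(a)`. -/
def HopfAction.twistedL : (C ⊗ᵥ N : VonNeumannAlgebra (HC ⊗ₕ HN)) →ₗ[ℂ]
    ((C ⊗ᵥ N) ⊗ᵥ G.alg : VonNeumannAlgebra ((HC ⊗ₕ HN) ⊗ₕ HG)) where
  toFun := α.twistedIn u
  map_add' a b := by
    refine Subtype.ext ?_
    change (legIn N u : (HC ⊗ₕ HN) ⊗ₕ HG →L[ℂ] (HC ⊗ₕ HN) ⊗ₕ HG) * α.amplRep (a + b) =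
      (legIn N u : (HC ⊗ₕ HN) ⊗ₕ HG →L[ℂ] (HC ⊗ₕ HN) ⊗ₕ HG) * α.amplRep a +
      (legIn N u : (HC ⊗ₕ HN) ⊗ₕ HG →L[ℂ] (HC ⊗ₕ HN) ⊗ₕ HG) * α.amplRep b
    rw [map_add, mul_add]
  map_smul' c a := by
    refine Subtype.ext ?_
    change (legIn N u : (HC ⊗ₕ HN) ⊗ₕ HG →L[ℂ] (HC ⊗ₕ HN) ⊗ₕ HG) * α.amplRep (c • a) =
      c • ((legIn N u : (HC ⊗ₕ HN) ⊗ₕ HG →L[ℂ] (HC ⊗ₕ HN) ⊗ₕ HG) * α.amplRep a)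
    rw [map_smul, mul_smul_comm]

/-- The average of `u₁₃ (id ⊗ α)(a)` by a bounded functional, as an element of `C ⊗ᵥ N`. -/
def HopfAction.avg (φ : StrongDual ℂ G.alg) : (C ⊗ᵥ N : VonNeumannAlgebra (HC ⊗ₕ HN)) →ₗ[ℂ]
    (C ⊗ᵥ N : VonNeumannAlgebra (HC ⊗ₕ HN)) :=
  (rightSlice φ).toLinearMap.comp (α.twistedL u)

theorem HopfAction.avg_apply (φ : StrongDual ℂ G.alg)
    (a : (C ⊗ᵥ N : VonNeumannAlgebra (HC ⊗ₕ HN))) :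
    α.avg u φ a = rightSlice φ (α.twistedIn u a) := rfl

theorem HopfAction.coe_avg (θ : NormalPos G.alg) (a : (C ⊗ᵥ N : VonNeumannAlgebra (HC ⊗ₕ HN))) :
    (α.avg u θ.toDual a : HC ⊗ₕ HN →L[ℂ] HC ⊗ₕ HN) = α.average u θ a := by
  rw [α.avg_apply, coe_rightSlice, α.toAmp_twistedIn]
  rfl

theorem HopfAction.average_mem (θ : NormalPos G.alg)
    (a : (C ⊗ᵥ N : VonNeumannAlgebra (HC ⊗ₕ HN))) : α.average u θ a ∈ C ⊗ᵥ N := by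
  rw [← α.coe_avg]; exact (α.avg u θ.toDual a).2

theorem HopfAction.norm_amplIn_le (a : (C ⊗ᵥ N : VonNeumannAlgebra (HC ⊗ₕ HN))) :
    ‖α.amplIn a‖ ≤ ‖a‖ := NonUnitalStarAlgHom.norm_apply_le α.amplRep a

theorem norm_legIn_le
    (hu : (u : HC ⊗ₕ HG →L[ℂ] HC ⊗ₕ HG) ∈ unitary (HC ⊗ₕ HG →L[ℂ] HC ⊗ₕ HG)) :
    ‖legIn N u‖ ≤ 1 := by
  have h : ‖legIn N u‖ * ‖legIn N u‖ ≤ 1 := by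
    rw [← CStarRing.norm_star_mul_self, star_legIn_mul u hu]
    exact ContinuousLinearMap.norm_id_le
  nlinarith [norm_nonneg (legIn N u)]

/-- A bound for arbitrary bounded functionals, so that it covers the non-positive differences m * θ
- m. -/
theorem HopfAction.norm_avg_le
    (hu : (u : HC ⊗ₕ HG →L[ℂ] HC ⊗ₕ HG) ∈ unitary (HC ⊗ₕ HG →L[ℂ] HC ⊗ₕ HG))
    (φ : StrongDual ℂ G.alg) (a : (C ⊗ᵥ N : VonNeumannAlgebra (HC ⊗ₕ HN))) :
    ‖α.avg u φ a‖ ≤ ‖φ‖ * ‖a‖ := by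
  refine (norm_slice_le φ (toAmp (α.twistedIn u a))).trans ?_
  gcongr
  calc ‖α.twistedIn u a‖ ≤ ‖legIn N u‖ * ‖α.amplIn a‖ := norm_mul_le _ _
    _ ≤ 1 * ‖a‖ := by
      gcongr
      · exact norm_legIn_le u hu
      · exact α.norm_amplIn_le a
    _ = ‖a‖ := one_mul _

theorem HopfAction.coeffIn_amplIn (a : (C ⊗ᵥ N : VonNeumannAlgebra (HC ⊗ₕ HN))) (ξ ξ' : HC)
    (k k' : HN) : coeffIn (tmul ξ k) (tmul ξ' k') (toAmp (α.amplIn a)) =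
      coeffIn k k' (toAmp (α.hom (coeffIn ξ ξ' (toAmp a)))) := by
  refine Subtype.ext ?_
  change coeff (tmul ξ k) (tmul ξ' k') (reassoc (α.ampl a)) = _
  rw [coeff_reassoc, α.ampl_eq, coeff_idL]
  rfl

/-- Brings slices of (id ⊗ α)(a) down to slices of α at coefficients of a, which lie in `N`, where
the invariance of ω can be used. -/
theorem HopfAction.coeffIn_rightSlice_amplIn (φ : StrongDual ℂ G.alg)
    (a : (C ⊗ᵥ N : VonNeumannAlgebra (HC ⊗ₕ HN))) (ξ ξ' : HC) :
    coeffIn ξ ξ' (toAmp (rightSlice (M := C ⊗ᵥ N) φ (α.amplIn a))) =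
      rightSlice φ (α.hom (coeffIn ξ ξ' (toAmp a))) := by
  refine Subtype.ext (ext_inner_clm fun k k' => ?_)
  change ⟪k, coeff ξ ξ' (slice φ (toAmp (α.amplIn a))) k'⟫_ℂ = ⟪k, slice φ _ k'⟫_ℂ
  rw [inner_coeff, inner_slice, inner_slice, α.coeffIn_amplIn]

/-- After Fubini, ω is applied to the `N` leg first, where invariance leaves a multiple of 1 for θ
to evaluate. -/
theorem HopfAction.rightSlice_rightSlice_amplIn {ω : NormalPos N} (hω : α.Invariant ω)
    (θ : NormalPos G.alg) (a : (C ⊗ᵥ N : VonNeumannAlgebra (HC ⊗ₕ HN))) :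
    rightSlice ω.toDual (rightSlice (M := C ⊗ᵥ N) θ.toDual (α.amplIn a)) =
      θ.toDual 1 • rightSlice (M := C) ω.toDual a := by
  refine Subtype.ext (ext_inner_clm fun ξ ξ' => ?_)
  change ⟪ξ, slice ω.toDual (toAmp (rightSlice (M := C ⊗ᵥ N) θ.toDual (α.amplIn a))) ξ'⟫_ℂ =
    ⟪ξ, θ.toDual 1 • slice ω.toDual (toAmp a) ξ'⟫_ℂ
  rw [inner_slice, inner_smul_right, inner_slice, α.coeffIn_rightSlice_amplIn,
    apply_rightSlice_eq _ θ.normal]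
  have h : rightSlice ω.toDual (flipL (α.hom (coeffIn ξ ξ' (toAmp a)))) =
      ω.toDual (coeffIn ξ ξ' (toAmp a)) • (1 : G.alg) := Subtype.ext (hω _)
  rw [h, map_smul, smul_eq_mul, mul_comm]

variable (μ : NormalPos C) (ω : NormalPos N)

/-- Kadison–Schwarz bounds avg(a)* avg(a) by θ(1) times a slice of (id ⊗ α)(a*a), with u₁₃
cancelled; invariance evaluates this with a second factor θ(1). The constant ‖Γ_θ(1)‖² is θ(1) as a
real number. -/
theorem HopfAction.norm_Xi_avg_le
    (hu : (u : HC ⊗ₕ HG →L[ℂ] HC ⊗ₕ HG) ∈ unitary (HC ⊗ₕ HG →L[ℂ] HC ⊗ₕ HG))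
    {ω : NormalPos N} (hω : α.Invariant ω)
    (θ : NormalPos G.alg) (a : (C ⊗ᵥ N : VonNeumannAlgebra (HC ⊗ₕ HN))) :
    ‖Xi μ ω (α.avg u θ.toDual a)‖ ≤ ‖θ.Γ 1‖ ^ 2 * ‖Xi μ ω a‖ := by
  have h1 : θ.toDual 1 = ((‖θ.Γ 1‖ ^ 2 : ℝ) : ℂ) := by rw [norm_gnsMap_sq, star_one, one_mul]
  have h2 : star (α.twistedIn u a) * α.twistedIn u a = α.amplIn (star a * a) := by
    rw [HopfAction.twistedIn, star_mul, mul_assoc, ← mul_assoc (star (legIn N u)),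
      star_legIn_mul u hu, one_mul, α.star_amplIn_mul]
  have h3 := (prodNormal μ ω).mono (star_rightSlice_mul_le (M := C ⊗ᵥ N) θ (α.twistedIn u a))
  rw [h2, map_smul, ← α.avg_apply] at h3
  change prodFunctional μ.toDual ω.toDual _ ≤
    θ.toDual 1 • μ.toDual (rightSlice ω.toDual (rightSlice θ.toDual _)) at h3
  rw [α.rightSlice_rightSlice_amplIn hω, map_smul] at h3
  change _ ≤ θ.toDual 1 • θ.toDual 1 • prodFunctional μ.toDual ω.toDual (star a * a) at h3
  rw [← norm_Xi_sq, ← norm_Xi_sq, h1, smul_eq_mul, smul_eq_mul, ← Complex.ofReal_mul,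
    ← Complex.ofReal_mul, Complex.real_le_real] at h3
  refine le_of_sq_le_sq ?_ (by positivity)
  rw [mul_pow]
  linarith

theorem HopfAction.isV_iff (θ : NormalPos G.alg)
    (V : μ.Space ⊗ₕ ω.Space →L[ℂ] μ.Space ⊗ₕ ω.Space) : α.IsV u μ ω θ V ↔
      ∀ a, V (Xi μ ω a) = Xi μ ω (α.avg u θ.toDual a) := by
  have h : ∀ a, (⟨α.average u θ a, α.average_mem u θ a⟩ : (C ⊗ᵥ N : VonNeumannAlgebra (HC ⊗ₕ HN))) =
      α.avg u θ.toDual a := fun a => Subtype.ext (α.coe_avg u θ a).symm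
  constructor
  · intro hV a
    obtain ⟨_, h2⟩ := hV a
    rw [h2, h]
  · intro hV a
    exact ⟨α.average_mem u θ a, by rw [hV, h]⟩

/-- The norm inequality makes Ξ(a) ↦ Ξ(avg(a)) well defined even where Ξ is not injective, as may
happen for non-faithful μ; density of the range of Ξ gives both the extension and its uniqueness. -/
theorem HopfAction.existsUnique_V
    (hu : (u : HC ⊗ₕ HG →L[ℂ] HC ⊗ₕ HG) ∈ unitary (HC ⊗ₕ HG →L[ℂ] HC ⊗ₕ HG))
    {ω : NormalPos N} (hω : α.Invariant ω) (θ : NormalPos G.alg) :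
    ∃! V, α.IsV u μ ω θ V := by
  have key := LinearMap.extendOfNorm_eq (f := (Xi μ ω).comp (α.avg u θ.toDual))
    (denseRange_Xi μ ω) ⟨‖θ.Γ 1‖ ^ 2, fun a => α.norm_Xi_avg_le u μ hu hω θ a⟩
  refine ⟨((Xi μ ω).comp (α.avg u θ.toDual)).extendOfNorm (Xi μ ω),
    (α.isV_iff u μ ω θ _).mpr key, ?_⟩
  · intro V hV
    rw [α.isV_iff] at hV
    refine ContinuousLinearMap.coeFn_injective ?_
    refine (denseRange_Xi μ ω).equalizer V.continuous (ContinuousLinearMap.continuous _) ?_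
    funext a
    exact (hV a).trans (key a).symm

theorem HopfAction.V_Xi
    (hu : (u : HC ⊗ₕ HG →L[ℂ] HC ⊗ₕ HG) ∈ unitary (HC ⊗ₕ HG →L[ℂ] HC ⊗ₕ HG))
    {ω : NormalPos N} (hω : α.Invariant ω) (θ : NormalPos G.alg)
    (a : (C ⊗ᵥ N : VonNeumannAlgebra (HC ⊗ₕ HN))) :
    α.V u μ ω θ (Xi μ ω a) = Xi μ ω (α.avg u θ.toDual a) := by
  have h := (α.existsUnique_V u μ hu hω θ).exists
  rw [HopfAction.V, dif_pos h]
  exact (α.isV_iff u μ ω θ _).mp h.choose_spec a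

theorem NormalPos.IsState.norm_gnsMap_one {P : VonNeumannAlgebra HG} {θ : NormalPos P} (hθ : θ.IsState) :
    ‖θ.Γ 1‖ ^ 2 = 1 := by
  have h : ((‖θ.Γ 1‖ ^ 2 : ℝ) : ℂ) = 1 := by
    rw [norm_gnsMap_sq, star_one, one_mul]; exact hθ
  exact_mod_cast h

theorem HopfAction.norm_V_le
    (hu : (u : HC ⊗ₕ HG →L[ℂ] HC ⊗ₕ HG) ∈ unitary (HC ⊗ₕ HG →L[ℂ] HC ⊗ₕ HG))
    {ω : NormalPos N} (hω : α.Invariant ω) {θ : NormalPos G.alg} (hθ : θ.IsState)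
    (ζ : μ.Space ⊗ₕ ω.Space) : ‖α.V u μ ω θ ζ‖ ≤ ‖ζ‖ := by
  have hc : IsClosed {ζ | ‖α.V u μ ω θ ζ‖ ≤ ‖ζ‖} :=
    isClosed_le (α.V u μ ω θ).continuous.norm continuous_norm
  refine hc.closure_subset_iff.mpr ?_ (denseRange_Xi μ ω ζ)
  rintro _ ⟨a, rfl⟩
  change ‖α.V u μ ω θ (Xi μ ω a)‖ ≤ _
  rw [α.V_Xi u μ hu hω]
  refine (α.norm_Xi_avg_le u μ hu hω θ a).trans ?_
  rw [hθ.norm_gnsMap_one, one_mul]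

end Averages

/-! ### Averages compose by convolution. -/

section Composition
variable {HG : Type*} [NormedAddCommGroup HG] [InnerProductSpace ℂ HG] [CompleteSpace HG]
variable {HN : Type*} [NormedAddCommGroup HN] [InnerProductSpace ℂ HN] [CompleteSpace HN]
variable {HC : Type*} [NormedAddCommGroup HC] [InnerProductSpace ℂ HC] [CompleteSpace HC]

theorem inner_mapT_one_mul (A : HC →L[ℂ] HC) (Z : HC ⊗ₕ HG →L[ℂ] HC ⊗ₕ HG) (x y : HC) (h h' : HG) :
    ⟪tmul y h, (mapT A (1 : HG →L[ℂ] HG) * Z : HC ⊗ₕ HG →L[ℂ] HC ⊗ₕ HG) (tmul x h')⟫_ℂ =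
      ⟪tmul (star A y) h, Z (tmul x h')⟫_ℂ := by
  rw [mul_apply_eq_comp, ← ContinuousLinearMap.adjoint_inner_left,
    ← ContinuousLinearMap.star_eq_adjoint, star_mapT, star_one, mapT_tmul]
  rfl

theorem inner_star_left (A : HC →L[ℂ] HC) (x y : HC) : ⟪star A y, x⟫_ℂ = ⟪y, A x⟫_ℂ := by
  rw [ContinuousLinearMap.star_eq_adjoint, ContinuousLinearMap.adjoint_inner_left]

variable {G : HopfVonNeumannAlgebra HG} {N : VonNeumannAlgebra HN} (α : HopfAction G N)
variable {C : VonNeumannAlgebra HC} {A : VonNeumannAlgebra HG}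

/-- Serves with two different middle legs: `HN` for u₁₃ beside the action, and `HG` for the factor
u₁₃ of the corepresentation identity. -/
theorem coeff_flip_reassoc_leg13 (v : (C ⊗ᵥ A : VonNeumannAlgebra (HC ⊗ₕ HG))) (h h' : HG) :
    coeff h h' (conjL (flipU (HC ⊗ₕ HN) HG) (reassoc (leg13 HN (v : HC ⊗ₕ HG →L[ℂ] HC ⊗ₕ HG)))) =
      mapT (coeffIn h h' (flipAmp v) : HC →L[ℂ] HC) 1 := by
  refine ext_inner_total dense_span_tmul fun p q => ?_
  have h1 : ∀ (y : HC ⊗ₕ HN) (g : HG), (flipU (HC ⊗ₕ HN) HG).symm (tmul g y) = tmul y g :=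
    fun y g => by rw [LinearIsometryEquiv.symm_apply_eq, flipU_tmul]
  rw [inner_coeff, inner_conjL, h1, h1, inner_reassoc, leg13_eq_idL, inner_idL]
  change ⟪_, mapT 1 (coeff p.1 q.1 (v : HC ⊗ₕ HG →L[ℂ] HC ⊗ₕ HG)) _⟫_ℂ = _
  rw [mapT_tmul, mapT_tmul, inner_tmul, inner_tmul, inner_coeff, inner_coeff_flip, mul_comm]

theorem inner_reassoc_leg13 (v : (C ⊗ᵥ A : VonNeumannAlgebra (HC ⊗ₕ HG))) (h h' : HG)
    (y x : HC ⊗ₕ HN) :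
    ⟪tmul y h, reassoc (leg13 HN (v : HC ⊗ₕ HG →L[ℂ] HC ⊗ₕ HG)) (tmul x h')⟫_ℂ =
      ⟪y, mapT (coeffIn h h' (flipAmp v) : HC →L[ℂ] HC) 1 x⟫_ℂ := by
  have h1 : ∀ (y : HC ⊗ₕ HN) (g : HG), (flipU (HC ⊗ₕ HN) HG).symm (tmul g y) = tmul y g :=
    fun y g => by rw [LinearIsometryEquiv.symm_apply_eq, flipU_tmul]
  rw [← coeff_flip_reassoc_leg13, inner_coeff, inner_conjL, h1, h1]

theorem dense_span_tmul4 :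
    Dense (Submodule.span ℂ (Set.range fun p : (HC × HN × HG) × HG =>
      tmul (tmul (tmul p.1.1 p.1.2.1) p.1.2.2) p.2) : Set (((HC ⊗ₕ HN) ⊗ₕ HG) ⊗ₕ HG)) := by
  have h1 : Dense (Submodule.span ℂ (Set.range (id : HG → HG)) : Set HG) := by simp
  have := dense_span_tmul_of_dense (dense_span_tmul3' (H := HC) (K := HN) (L := HG)) h1
  simp only [id] at this
  exact this

theorem HopfAction.coeffIn_flip_amplIn (a : (C ⊗ᵥ N : VonNeumannAlgebra (HC ⊗ₕ HN))) (ξ ξ' : HC)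
    (h h' : HG) : coeffIn ξ ξ' (toAmp (M := C) (N := N) (coeffIn h h' (flipAmp (α.amplIn a)))) =
      coeffIn h h' (flipAmp (α.hom (coeffIn ξ ξ' (toAmp a)))) := by
  rw [← rightSlice_vectorFunctional, ← rightSlice_vectorFunctional, α.coeffIn_rightSlice_amplIn]

/-- The action identity amplified by `C`: a coefficient along `HC` reduces it to the identity for α
at an element of `N`. -/
theorem HopfAction.reassoc_idL_amplIn (a : (C ⊗ᵥ N : VonNeumannAlgebra (HC ⊗ₕ HN))) :
    reassoc (idL G.Δ (α.amplIn a)) = homIdL α.amplRep (α.amplIn a) := by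
  refine ext_inner_total dense_span_tmul4 ?_
  rintro ⟨⟨ξ, k, g⟩, h⟩ ⟨⟨ξ', k', g'⟩, h'⟩
  dsimp only
  have hl : ⟪tmul (tmul (tmul ξ k) g) h, reassoc (idL G.Δ (α.amplIn a))
      (tmul (tmul (tmul ξ' k') g') h')⟫_ℂ = ⟪tmul k g,
        α.rep (coeffIn h h' (flipAmp (α.hom (coeffIn ξ ξ' (toAmp a))))) (tmul k' g')⟫_ℂ := by
    rw [inner_reassoc, inner_idL, α.coeffIn_amplIn, ← inner_idL, idL_apply, ← α.action]
    change ⟪_, conjL (assocU HN HG HG) _ _⟫_ℂ = _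
    rw [inner_conjL, assocU_symm_tmul, assocU_symm_tmul]
    exact inner_homIdL α.rep _ _ _ _ _
  have hr : ⟪tmul (tmul (tmul ξ k) g) h, homIdL α.amplRep (α.amplIn a)
      (tmul (tmul (tmul ξ' k') g') h')⟫_ℂ = ⟪tmul k g,
        α.rep (coeffIn h h' (flipAmp (α.hom (coeffIn ξ ξ' (toAmp a))))) (tmul k' g')⟫_ℂ := by
    rw [inner_homIdL, α.amplRep_apply, inner_reassoc, α.ampl_eq, inner_idL, α.coeffIn_flip_amplIn]
  exact hl.trans hr.symm

variable (u : (C ⊗ᵥ G.alg : VonNeumannAlgebra (HC ⊗ₕ HG)))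

theorem coeffIn_legIn (ξ ξ' : HC) (k k' : HN) :
    coeffIn (tmul ξ k) (tmul ξ' k') (toAmp (legIn N u)) =
      ⟪k, k'⟫_ℂ • coeffIn ξ ξ' (toAmp u) := by
  refine Subtype.ext ?_
  change coeff (tmul ξ k) (tmul ξ' k') (reassoc (leg13 HN (u : HC ⊗ₕ HG →L[ℂ] HC ⊗ₕ HG))) =
    ⟪k, k'⟫_ℂ • coeff ξ ξ' (u : HC ⊗ₕ HG →L[ℂ] HC ⊗ₕ HG)
  rw [coeff_reassoc, leg13_eq_idL, coeff_idL]
  exact coeff_mapT k k' 1 _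

theorem coeffIn_flip_legIn (h h' : HG) :
    coeffIn h h' (flipAmp (legIn N u)) = elem (coeffIn h h' (flipAmp u)) (1 : N) :=
  Subtype.ext (coeff_flip_reassoc_leg13 u h h')

theorem HopfAction.amplRep_elem_one (c : C) :
    α.amplRep (elem c (1 : N)) = mapT (mapT (c : HC →L[ℂ] HC) 1) 1 := by
  rw [α.amplRep_apply, α.ampl_eq, idL_elem, map_one, ← reassoc_mapT]
  congr 2
  exact mapT_one_one.symm

/-- The corepresentation identity with an idle leg `HN` inserted. Since α is unital, it acts
trivially on that leg, and matrix coefficients reduce the claim to (id ⊗ Δ)(u) = u₁₂ u₁₃. -/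
theorem HopfAction.reassoc_idL_legIn (hcorep : IsCorepresentation G u) :
    reassoc (idL G.Δ (legIn N u)) =
      mapT (legIn N u : (HC ⊗ₕ HN) ⊗ₕ HG →L[ℂ] (HC ⊗ₕ HN) ⊗ₕ HG) 1 *
        homIdL α.amplRep (legIn N u) := by
  refine ext_inner_total dense_span_tmul4 ?_
  rintro ⟨⟨ξ, k, g⟩, h⟩ ⟨⟨ξ', k', g'⟩, h'⟩
  dsimp only
  have hl : ⟪tmul g h, G.Δ (coeffIn ξ ξ' (toAmp u)) (tmul g' h')⟫_ℂ =
      ⟪tmul ξ g, (u : HC ⊗ₕ HG →L[ℂ] HC ⊗ₕ HG)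
        (tmul ((coeffIn h h' (flipAmp u) : HC →L[ℂ] HC) ξ') g')⟫_ℂ := by
    rw [← inner_idL, idL_apply, hcorep, ← inner_reassoc, reassoc_mul, reassoc_leg12,
      inner_mapT_one_mul, inner_reassoc_leg13, inner_star_left, mapT_tmul]
    rfl
  rw [inner_reassoc, inner_idL, coeffIn_legIn, map_smul, smul_apply, inner_smul_right, hl,
    inner_mapT_one_mul, inner_homIdL, coeffIn_flip_legIn, α.amplRep_elem_one, inner_star_left,
    mapT_tmul, mapT_tmul]
  change _ = ⟪_, reassoc (leg13 HN (u : HC ⊗ₕ HG →L[ℂ] HC ⊗ₕ HG)) (tmul (tmul _ k') g')⟫_ℂ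
  rw [inner_reassoc, leg13_eq_idL, inner_idL]
  change _ = ⟪_, mapT 1 (coeff ξ _ (u : HC ⊗ₕ HG →L[ℂ] HC ⊗ₕ HG)) _⟫_ℂ
  rw [mapT_tmul, inner_tmul, inner_coeff]
  rfl

theorem HopfAction.reassoc_idL_twistedIn (hcorep : IsCorepresentation G u)
    (a : (C ⊗ᵥ N : VonNeumannAlgebra (HC ⊗ₕ HN))) :
    reassoc (idL G.Δ (α.twistedIn u a)) =
      mapT (legIn N u : (HC ⊗ₕ HN) ⊗ₕ HG →L[ℂ] (HC ⊗ₕ HN) ⊗ₕ HG) 1 *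
        homIdL α.amplRep (α.twistedIn u a) := by
  rw [HopfAction.twistedIn, idL_mul G.isNormalOp_Δ, reassoc_mul,
    α.reassoc_idL_legIn u hcorep, α.reassoc_idL_amplIn, homIdL_mul α.isNormalOp_amplRep, mul_assoc]

/-- Normality of ψ lets its slice pass through the representation (id ⊗ α); the left factor u₁₃ is
absorbed into the left vector, and `HopfAction.reassoc_idL_twistedIn` recognises what remains as Δ
of a coefficient. -/
theorem HopfAction.coeffIn_twistedIn_avg (hcorep : IsCorepresentation G u)
    {ψ : StrongDual ℂ G.alg} (hψ : ψ ∈ predual G.alg)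
    (a : (C ⊗ᵥ N : VonNeumannAlgebra (HC ⊗ₕ HN))) (ξ η : HC ⊗ₕ HN) :
    coeffIn ξ η (toAmp (α.twistedIn u (α.avg u ψ a))) =
      rightSlice ψ (G.comul (coeffIn ξ η (toAmp (α.twistedIn u a)))) := by
  refine Subtype.ext (ext_inner_clm fun g h => ?_)
  change ⟪g, coeff ξ η ((legIn N u : (HC ⊗ₕ HN) ⊗ₕ HG →L[ℂ] (HC ⊗ₕ HN) ⊗ₕ HG) *
    α.amplRep (rightSlice ψ (α.twistedIn u a))) h⟫_ℂ =
    ⟪g, slice ψ (toAmp (G.comul (coeffIn ξ η (toAmp (α.twistedIn u a))))) h⟫_ℂ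
  rw [inner_coeff, mul_apply_eq_comp, ← inner_star_left, hom_rightSlice α.isNormalOp_amplRep hψ,
    inner_slice, inner_slice]
  congr 1
  refine Subtype.ext ?_
  change coeff _ _ (homIdL α.amplRep (α.twistedIn u a)) =
    coeff g h (G.Δ (coeffIn ξ η (toAmp (α.twistedIn u a))))
  rw [← coeff_mul_left, ← α.reassoc_idL_twistedIn u hcorep, coeff_reassoc, coeff_idL]

/-- Averages compose according to the convolution product. -/
theorem HopfAction.avg_avg (hcorep : IsCorepresentation G u) (φ : StrongDual ℂ G.alg)
    {ψ : StrongDual ℂ G.alg} (hψ : ψ ∈ predual G.alg)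
    (a : (C ⊗ᵥ N : VonNeumannAlgebra (HC ⊗ₕ HN))) :
    α.avg u φ (α.avg u ψ a) = α.avg u (G.conv φ ψ) a := by
  refine Subtype.ext (ext_inner_clm fun ξ η => ?_)
  change ⟪ξ, slice φ (toAmp (α.twistedIn u (α.avg u ψ a))) η⟫_ℂ =
    ⟪ξ, slice (G.conv φ ψ) (toAmp (α.twistedIn u a)) η⟫_ℂ
  rw [inner_slice, inner_slice, α.coeffIn_twistedIn_avg u hcorep hψ]
  rfl

end Composition

/-! ### A mean ergodic theorem for contractions on a Hilbert space. -/

section MeanErgodic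
variable {E : Type*} [NormedAddCommGroup E] [InnerProductSpace ℂ E]
variable {ι : Type*} {l : Filter ι}

/-- The vectors on which a uniformly bounded family of operators tends to zero. -/
def nullSpace (l : Filter ι) (A : ι → E →L[ℂ] E) : Submodule ℂ E where
  carrier := {x | Filter.Tendsto (fun i => A i x) l (nhds 0)}
  add_mem' hx hy := by simpa using Filter.Tendsto.add hx hy
  zero_mem' := by simpa using tendsto_const_nhds
  smul_mem' c x hx := by simpa using Filter.Tendsto.const_smul hx c

theorem mem_nullSpace {A : ι → E →L[ℂ] E} {x : E} :
    x ∈ nullSpace l A ↔ Filter.Tendsto (fun i => A i x) l (nhds 0) := Iff.rfl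

theorem isClosed_nullSpace {A : ι → E →L[ℂ] E} {R : ℝ} (hA : ∀ i x, ‖A i x‖ ≤ R * ‖x‖) :
    IsClosed (nullSpace l A : Set E) := by
  refine isClosed_of_closure_subset fun x hx => ?_
  rw [SetLike.mem_coe, mem_nullSpace, Metric.tendsto_nhds]
  intro ε hε
  have hR : 0 < |R| + 1 := by positivity
  obtain ⟨y, hy, hxy⟩ := Metric.mem_closure_iff.mp hx (ε / 2 / (|R| + 1)) (by positivity)
  filter_upwards [(Metric.tendsto_nhds.mp (mem_nullSpace.mp hy)) (ε / 2) (by positivity)] with i hi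
  rw [dist_zero_right] at hi ⊢
  rw [dist_eq_norm, lt_div_iff₀ hR] at hxy
  have h1 : A i x = A i (x - y) + A i y := by rw [map_sub, sub_add_cancel]
  have h2 : ‖A i (x - y)‖ ≤ ‖x - y‖ * (|R| + 1) := (hA i _).trans (by
    rw [mul_comm]
    gcongr
    linarith [le_abs_self R])
  calc ‖A i x‖ ≤ ‖A i (x - y)‖ + ‖A i y‖ := by rw [h1]; exact norm_add_le _ _
    _ < ε := by linarith

/-- Expanding, ‖y - x‖² = ‖y‖² - ‖x‖² ≤ 0. With y = Tx this turns orthogonality to Tx - x into Tx =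
x for a contraction T. -/
theorem eq_of_inner_eq_norm_sq {x y : E} (h : ⟪x, y⟫_ℂ = ⟪x, x⟫_ℂ) (hy : ‖y‖ ≤ ‖x‖) : y = x := by
  have h1 : ‖y - x‖ ^ 2 = ‖y‖ ^ 2 - ‖x‖ ^ 2 := by
    have h2 : RCLike.re ⟪y, x⟫_ℂ = ‖x‖ ^ 2 := by
      rw [inner_re_symm, h, inner_self_eq_norm_sq]
    rw [@norm_sub_sq ℂ, h2]
    ring
  have h3 : ‖y - x‖ ^ 2 ≤ 0 := by
    rw [h1, sub_nonpos]
    gcongr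
  have h4 : ‖y - x‖ = 0 := by
    have := sq_nonneg ‖y - x‖
    exact pow_eq_zero_iff (two_ne_zero) |>.mp (le_antisymm h3 this)
  exact sub_eq_zero.mp (norm_eq_zero.mp h4)

/-- A mean ergodic theorem: contractions which fix the common fixed vectors of a family of
contractions `T` and which asymptotically absorb `T` converge strongly to the projection onto
these fixed vectors. -/
theorem tendsto_starProjection_of_absorb [CompleteSpace E] {Θ : Type*} {T : Θ → E →L[ℂ] E}
    (hT : ∀ θ x, ‖T θ x‖ ≤ ‖x‖) (F : Submodule ℂ E) [F.HasOrthogonalProjection]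
    (hF : ∀ x, (∀ θ, T θ x = x) → x ∈ F) {S : ι → E →L[ℂ] E} (hS : ∀ i x, ‖S i x‖ ≤ ‖x‖)
    (hSF : ∀ i, ∀ x ∈ F, S i x = x)
    (h : ∀ θ x, Filter.Tendsto (fun i => S i (T θ x - x)) l (nhds 0)) (x : E) :
    Filter.Tendsto (fun i => S i x) l (nhds (F.starProjection x)) := by
  have hc : IsClosed (nullSpace l S : Set E) :=
    isClosed_nullSpace (R := 1) fun i x => by rw [one_mul]; exact hS i x
  have h1 : (nullSpace l S)ᗮ ≤ F := fun x hx => hF x fun θ => by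
    refine eq_of_inner_eq_norm_sq ?_ (hT θ x)
    rw [← sub_eq_zero, ← inner_sub_right]
    exact Submodule.inner_left_of_mem_orthogonal (mem_nullSpace.mpr (h θ x)) hx
  -- Taking orthogonal complements in `h1` gives the double complement of the null space, which is
  -- the null space because it is closed.
  have h2 : Fᗮ ≤ nullSpace l S := by
    refine (Submodule.orthogonal_le h1).trans ?_
    rw [Submodule.orthogonal_orthogonal_eq_closure]
    exact (IsClosed.submodule_topologicalClosure_eq hc).le
  have h3 := mem_nullSpace.mp (h2 (F.sub_starProjection_mem_orthogonal x))
  have h4 := h3.add_const (F.starProjection x)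
  rw [zero_add] at h4
  refine h4.congr fun i => ?_
  rw [map_sub, hSF i _ (F.starProjection_apply_mem x), sub_add_cancel]

end MeanErgodic

/-! ### Normal states, and normality of maps implemented on the GNS space. -/

section States
variable {H : Type*} [NormedAddCommGroup H] [InnerProductSpace ℂ H] [CompleteSpace H]
variable {M : VonNeumannAlgebra H}

theorem comp_mem_of_mem_topologicalClosure {X : Type*} [NormedAddCommGroup X] [NormedSpace ℂ X]
    (E : X →L[ℂ] X) (D W : Submodule ℂ (StrongDual ℂ X)) (hW : IsClosed (W : Set (StrongDual ℂ X)))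
    (h : ∀ φ ∈ D, φ.comp E ∈ W) {φ : StrongDual ℂ X} (hφ : φ ∈ D.topologicalClosure) :
    φ.comp E ∈ W := by
  let F : StrongDual ℂ X →L[ℂ] StrongDual ℂ X := (ContinuousLinearMap.compL ℂ X X ℂ).flip E
  have h1 : D ≤ W.comap F.toLinearMap := fun φ hφ => h φ hφ
  exact Submodule.topologicalClosure_minimal _ h1 (hW.preimage F.continuous) hφ

theorem NormalPos.IsState.norm_le_one {θ : NormalPos M} (hθ : θ.IsState) : ‖θ.toDual‖ ≤ 1 := by
  -- Cauchy–Schwarz against Γ(1), which has norm 1, bounds the norm by its own square root; hence it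
  -- is at most 1.
  have h : ‖θ.toDual‖ ≤ Real.sqrt ‖θ.toDual‖ :=
    ContinuousLinearMap.opNorm_le_bound _ (Real.sqrt_nonneg _) fun x => by
      refine (norm_apply_le_gnsMap θ x).trans ?_
      have h1 : ‖θ.Γ 1‖ = 1 :=
        (pow_eq_one_iff_of_nonneg (norm_nonneg _) two_ne_zero).mp hθ.norm_gnsMap_one
      rw [h1, one_mul]
      exact norm_gnsMap_le θ x
  have h2 := Real.sq_sqrt (norm_nonneg θ.toDual)
  by_contra! hcon
  nlinarith [norm_nonneg θ.toDual]

variable {K : Type*} [NormedAddCommGroup K] [InnerProductSpace ℂ K] [CompleteSpace K]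
variable {N : VonNeumannAlgebra K}

/-- A bounded map implemented on the GNS space by a symmetric operator is normal. -/
theorem isNormalMap_of_Xi {φ : NormalPos M} {ψ : NormalPos N} (hφ : φ.Faithful) (hψ : ψ.Faithful)
    (E : (M ⊗ᵥ N : VonNeumannAlgebra (H ⊗ₕ K)) →L[ℂ] (M ⊗ᵥ N : VonNeumannAlgebra (H ⊗ₕ K)))
    (P : φ.Space ⊗ₕ ψ.Space →L[ℂ] φ.Space ⊗ₕ ψ.Space) (hP : P.toLinearMap.IsSymmetric)
    (hE : ∀ a, Xi φ ψ (E a) = P (Xi φ ψ a)) : IsNormalMap E := by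
  intro χ hχ
  refine ⟨χ.comp E, ?_, fun _ => rfl⟩
  -- Symmetry of `P` moves it to the fixed vector Ξ(c), so composition with `E` yields another
  -- functional of the form ⟪w, Ξ(·)⟫.
  have h0 : ∀ c, ((innerSL ℂ (Xi φ ψ c)).comp (XiL φ ψ)).comp E =
      (innerSL ℂ (P (Xi φ ψ c))).comp (XiL φ ψ) := fun c => by
    refine ContinuousLinearMap.ext fun a => ?_
    have h2 : ⟪Xi φ ψ c, Xi φ ψ (E a)⟫_ℂ = ⟪P (Xi φ ψ c), Xi φ ψ a⟫_ℂ := by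
      rw [hE]
      exact (hP _ _).symm
    exact h2
  refine comp_mem_of_mem_topologicalClosure E _ _ isClosed_predual (fun χ hχ => ?_)
    (predual_le_closure_Xi hφ hψ hχ)
  induction hχ using Submodule.span_induction with
  | mem x hx =>
    obtain ⟨c, rfl⟩ := hx
    rw [h0]
    exact XiFunctional_mem_predual φ ψ _
  | zero => rw [ContinuousLinearMap.zero_comp]; exact zero_mem _
  | add x y _ _ hx hy => rw [ContinuousLinearMap.add_comp]; exact add_mem hx hy
  | smul c x _ hx => rw [ContinuousLinearMap.smul_comp]; exact Submodule.smul_mem _ c hx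

/-- The positive functional `x ↦ ⟪h, x h⟫`. -/
def vectorPos (M : VonNeumannAlgebra H) (h : H) : NormalPos M where
  toDual := vectorFunctional M h h
  normal := vectorFunctional_mem_predual h h
  nonneg x hx := (nonneg_iff_inner (x : H →L[ℂ] H)).mp hx h

theorem vectorPos_isState {h : H} (hh : ‖h‖ = 1) : (vectorPos M h).IsState := by
  change ⟪h, h⟫_ℂ = 1
  rw [inner_self_eq_norm_sq_to_K, hh]
  simp

end States

/-! ### Convergence of the averages, and the projection onto N_u. -/

section MainTheorem
variable {HG : Type*} [NormedAddCommGroup HG] [InnerProductSpace ℂ HG] [CompleteSpace HG]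
variable {HN : Type*} [NormedAddCommGroup HN] [InnerProductSpace ℂ HN] [CompleteSpace HN]
variable {HC : Type*} [NormedAddCommGroup HC] [InnerProductSpace ℂ HC] [CompleteSpace HC]
variable {G : HopfVonNeumannAlgebra HG} {N : VonNeumannAlgebra HN} (α : HopfAction G N)
variable {C : VonNeumannAlgebra HC} (u : (C ⊗ᵥ G.alg : VonNeumannAlgebra (HC ⊗ₕ HG)))
variable (μ : NormalPos C) {ω : NormalPos N}

theorem HopfAction.avg_sub (φ ψ : StrongDual ℂ G.alg)
    (a : (C ⊗ᵥ N : VonNeumannAlgebra (HC ⊗ₕ HN))) :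
    α.avg u (φ - ψ) a = α.avg u φ a - α.avg u ψ a :=
  map_sub (rightSliceL (α.twistedIn u a)) φ ψ

variable (hu : (u : HC ⊗ₕ HG →L[ℂ] HC ⊗ₕ HG) ∈ unitary (HC ⊗ₕ HG →L[ℂ] HC ⊗ₕ HG))
  (hω : α.Invariant ω)

theorem HopfAction.mem_fixedSpace {ζ : μ.Space ⊗ₕ ω.Space} :
    ζ ∈ α.fixedSpace u μ ω ↔ ∀ θ : NormalPos G.alg, θ.IsState → α.V u μ ω θ ζ = ζ := by
  rw [HopfAction.fixedSpace, Submodule.mem_iInf]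
  constructor
  · intro h θ hθ
    exact sub_eq_zero.mp (LinearMap.mem_ker.mp (h ⟨θ, hθ⟩))
  · intro h θ
    exact LinearMap.mem_ker.mpr (sub_eq_zero.mpr (h θ θ.2))

include hu hω in
/-- The operators `V_u(m_i)` of an approximately invariant net converge strongly to `P_u`. -/
theorem HopfAction.tendsto_V (hcorep : IsCorepresentation G u) {ι : Type*} [Preorder ι]
    {m : ι → NormalPos G.alg} (hm : IsApproxInvariant G m) (ζ : μ.Space ⊗ₕ ω.Space) :
    Filter.Tendsto (fun i => α.V u μ ω (m i) ζ) Filter.atTop (nhds (α.P u μ ω ζ)) := by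
  refine tendsto_starProjection_of_absorb
    (T := fun θ : {θ : NormalPos G.alg // θ.IsState} => α.V u μ ω θ)
    (fun θ x => α.norm_V_le u μ hu hω θ.2 x) (α.fixedSpace u μ ω)
    (fun x hx => (α.mem_fixedSpace u μ).mpr fun θ hθ => hx ⟨θ, hθ⟩)
    (S := fun i => α.V u μ ω (m i)) (fun i x => α.norm_V_le u μ hu hω (hm.1 i) x)
    (fun i x hx => (α.mem_fixedSpace u μ).mp hx _ (hm.1 i)) ?_ ζ
  rintro ⟨θ, hθ⟩ x
  let A : ι → (μ.Space ⊗ₕ ω.Space →L[ℂ] μ.Space ⊗ₕ ω.Space) :=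
    fun i => (α.V u μ ω (m i)).comp (α.V u μ ω θ - 1)
  have hc : IsClosed (nullSpace Filter.atTop A : Set (μ.Space ⊗ₕ ω.Space)) := by
    -- V(m_i)(V(θ) - 1) has norm at most 2, uniformly in i, so convergence need only be checked on
    -- the dense range of Ξ.
    refine isClosed_nullSpace (R := 2) fun i x => ?_
    refine (α.norm_V_le u μ hu hω (hm.1 i) _).trans ?_
    change ‖α.V u μ ω θ x - x‖ ≤ _
    refine (norm_sub_le _ _).trans ?_
    have := α.norm_V_le u μ hu hω hθ x
    linarith
  have hd : Set.range (Xi μ ω) ⊆ nullSpace Filter.atTop A := by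
    rintro _ ⟨a, rfl⟩
    rw [SetLike.mem_coe, mem_nullSpace]
    -- V(m)V(θ) - V(m) is averaging by m * θ - m, whose norm tends to 0 by approximate invariance.
    have h0 : ∀ i, A i (Xi μ ω a) =
        XiL μ ω (α.avg u (G.conv (m i).toDual θ.toDual - (m i).toDual) a) := fun i => by
      change α.V u μ ω (m i) (α.V u μ ω θ (Xi μ ω a) - Xi μ ω a) = _
      rw [map_sub, α.V_Xi u μ hu hω, α.V_Xi u μ hu hω, α.V_Xi u μ hu hω,
        α.avg_avg u hcorep _ θ.normal, α.avg_sub, map_sub]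
      rfl
    have hb : ∀ i, ‖A i (Xi μ ω a)‖ ≤
        ‖XiL μ ω‖ * (‖G.conv (m i).toDual θ.toDual - (m i).toDual‖ * ‖a‖) := fun i => by
      rw [h0]
      exact ((XiL μ ω).le_opNorm _).trans (by gcongr; exact α.norm_avg_le u hu _ a)
    refine squeeze_zero_norm hb ?_
    have := ((hm.2 θ hθ).1.mul_const ‖a‖).const_mul ‖XiL μ ω‖
    simpa using this
  exact hc.closure_subset_iff.mpr hd (denseRange_Xi μ ω x)

theorem HopfAction.P_P (ζ : μ.Space ⊗ₕ ω.Space) :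
    α.P u μ ω (α.P u μ ω ζ) = α.P u μ ω ζ :=
  Submodule.starProjection_eq_self_iff.mpr (Submodule.starProjection_apply_mem _ _)

theorem HopfAction.P_eq_self {ζ : μ.Space ⊗ₕ ω.Space} :
    α.P u μ ω ζ = ζ ↔ ∀ θ : NormalPos G.alg, θ.IsState → α.V u μ ω θ ζ = ζ := by
  rw [← α.mem_fixedSpace]
  exact Submodule.starProjection_eq_self_iff

include hu in
theorem HopfAction.twistedIn_eq_elem_iff (b : (C ⊗ᵥ N : VonNeumannAlgebra (HC ⊗ₕ HN))) :
    α.twistedIn u b = elem b 1 ↔ b ∈ α.fixedSet u := by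
  have h1 : α.twistedIn u b = elem b 1 ↔ leg13 HN (u : HC ⊗ₕ HG →L[ℂ] HC ⊗ₕ HG) * α.ampl b =
      leg12 HG (b : HC ⊗ₕ HN →L[ℂ] HC ⊗ₕ HN) := by
    rw [← reassoc_injective.eq_iff, reassoc_mul, reassoc_leg12, Subtype.ext_iff]
    rfl
  rw [h1]
  change _ ↔ α.ampl b = leg13 HN (star (u : HC ⊗ₕ HG →L[ℂ] HC ⊗ₕ HG)) *
    leg12 HG (b : HC ⊗ₕ HN →L[ℂ] HC ⊗ₕ HN)
  constructor
  · intro h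
    rw [← h, ← mul_assoc, ← leg13_mul, Unitary.star_mul_self_of_mem hu, leg13_one, one_mul]
  · intro h
    rw [h, ← mul_assoc, ← leg13_mul, Unitary.mul_star_self_of_mem hu, leg13_one, one_mul]

theorem HopfAction.avg_of_twistedIn_eq {b : (C ⊗ᵥ N : VonNeumannAlgebra (HC ⊗ₕ HN))}
    (hb : α.twistedIn u b = elem b 1) {θ : NormalPos G.alg} (hθ : θ.IsState) :
    α.avg u θ.toDual b = b := by
  refine Subtype.ext (ext_inner_clm fun ξ η => ?_)
  rw [α.avg_apply, hb]
  change ⟪ξ, slice θ.toDual (toAmp (elem b 1)) η⟫_ℂ = _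
  rw [inner_slice, coeffIn_elem, map_smul, hθ, smul_eq_mul, mul_one]

/-- Vector states suffice: each coefficient A of the twisted element satisfies ⟪g, Ag⟫ = c for all
unit vectors g, and on a complex Hilbert space a constant numerical range forces A = c. -/
theorem HopfAction.twistedIn_eq_of_avg {b : (C ⊗ᵥ N : VonNeumannAlgebra (HC ⊗ₕ HN))}
    (h : ∀ θ : NormalPos G.alg, θ.IsState → α.avg u θ.toDual b = b) :
    α.twistedIn u b = elem b 1 := by
  refine Subtype.ext (ext_coeff fun ξ η => ?_)
  change _ = coeff ξ η (mapT (b : HC ⊗ₕ HN →L[ℂ] HC ⊗ₕ HN) 1)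
  rw [coeff_mapT]
  set A := coeff ξ η (α.twistedIn u b : (HC ⊗ₕ HN) ⊗ₕ HG →L[ℂ] (HC ⊗ₕ HN) ⊗ₕ HG) with hA
  have h1 : ∀ g : HG, ‖g‖ = 1 → ⟪g, A g⟫_ℂ = ⟪ξ, (b : HC ⊗ₕ HN →L[ℂ] HC ⊗ₕ HN) η⟫_ℂ := by
    intro g hg
    conv_rhs => rw [← h _ (vectorPos_isState hg)]
    exact (inner_slice (vectorFunctional G.alg g g) (toAmp (α.twistedIn u b)) ξ η).symm
  set c := ⟪ξ, (b : HC ⊗ₕ HN →L[ℂ] HC ⊗ₕ HN) η⟫_ℂ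
  have h2 : ∀ g : HG, ⟪(A - c • (1 : HG →L[ℂ] HG)) g, g⟫_ℂ = 0 := by
    intro g
    rcases eq_or_ne g 0 with rfl | hg
    · simp
    have hn : ‖g‖ ≠ 0 := norm_ne_zero_iff.mpr hg
    have h3 := h1 (((‖g‖ : ℂ)⁻¹) • g) (by rw [norm_smul]; simp [hn])
    rw [map_smul, inner_smul_left, inner_smul_right] at h3
    have h4 : ⟪g, A g⟫_ℂ = c * ⟪g, g⟫_ℂ := by
      rw [← h3, inner_self_eq_norm_sq_to_K]
      have hn' : (‖g‖ : ℂ) ≠ 0 := by exact_mod_cast hn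
      simp
      field_simp
    rw [← inner_conj_symm, sub_apply, inner_sub_right, h4, smul_apply, inner_smul_right]
    simp
  have h5 := (inner_map_self_eq_zero (A - c • (1 : HG →L[ℂ] HG)).toLinearMap).mp h2
  have h6 : A - c • (1 : HG →L[ℂ] HG) = 0 := by
    ext g
    exact congrArg (fun T : HG →ₗ[ℂ] HG => T g) h5
  exact sub_eq_zero.mp h6

include hu hω in
-- Injectivity of Ξ turns fixed vectors of all V(θ) into elements fixed by all averages, which are
-- those with u₁₃ (id ⊗ α)(b) = b ⊗ 1; unitarity of u moves u₁₃ to the other side.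
theorem HopfAction.P_Xi_eq_iff (hμ : μ.Faithful) (hωf : ω.Faithful)
    (b : (C ⊗ᵥ N : VonNeumannAlgebra (HC ⊗ₕ HN))) :
    α.P u μ ω (Xi μ ω b) = Xi μ ω b ↔ b ∈ α.fixedSet u := by
  rw [α.P_eq_self, ← α.twistedIn_eq_elem_iff u hu]
  constructor
  · intro h
    refine α.twistedIn_eq_of_avg u fun θ hθ => Xi_injective hμ hωf ?_
    rw [← α.V_Xi u μ hu hω, h θ hθ]
  · intro h θ hθ
    rw [α.V_Xi u μ hu hω, α.avg_of_twistedIn_eq u h hθ]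

include hu hω in
theorem HopfAction.tendsto_Xi_avg (hcorep : IsCorepresentation G u) {ι : Type*} [Preorder ι]
    {m : ι → NormalPos G.alg} (hm : IsApproxInvariant G m)
    (a : (C ⊗ᵥ N : VonNeumannAlgebra (HC ⊗ₕ HN))) :
    Filter.Tendsto (fun i => Xi μ ω (α.avg u (m i).toDual a)) Filter.atTop
      (nhds (α.P u μ ω (Xi μ ω a))) :=
  (α.tendsto_V u μ hu hω hcorep hm (Xi μ ω a)).congr fun i => α.V_Xi u μ hu hω (m i) a

include hu in
theorem HopfAction.norm_avg_state_le {θ : NormalPos G.alg} (hθ : θ.IsState)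
    (a : (C ⊗ᵥ N : VonNeumannAlgebra (HC ⊗ₕ HN))) : ‖α.avg u θ.toDual a‖ ≤ ‖a‖ :=
  (α.norm_avg_le u hu θ.toDual a).trans
    (mul_le_of_le_one_left (norm_nonneg a) hθ.norm_le_one)

include hu hω in
-- The averages of a stay in the ball of radius ‖a‖, so they converge ultraweakly along an
-- ultrafilter. Each ⟪w, Ξ(·)⟫ is normal, which identifies Ξ of the limit with the norm limit P
-- Ξ(a). Faithfulness plays no part yet.
theorem HopfAction.exists_Xi_eq_P (hcorep : IsCorepresentation G u) {ι : Type*} [Preorder ι]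
    [IsDirectedOrder ι] [Nonempty ι] {m : ι → NormalPos G.alg} (hm : IsApproxInvariant G m)
    (a : (C ⊗ᵥ N : VonNeumannAlgebra (HC ⊗ₕ HN))) :
    ∃ b : (C ⊗ᵥ N : VonNeumannAlgebra (HC ⊗ₕ HN)),
      ‖b‖ ≤ ‖a‖ ∧ Xi μ ω b = α.P u μ ω (Xi μ ω a) := by
  obtain ⟨b, hb, h⟩ := exists_ultraweak_limit (Ultrafilter.of (Filter.atTop : Filter ι))
    (fun i => α.avg u (m i).toDual a) ‖a‖ fun i => α.norm_avg_state_le u hu (hm.1 i) a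
  refine ⟨b, hb, ext_inner_left ℂ fun w => ?_⟩
  have h1 := h _ (XiFunctional_mem_predual μ ω w)
  have h2 := ((innerSL ℂ w).continuous.tendsto _).comp
    ((α.tendsto_Xi_avg u μ hu hω hcorep hm a).mono_left (Ultrafilter.of_le _))
  exact tendsto_nhds_unique h1 h2

include hu hω in
/-- The contraction `E_u` of `C ⊗ᵥ N` implemented by `P_u`. -/
theorem HopfAction.exists_expectation (hμ : μ.Faithful) (hωf : ω.Faithful)
    (hcorep : IsCorepresentation G u) {ι : Type*} [Preorder ι]
    [IsDirectedOrder ι] [Nonempty ι] {m : ι → NormalPos G.alg} (hm : IsApproxInvariant G m) :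
    ∃ E : (C ⊗ᵥ N : VonNeumannAlgebra (HC ⊗ₕ HN)) →L[ℂ]
      (C ⊗ᵥ N : VonNeumannAlgebra (HC ⊗ₕ HN)),
      ‖E‖ ≤ 1 ∧ ∀ a, Xi μ ω (E a) = α.P u μ ω (Xi μ ω a) := by
  choose E hE1 hE2 using α.exists_Xi_eq_P u μ hu hω hcorep hm
  have hinj := Xi_injective hμ hωf
  let E₀ : (C ⊗ᵥ N : VonNeumannAlgebra (HC ⊗ₕ HN)) →ₗ[ℂ]
      (C ⊗ᵥ N : VonNeumannAlgebra (HC ⊗ₕ HN)) :=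
    { toFun := E
      map_add' := fun a b => hinj (by rw [map_add, hE2, hE2, hE2, map_add, map_add])
      map_smul' := fun c a => hinj (by
        rw [RingHom.id_apply, map_smul, hE2, hE2, map_smul, map_smul]) }
  exact ⟨E₀.mkContinuous 1 fun a => by rw [one_mul]; exact hE1 a,
    E₀.mkContinuous_norm_le zero_le_one _, hE2⟩

theorem HopfAction.isNormalMap_expectation (hμ : μ.Faithful) (hωf : ω.Faithful)
    (E : (C ⊗ᵥ N : VonNeumannAlgebra (HC ⊗ₕ HN)) →L[ℂ] (C ⊗ᵥ N : VonNeumannAlgebra (HC ⊗ₕ HN)))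
    (hE : ∀ a, Xi μ ω (E a) = α.P u μ ω (Xi μ ω a)) : IsNormalMap E := by
  exact isNormalMap_of_Xi hμ hωf E _ (Submodule.starProjection_isSymmetric _) hE

/-- Ξ(N_u) is the image under `P` of the dense range of Ξ, and the range of `P` is closed as its set
of fixed vectors. -/
theorem HopfAction.closure_Xi_fixedSet
    (E : (C ⊗ᵥ N : VonNeumannAlgebra (HC ⊗ₕ HN)) →L[ℂ] (C ⊗ᵥ N : VonNeumannAlgebra (HC ⊗ₕ HN)))
    (hr : Set.range E = α.fixedSet u)
    (hE : ∀ a, Xi μ ω (E a) = α.P u μ ω (Xi μ ω a)) :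
    closure (Xi μ ω '' α.fixedSet u) = Set.range (α.P u μ ω) := by
  have h1 : Xi μ ω '' α.fixedSet u = α.P u μ ω '' Set.range (Xi μ ω) := by
    rw [← hr, ← Set.range_comp, ← Set.range_comp]
    exact congrArg Set.range (funext hE)
  have h2 : IsClosed (Set.range (α.P u μ ω)) := by
    have : Set.range (α.P u μ ω) = {ζ | α.P u μ ω ζ = ζ} := by
      ext ζ
      exact ⟨by rintro ⟨x, rfl⟩; exact α.P_P u μ x, fun h => ⟨ζ, h⟩⟩
    rw [this]
    exact isClosed_eq (α.P u μ ω).continuous continuous_id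
  rw [h1]
  refine subset_antisymm (closure_minimal (Set.image_subset_range _ _) h2) ?_
  rw [← Set.image_univ, ← (denseRange_Xi μ ω).closure_range]
  exact image_closure_subset_closure_image (α.P u μ ω).continuous

end MainTheorem

end QErg

end

theorem mainTheorem4
    {HG HN HC : Type*}
    [NormedAddCommGroup HG] [InnerProductSpace ℂ HG] [CompleteSpace HG]
    [NormedAddCommGroup HN] [InnerProductSpace ℂ HN] [CompleteSpace HN]
    [NormedAddCommGroup HC] [InnerProductSpace ℂ HC] [CompleteSpace HC]
    (G : HopfVonNeumannAlgebra HG)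
    (N : VonNeumannAlgebra HN) (α : HopfAction G N)
    (ω : NormalPos N) (hω : ω.IsState) (hωf : ω.Faithful) (hωα : α.Invariant ω)
    (C : VonNeumannAlgebra HC)
    (u : (C ⊗ᵥ G.alg : VonNeumannAlgebra (HC ⊗ₕ HG)))
    (hu : (u : HC ⊗ₕ HG →L[ℂ] HC ⊗ₕ HG) ∈ unitary (HC ⊗ₕ HG →L[ℂ] HC ⊗ₕ HG))
    (hcorep : IsCorepresentation G u)
    (μ : NormalPos C)
    {ι : Type*} [Preorder ι] [IsDirectedOrder ι] [Nonempty ι]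
    (m : ι → NormalPos G.alg) (hm : IsApproxInvariant G m) :
    (∀ θ : NormalPos G.alg, ∃! V, α.IsV u μ ω θ V) ∧
    (∀ ζ, Filter.Tendsto (fun i => α.V u μ ω (m i) ζ) Filter.atTop (nhds (α.P u μ ω ζ))) ∧
    (μ.Faithful →
      ∃ E : (C ⊗ᵥ N : VonNeumannAlgebra (HC ⊗ₕ HN)) →L[ℂ]
          (C ⊗ᵥ N : VonNeumannAlgebra (HC ⊗ₕ HN)),
        ((∀ a, E (E a) = E a) ∧ Set.range E = α.fixedSet u ∧
          ∀ a, Xi μ ω (E a) = α.P u μ ω (Xi μ ω a)) ∧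
        (∀ E' : (C ⊗ᵥ N : VonNeumannAlgebra (HC ⊗ₕ HN)) →ₗ[ℂ]
            (C ⊗ᵥ N : VonNeumannAlgebra (HC ⊗ₕ HN)),
          (∀ a, E' (E' a) = E' a) → Set.range E' = α.fixedSet u →
          (∀ a, Xi μ ω (E' a) = α.P u μ ω (Xi μ ω a)) → ∀ a, E' a = E a) ∧
        IsNormalMap E ∧
        (E ≠ 0 → ‖E‖ = 1) ∧
        (∀ (κ : Type*) [Preorder κ] [IsDirectedOrder κ] [Nonempty κ]
          (m' : κ → NormalPos G.alg), IsApproxInvariant G m' →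
          ∀ a : (C ⊗ᵥ N : VonNeumannAlgebra (HC ⊗ₕ HN)), ∀ ξ : HC ⊗ₕ HN,
            Filter.Tendsto (fun k => α.average u (m' k) a ξ) Filter.atTop
              (nhds ((E a : HC ⊗ₕ HN →L[ℂ] HC ⊗ₕ HN) ξ))) ∧
        closure (Xi μ ω '' α.fixedSet u) = Set.range (α.P u μ ω)) := by
  refine ⟨fun θ => α.existsUnique_V u μ hu hωα θ, α.tendsto_V u μ hu hωα hcorep hm, fun hμ => ?_⟩
  obtain ⟨E, hE1, hE⟩ := α.exists_expectation u μ hu hωα hμ hωf hcorep hm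
  have hinj := Xi_injective hμ hωf
  have hEE : ∀ a, E (E a) = E a := fun a => hinj (by rw [hE, hE, α.P_P])
  have hr : Set.range E = α.fixedSet u := by
    ext b
    rw [← α.P_Xi_eq_iff u μ hu hωα hμ hωf]
    constructor
    · rintro ⟨a, rfl⟩
      rw [hE, α.P_P]
    · intro h
      exact ⟨b, hinj ((hE b).trans h)⟩
  refine ⟨E, ⟨hEE, hr, hE⟩, fun E' _ _ h a => hinj ((h a).trans (hE a).symm),
    α.isNormalMap_expectation u μ hμ hωf E hE, fun h0 => le_antisymm hE1 ?_, ?_,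
    α.closure_Xi_fixedSet u μ E hr hE⟩
  · obtain ⟨a, ha⟩ : ∃ a, E a ≠ 0 := by
      by_contra! hcon
      exact h0 (ContinuousLinearMap.ext hcon)
    -- A nonzero idempotent fixes the nonzero vector E(a), so its norm is at least 1.
    have h := E.le_opNorm (E a)
    rw [hEE] at h
    exact le_of_mul_le_mul_right (by rwa [one_mul]) (norm_pos_iff.mpr ha)
  · intro κ _ _ _ m' hm' a ξ
    simp only [← α.coe_avg]
    refine tendsto_strong_of_Xi hμ hωf (fun k => α.avg u (m' k).toDual a) (E a) ‖a‖
      (fun k => α.norm_avg_state_le u hu (hm'.1 k) a) ?_ ξ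
    rw [hE]
    exact α.tendsto_Xi_avg u μ hu hωα hcorep hm' a
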